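/- Let $M\ge 1$, $L\in\mathbb{C}^{M\times M}$ (for instance a real matrix), $v\in\mathbb{C}^M$ with $\|v\|=1$ (Euclidean norm), $0\le\theta<\pi/2$, $h>0$, $\delta>0$, $\tau:=h/\delta$, and let $k\ge 0$, $m\ge 1$ be integers. Let $F(A)=\{x^HAx/x^Hx : x\neq 0\}$ denote the numerical range of a square complex matrix $A$, and assume that $F(L)\subset S_\theta:=\{\lambda\in\mathbb{C} : |\arg(-\lambda)|\le\theta\}$, where the vertex $0$ is included in $S_\theta$. Put $\varphi_0(\lambda)=e^{\lambda}$, $\varphi_{k+1}(\lambda)=(\varphi_k(\lambda)-1/k!)/\lambda$ (entire functions, $\varphi_k(\lambda)=\sum_{j\ge0}\lambda^j/(j+k)!$), $f_k(z)=\varphi_k(\tau(1-1/z))$, $Z=(I-\delta L)^{-1}$, and $G_\theta=\{(1-\delta\lambda)^{-1} : \lambda\in S_\theta\}$. Let $v_1=v,v_2,\dots$ be the vectors produced by the Arnoldi process for $Z$ and $v$, let $h_{i,j}=v_i^HZv_j$, $V_m=[v_1,\dots,v_m]$, $H_m=(h_{i,j})_{1\le i,j\le m}$, and assume that the process does not break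 down before step $m$, i.e. $h_{j+1,j}\neq0$ for $1\le j<m$ (if it breaks down at step $m$, put $v_{m+1}=0$, so that $h_{m+1,m}=0$). Let $$E_{k,m}=\varphi_k(hL)v-V_mf_k(H_m)e_1 .$$ Let $K$ be Crouzeix's constant, that is, the infimum of all real $K'$ such that $\|p(A)\|\le K'\max_{z\in F(A)}|p(z)|$ for all square complex matrices $A$ of any size and all complex polynomials $p$. Then $2\le K\le 11.08$, the function $z\mapsto\left|\frac{d^{m+k}}{dz^{m+k}}\bigl(f_0(z)z^k\bigr)\right|$ attains its maximum on $G_\theta$, and $$\|E_{k,m}\|\le \frac{K}{\tau^k(m+k)!}\,\max_{z\in G_\theta}\left|\frac{d^{m+k}}{dz^{m+k}}\bigl(f_0(z)z^k\bigr)\right|\,\prod_{i=1}^m h_{i+1,i}.$$ If $L$ is Hermitian (in particular if $L$ is real symmetric), the same bound holds with $K$ replaced by $1$. -/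

import Mathlib

open scoped Matrix

noncomputable section

namespace RDArnoldi

/-- A square complex matrix as an operator on `ℂ^n` with the Euclidean norm. Its norm is the
matrix norm induced by the Euclidean vector norm. -/
abbrev op {n : ℕ} (A : Matrix (Fin n) (Fin n) ℂ) :
    EuclideanSpace ℂ (Fin n) →L[ℂ] EuclideanSpace ℂ (Fin n) :=
  Matrix.toEuclideanCLM (n := Fin n) (𝕜 := ℂ) A

/-- The numerical range `F(A) = { xᴴAx / xᴴx : x ≠ 0 }`. -/
def numericalRange {n : ℕ} (A : Matrix (Fin n) (Fin n) ℂ) : Set ℂ :=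
  {z | ∃ x : EuclideanSpace ℂ (Fin n), x ≠ 0 ∧ z = inner ℂ x (op A x) / inner ℂ x x}

/-- `K` is an admissible constant in Crouzeix's inequality `‖p(A)‖ ≤ K max_{F(A)} |p|`, for all
square complex matrices `A` of any size and all complex polynomials `p`. The maximum is
expressed through its upper bounds `C`. -/
def IsCrouzeixBound (K : ℝ) : Prop :=
  ∀ (n : ℕ) (A : Matrix (Fin n) (Fin n) ℂ) (p : Polynomial ℂ) (C : ℝ), 0 ≤ C →
    (∀ z ∈ numericalRange A, ‖p.eval z‖ ≤ C) → ‖op (Polynomial.aeval A p)‖ ≤ K * C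

/-- Crouzeix's constant: the best constant in Crouzeix's inequality. -/
def crouzeixConstant : ℝ := sInf {K | IsCrouzeixBound K}

/-- The closed sector of semiangle `θ` around the negative real axis, with vertex `0`
(the vertex belongs to it, since `Complex.arg 0 = 0`). -/
def sector (θ : ℝ) : Set ℂ := {l | |Complex.arg (-l)| ≤ θ}

/-- The image of the sector under `l ↦ (1 - δ l)⁻¹`. -/
def lens (δ θ : ℝ) : Set ℂ := (fun l : ℂ => (1 - (δ : ℂ) * l)⁻¹) '' sector θ

/-- The functions `φ_k(a) = ∑_j a^j / (j+k)!`, for complex numbers and for complex matrices. On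
complex numbers they are given by `φ_0 = exp` and `φ_{k+1}(a) = (φ_k(a) - 1/k!) / a`, as
`phi_zero` and `phi_succ` show. -/
def phi {R : Type*} [Ring R] [Algebra ℂ R] [TopologicalSpace R] (k : ℕ) (a : R) : R :=
  ∑' j : ℕ, ((Nat.factorial (j + k) : ℂ)⁻¹) • a ^ j

/-- `f_k(a) = φ_k(τ (1 - a⁻¹))`, for complex numbers and for complex matrices. -/
def rdFun {R : Type*} [Ring R] [Algebra ℂ R] [TopologicalSpace R] (τ : ℝ) (k : ℕ) (a : R) : R :=
  phi k ((τ : ℂ) • (1 - Ring.inverse a))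

theorem phi_zero (a : ℂ) : phi 0 a = Complex.exp a := by
  rw [Complex.exp_eq_exp_ℂ, NormedSpace.exp_eq_tsum ℂ]
  simp [phi]

theorem phi_summable (k : ℕ) (a : ℂ) :
    Summable fun j : ℕ => ((Nat.factorial (j + k) : ℂ)⁻¹) • a ^ j := by
  refine Summable.of_norm_bounded (g := fun j : ℕ => ‖a‖ ^ j / (Nat.factorial j : ℝ))
    (Real.summable_pow_div_factorial ‖a‖) fun j => ?_
  rw [norm_smul, norm_inv, Complex.norm_natCast, norm_pow, div_eq_inv_mul]
  gcongr
  omega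

theorem phi_succ (k : ℕ) {a : ℂ} (ha : a ≠ 0) :
    phi (k + 1) a = (phi k a - (Nat.factorial k : ℂ)⁻¹) / a := by
  have h := (phi_summable k a).tsum_eq_zero_add
  rw [eq_div_iff ha, phi, phi, h, ← tsum_mul_right]
  simp only [zero_add, pow_zero, smul_eq_mul, mul_one, add_sub_cancel_left]
  refine tsum_congr fun j => ?_
  rw [show j + (k + 1) = j + 1 + k by omega, pow_succ]
  ring

variable {M : ℕ} (A : Matrix (Fin M) (Fin M) ℂ) (v : EuclideanSpace ℂ (Fin M))

/-- The vectors `v_1, v_2, …` (here with indices `0, 1, …`) of the Arnoldi process for the matrix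
`A` and the starting vector `v`: the vector `A v_j` is orthogonalized against `v_1, …, v_j`, and
the result is normalized (it stays `0` if it is `0`, when the process breaks down). -/
def arnoldiVec : ℕ → EuclideanSpace ℂ (Fin M)
  | 0 => v
  | j + 1 =>
    let w := op A (arnoldiVec j) -
      ∑ i : Fin (j + 1), inner ℂ (arnoldiVec i) (op A (arnoldiVec j)) • arnoldiVec i
    ((‖w‖ : ℂ)⁻¹) • w
  termination_by j => j
  decreasing_by all_goals omega

/-- The coefficients `h_{i,j} = v_iᴴ A v_j` of the Arnoldi process (indices from `0`). -/
def arnoldiCoeff (i j : ℕ) : ℂ := inner ℂ (arnoldiVec A v i) (op A (arnoldiVec A v j))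

theorem arnoldiVec_succ (j : ℕ) :
    arnoldiVec A v (j + 1) =
      ((‖op A (arnoldiVec A v j) -
        ∑ i : Fin (j + 1), arnoldiCoeff A v i j • arnoldiVec A v i‖ : ℂ)⁻¹) •
      (op A (arnoldiVec A v j) -
        ∑ i : Fin (j + 1), arnoldiCoeff A v i j • arnoldiVec A v i) := by
  rw [arnoldiVec]
  rfl

theorem arnoldiVec_orth (hv : ‖v‖ = 1) (j : ℕ) :
    (∀ i ≤ j, arnoldiVec A v i = 0 ∨ ‖arnoldiVec A v i‖ = 1) ∧
    (∀ i ≤ j, ∀ l ≤ j, i ≠ l → inner ℂ (arnoldiVec A v i) (arnoldiVec A v l) = 0) ∧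
    ∀ l ≤ j, inner ℂ (arnoldiVec A v l) (op A (arnoldiVec A v j) -
        ∑ i : Fin (j + 1), arnoldiCoeff A v i j • arnoldiVec A v i) = 0 := by
  have key : ∀ j, (∀ i ≤ j, arnoldiVec A v i = 0 ∨ ‖arnoldiVec A v i‖ = 1) →
      (∀ i ≤ j, ∀ l ≤ j, i ≠ l → inner ℂ (arnoldiVec A v i) (arnoldiVec A v l) = 0) →
      ∀ l ≤ j, inner ℂ (arnoldiVec A v l) (op A (arnoldiVec A v j) -
        ∑ i : Fin (j + 1), arnoldiCoeff A v i j • arnoldiVec A v i) = 0 := by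
    intro j h1 h2 l hl
    rw [inner_sub_right, inner_sum, Finset.sum_eq_single (⟨l, by omega⟩ : Fin (j + 1))]
    · rcases h1 l hl with h | h
      · simp [h]
      · rw [inner_smul_right, inner_self_eq_norm_sq_to_K, h]
        simp [arnoldiCoeff]
    · intro b _ hb
      rw [inner_smul_right, h2 l hl b (by omega) (fun h => hb (Fin.ext h.symm)), mul_zero]
    · simp
  induction j with
  | zero =>
    have h1 : ∀ i ≤ 0, arnoldiVec A v i = 0 ∨ ‖arnoldiVec A v i‖ = 1 := by
      intro i hi
      obtain rfl : i = 0 := by omega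
      right
      rw [arnoldiVec, hv]
    have h2 : ∀ i ≤ 0, ∀ l ≤ 0, i ≠ l →
        inner ℂ (arnoldiVec A v i) (arnoldiVec A v l) = 0 := by
      intro i hi l hl h
      omega
    exact ⟨h1, h2, key 0 h1 h2⟩
  | succ j ih =>
    obtain ⟨h1, h2, h3⟩ := ih
    have h1' : ∀ i ≤ j + 1, arnoldiVec A v i = 0 ∨ ‖arnoldiVec A v i‖ = 1 := by
      intro i hi
      rcases Nat.lt_or_ge j i with h | h
      · obtain rfl : i = j + 1 := by omega
        rw [arnoldiVec_succ]
        set w := op A (arnoldiVec A v j) -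
          ∑ i : Fin (j + 1), arnoldiCoeff A v i j • arnoldiVec A v i
        by_cases hw : w = 0
        · left
          simp [hw]
        · right
          rw [norm_smul, norm_inv, Complex.norm_real, norm_norm,
            inv_mul_cancel₀ (norm_ne_zero_iff.mpr hw)]
      · exact h1 i h
    have h4 : ∀ l ≤ j, inner ℂ (arnoldiVec A v l) (arnoldiVec A v (j + 1)) = 0 := by
      intro l hl
      rw [arnoldiVec_succ, inner_smul_right, h3 l hl, mul_zero]
    have h2' : ∀ i ≤ j + 1, ∀ l ≤ j + 1, i ≠ l →
        inner ℂ (arnoldiVec A v i) (arnoldiVec A v l) = 0 := by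
      intro i hi l hl h
      rcases Nat.lt_or_ge j i with h' | h'
      · obtain rfl : i = j + 1 := by omega
        rw [← inner_conj_symm, h4 l (by omega), map_zero]
      · rcases Nat.lt_or_ge j l with h'' | h''
        · obtain rfl : l = j + 1 := by omega
          exact h4 i h'
        · exact h2 i h' l h'' h
    exact ⟨h1', h2', key (j + 1) h1' h2'⟩

/-- The subdiagonal coefficients `h_{j+1,j}` are the normalization factors of the process; in
particular they are real and nonnegative, hence equal to their absolute values. -/
theorem arnoldiCoeff_succ (hv : ‖v‖ = 1) (j : ℕ) :
    arnoldiCoeff A v (j + 1) j = (‖op A (arnoldiVec A v j) -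
        ∑ i : Fin (j + 1), arnoldiCoeff A v i j • arnoldiVec A v i‖ : ℂ) := by
  have h3 := (arnoldiVec_orth A v hv j).2.2
  rw [arnoldiCoeff, arnoldiVec_succ]
  set w := op A (arnoldiVec A v j) -
    ∑ i : Fin (j + 1), arnoldiCoeff A v i j • arnoldiVec A v i with hw
  have h5 : op A (arnoldiVec A v j) =
      w + ∑ i : Fin (j + 1), arnoldiCoeff A v i j • arnoldiVec A v i := by
    rw [hw, sub_add_cancel]
  have h6 : inner ℂ w (∑ i : Fin (j + 1), arnoldiCoeff A v i j • arnoldiVec A v i) = 0 := by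
    rw [inner_sum]
    refine Finset.sum_eq_zero fun i _ => ?_
    rw [inner_smul_right, ← inner_conj_symm, h3 i (by omega), map_zero, mul_zero]
  rw [inner_smul_left, h5, inner_add_right, h6, add_zero, inner_self_eq_norm_sq_to_K]
  by_cases h : ‖w‖ = 0
  · simp [h]
  · have : (‖w‖ : ℂ) ≠ 0 := by exact_mod_cast h
    simp
    field_simp

/-- The matrix `V_m` with columns `v_1, …, v_m`. -/
def arnoldiBasis (m : ℕ) : Matrix (Fin M) (Fin m) ℂ := Matrix.of fun a j => arnoldiVec A v j a

/-- The upper Hessenberg matrix `H_m = (h_{i,j})`. -/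
def arnoldiHess (m : ℕ) : Matrix (Fin m) (Fin m) ℂ := Matrix.of fun i j => arnoldiCoeff A v i j

/-- The approximation `V_m f_k(H_m) e_1` to `f_k(A) v`. -/
def arnoldiApprox (τ : ℝ) (k m : ℕ) : EuclideanSpace ℂ (Fin M) :=
  WithLp.toLp 2 (arnoldiBasis A v m *ᵥ
    (rdFun τ k (arnoldiHess A v m) *ᵥ fun i : Fin m => if (i : ℕ) = 0 then 1 else 0))

/-- The matrix `Z = (I - δ L)⁻¹`. -/
def shiftInv (δ : ℝ) (L : Matrix (Fin M) (Fin M) ℂ) : Matrix (Fin M) (Fin M) ℂ :=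
  (1 - (δ : ℂ) • L)⁻¹

/-- The error `E_{k,m} = φ_k(hL) v - V_m f_k(H_m) e_1` of the restricted-denominator rational
Arnoldi method, where the Arnoldi process is run with `Z = (I - δ L)⁻¹` and `v`, and
`τ = h / δ`. -/
def rdError (L : Matrix (Fin M) (Fin M) ℂ) (v : EuclideanSpace ℂ (Fin M)) (h δ : ℝ) (k m : ℕ) :
    EuclideanSpace ℂ (Fin M) :=
  op (phi k ((h : ℂ) • L)) v - arnoldiApprox (shiftInv δ L) v (h / δ) k m

end RDArnoldi

end

/-! For a polynomial p the Arnoldi error has a closed form. Divide p by the characteristic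
polynomial q of H_m. The remainder has degree less than m and is reproduced exactly, while q(H_m) =
0 and q(Z)v = (∏ h_{i+1,i}) v_{m+1}. Hence the error is g(Z) applied to (∏ h_{i+1,i}) v_{m+1}, where
g is the quotient (`op_aeval_sub_arnoldiLin`). A K-spectral inequality on F(Z) then reduces
everything to a bound for |g| on a convex set S containing F(Z).

Put B = τ^k (z-1)^k p + t, where t = `taylorPart` has degree at most k. Then τ^k g is the quotient
of B by (z-1)^k q, up to a remainder of degree less than m+k. The m+k nodes, namely the eigenvalues
of H_m and k copies of 1, all lie in S, so |τ^k g| ≤ max |B^(m+k)|/(m+k)! (`norm_eval_quotient_le`).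
As p tends to f_k, Taylor's formula for the exponential shows that B tends to f_0(z) z^k.

The function f_k is singular at 0, but F(Z) is a compact subset of the open right half-plane. So S
can be the part of the lens in a half-plane Re z ≥ c > 0, and one sequence of polynomials converges
to f_k uniformly on a disk around S and also at Z and at H_m (`exists_polynomial_approx`). The lens
is convex: the sector is an intersection of half-planes, which λ ↦ 1/(1-δλ) turns into disks (or
half-planes), with the origin removed. The same inequalities for quadratic forms place F(Z) in the
lens.

Crouzeix's constant is bounded by 3. On a polygon around F(A) the Cauchy kernel has nonnegative real
part, which gives ‖p(A) + G(A)*‖ ≤ 2 max |p|, where G is the Cauchy transform of the conjugate of p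
(`norm_cauchy_add_adjoint_le`). The Ransford–Schwenninger argument turns this into M^4 ≤ 2M^3 + 3M^2
for the best constant M, hence M ≤ 3. A nilpotent 2×2 block gives the lower bound 2. For Hermitian L
the matrix Z is Hermitian, and the functional calculus gives the constant 1. -/

noncomputable section

namespace RDArnoldi

open Complex ComplexConjugate

/-! ### Numerical ranges: convexity, compactness, coercivity -/

section NumericalRange

variable {E : Type*} [NormedAddCommGroup E] [InnerProductSpace ℂ E]

/-- The numerical range of an operator, described by unit vectors. -/
def opRange (T : E →L[ℂ] E) : Set ℂ := {z | ∃ x : E, ‖x‖ = 1 ∧ inner ℂ x (T x) = z}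

theorem exists_opRange_inner_eq (T : E →L[ℂ] E) {x : E} (hx : x ≠ 0) :
    ∃ w ∈ opRange T, inner ℂ x (T x) = (‖x‖ : ℂ) ^ 2 * w := by
  have hn : (‖x‖ : ℂ) ≠ 0 := by simpa using hx
  refine ⟨_, ⟨((‖x‖ : ℂ)⁻¹) • x, ?_, rfl⟩, ?_⟩
  · rw [norm_smul, norm_inv, Complex.norm_real, norm_norm, inv_mul_cancel₀ (by simpa using hx)]
  · rw [map_smul, inner_smul_left, inner_smul_right, map_inv₀, Complex.conj_ofReal]
    field_simp

/-- Multiplying x by a suitable phase makes the sum of the two cross terms real. Along the segment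
from the rotated x to y the Rayleigh quotient is then real and continuous with end values 0 and 1,
so the intermediate value theorem applies. -/
theorem exists_unit_inner_eq (T : E →L[ℂ] E) {x y : E} (hx : ‖x‖ = 1) (hy : ‖y‖ = 1)
    (hTx : inner ℂ x (T x) = 0) (hTy : inner ℂ y (T y) = 1) {s : ℝ} (hs : s ∈ Set.Icc (0 : ℝ) 1) :
    (s : ℂ) ∈ opRange T := by
  obtain ⟨ω, hω, him⟩ : ∃ ω : ℂ, ‖ω‖ = 1 ∧
      (ω * (inner ℂ y (T x) - conj (inner ℂ x (T y)))).im = 0 := by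
    set d := inner ℂ y (T x) - conj (inner ℂ x (T y))
    by_cases hd : d = 0
    · exact ⟨1, by simp, by simp [hd]⟩
    · have hd' : (‖d‖ : ℂ) ≠ 0 := by simpa using hd
      refine ⟨conj d / ‖d‖, ?_, ?_⟩
      · simp [hd]
      · rw [div_mul_eq_mul_div, mul_comm, Complex.mul_conj, ← Complex.ofReal_div, Complex.ofReal_im]
  set u := ω • x
  have hu : ‖u‖ = 1 := by rw [norm_smul, hω, hx, one_mul]
  have hTu : inner ℂ u (T u) = 0 := by
    rw [map_smul, inner_smul_left, inner_smul_right, hTx, mul_zero, mul_zero]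
  set r : ℝ := (inner ℂ u (T y) + inner ℂ y (T u)).re
  have hr : inner ℂ u (T y) + inner ℂ y (T u) = r := by
    apply Complex.ext
    · simp [r]
    · have : (inner ℂ u (T y) + inner ℂ y (T u)).im = 0 := by
        rw [map_smul, inner_smul_left, inner_smul_right]
        rw [← him]
        simp only [Complex.add_im, Complex.mul_im, Complex.sub_re, Complex.sub_im,
          Complex.conj_re, Complex.conj_im]
        ring
      rw [this, Complex.ofReal_im]
  set z : ℝ → E := fun t => ((1 - t : ℝ) : ℂ) • u + (t : ℂ) • y
  have hz : ∀ t, inner ℂ (z t) (T (z t)) = ((t ^ 2 + t * (1 - t) * r : ℝ) : ℂ) := by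
    intro t
    simp only [z, map_add, map_smul, inner_add_left, inner_add_right, inner_smul_left,
      inner_smul_right, hTu, hTy, Complex.conj_ofReal]
    push_cast
    rw [← hr]
    ring
  -- The segment misses 0: otherwise y would be a multiple of u, and the quadratic form would vanish
  -- at y as it does at u.
  have hz0 : ∀ t, z t ≠ 0 := by
    intro t ht
    have ht0 : (t : ℂ) ≠ 0 := by
      intro h0
      have h0' : t = 0 := by exact_mod_cast h0
      simp only [z, h0', sub_zero, Complex.ofReal_one, one_smul, Complex.ofReal_zero, zero_smul,
        add_zero] at ht
      simp [ht] at hu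
    have hyu : y = (-((1 - t : ℝ) : ℂ) / t) • u := by
      have h2 : (t : ℂ) • y = (-((1 - t : ℝ) : ℂ)) • u := by
        rw [neg_smul]
        exact eq_neg_of_add_eq_zero_right ht
      rw [div_eq_inv_mul, mul_smul, ← h2, smul_smul, inv_mul_cancel₀ ht0, one_smul]
    rw [hyu, map_smul, inner_smul_left, inner_smul_right, hTu] at hTy
    simp at hTy
  set φ : ℝ → ℝ := fun t => (t ^ 2 + t * (1 - t) * r) / ‖z t‖ ^ 2
  have hφ : ContinuousOn φ (Set.Icc 0 1) := by
    refine Continuous.continuousOn (Continuous.div (by fun_prop) (by fun_prop) fun t => ?_)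
    exact pow_ne_zero 2 (norm_ne_zero_iff.mpr (hz0 t))
  have h0 : φ 0 = 0 := by simp [φ]
  have h1 : φ 1 = 1 := by simp [φ, z, hy]
  obtain ⟨t, -, ht⟩ := intermediate_value_Icc (zero_le_one) hφ (by rwa [h0, h1] : s ∈ _)
  obtain ⟨w, hw, hzw⟩ := exists_opRange_inner_eq T (hz0 t)
  have hn : (‖z t‖ : ℂ) ^ 2 ≠ 0 := pow_ne_zero 2 (by simpa using hz0 t)
  rw [hz] at hzw
  convert hw
  rw [← ht]
  simp only [φ]
  rw [Complex.ofReal_div, hzw, Complex.ofReal_pow]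
  exact mul_div_cancel_left₀ w hn

/-- The Toeplitz–Hausdorff theorem. -/
theorem convex_opRange (T : E →L[ℂ] E) : Convex ℝ (opRange T) := by
  rw [convex_iff_segment_subset]
  rintro _ ⟨x, hx, rfl⟩ _ ⟨y, hy, rfl⟩
  set α := inner ℂ x (T x) with hα
  set β := inner ℂ y (T y) with hβ
  rw [segment_eq_image']
  rintro _ ⟨s, hs, rfl⟩
  by_cases hαβ : β - α = 0
  · exact ⟨x, hx, by simp only [hαβ, smul_zero, add_zero]; rfl⟩
  -- An affine change of T sends α to 0 and β to 1, which reduces to the normalized case.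
  have hT : ∀ w : E, ‖w‖ = 1 → inner ℂ w (((β - α)⁻¹ • (T - α • ContinuousLinearMap.id ℂ E)) w) =
      (β - α)⁻¹ * (inner ℂ w (T w) - α) := by
    intro w hw
    simp [inner_self_eq_norm_sq_to_K, hw]
  obtain ⟨w, hw, hws⟩ := exists_unit_inner_eq _ hx hy
    (by rw [hT x hx, ← hα, sub_self, mul_zero]) (by rw [hT y hy, ← hβ, inv_mul_cancel₀ hαβ]) hs
  rw [hT w hw] at hws
  refine ⟨w, hw, ?_⟩
  simp only [Complex.real_smul, ← hws]
  field_simp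
  ring

theorem isCompact_opRange [FiniteDimensional ℂ E] (T : E →L[ℂ] E) : IsCompact (opRange T) := by
  have : ProperSpace E := FiniteDimensional.proper ℂ E
  have h : opRange T = (fun x : E => inner ℂ x (T x)) '' Metric.sphere 0 1 := by
    ext z
    simp [opRange]
  rw [h]
  exact (isCompact_sphere _ _).image (by fun_prop)

theorem opRange_nonempty [Nontrivial E] (T : E →L[ℂ] E) : (opRange T).Nonempty := by
  obtain ⟨x, hx⟩ := exists_ne (0 : E)
  obtain ⟨w, hw, -⟩ := exists_opRange_inner_eq T hx
  exact ⟨w, hw⟩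

theorem numericalRange_eq_opRange {n : ℕ} (A : Matrix (Fin n) (Fin n) ℂ) :
    numericalRange A = opRange (op A) := by
  ext z
  constructor
  · rintro ⟨x, hx, rfl⟩
    obtain ⟨w, hw, h⟩ := exists_opRange_inner_eq (op A) hx
    have hn : (‖x‖ : ℂ) ^ 2 ≠ 0 := pow_ne_zero 2 (by simpa using hx)
    convert hw
    rw [h, inner_self_eq_norm_sq_to_K]
    exact mul_div_cancel_left₀ w hn
  · rintro ⟨x, hx, rfl⟩
    refine ⟨x, fun h => by simp [h] at hx, ?_⟩
    rw [inner_self_eq_norm_sq_to_K, hx]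
    simp

/-- A real-linear lower bound on the numerical range is a lower bound on the quadratic form. -/
theorem re_mul_inner_ge (T : E →L[ℂ] E) {ω : ℂ} {c : ℝ} (h : ∀ z ∈ opRange T, c ≤ (ω * z).re)
    (x : E) : c * ‖x‖ ^ 2 ≤ (ω * inner ℂ x (T x)).re := by
  by_cases hx : x = 0
  · simp [hx]
  obtain ⟨w, hw, hxw⟩ := exists_opRange_inner_eq T hx
  rw [hxw, mul_left_comm, ← Complex.ofReal_pow, Complex.re_ofReal_mul, mul_comm]
  exact mul_le_mul_of_nonneg_left (h w hw) (by positivity)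

/-- An operator with coercive real part is a perturbation of a large multiple of the identity. -/
theorem norm_sub_smul_id_lt (T : E →L[ℂ] E) {c b : ℝ} (hc : 0 < c) (hb : ‖T‖ ≤ b)
    (h : ∀ x : E, c * ‖x‖ ^ 2 ≤ (inner ℂ x (T x)).re) {R : ℝ} (hR : b ^ 2 < 2 * c * R) :
    ‖T - algebraMap ℂ (E →L[ℂ] E) (R : ℂ)‖ < R := by
  have hR0 : 0 < R := by nlinarith [sq_nonneg b]
  -- In the expansion of ‖Tx - Rx‖², coercivity makes the cross term at most -2cR‖x‖², which
  -- outweighs ‖Tx‖² ≤ b²‖x‖².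
  have key : ‖T - algebraMap ℂ (E →L[ℂ] E) (R : ℂ)‖ ≤ √(R ^ 2 - (2 * c * R - b ^ 2)) := by
    refine ContinuousLinearMap.opNorm_le_bound _ (Real.sqrt_nonneg _) fun x => ?_
    have h1 : ‖(T - algebraMap ℂ (E →L[ℂ] E) (R : ℂ)) x‖ ^ 2 =
        ‖T x‖ ^ 2 - 2 * R * (inner ℂ x (T x)).re + R ^ 2 * ‖x‖ ^ 2 := by
      rw [sub_apply, @norm_sub_sq ℂ]
      simp only [Algebra.algebraMap_eq_smul_one, smul_apply,
        one_apply_eq_self, inner_smul_right, norm_smul, Complex.norm_real,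
        RCLike.re_eq_complex_re, Complex.re_ofReal_mul]
      rw [← inner_conj_symm, Complex.conj_re, Real.norm_of_nonneg hR0.le]
      ring
    have h2 : ‖T x‖ ≤ b * ‖x‖ := (T.le_opNorm x).trans (by gcongr)
    have h3 : ‖T x‖ ^ 2 ≤ b ^ 2 * ‖x‖ ^ 2 := by
      rw [← mul_pow]
      gcongr
    have h4 : ‖(T - algebraMap ℂ (E →L[ℂ] E) (R : ℂ)) x‖ ^ 2 ≤
        (R ^ 2 - (2 * c * R - b ^ 2)) * ‖x‖ ^ 2 := by
      rw [h1]
      nlinarith [h x]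
    rw [← Real.sqrt_sq (norm_nonneg x), ← Real.sqrt_mul' _ (by positivity)]
    exact Real.le_sqrt_of_sq_le h4
  refine key.trans_lt ?_
  rw [Real.sqrt_lt' hR0]
  linarith

end NumericalRange

/-! ### Invertibility by the Neumann series -/

section Perturbation

variable {A : Type*} [NormedRing A] [NormedAlgebra ℂ A] [CompleteSpace A]

/-- Only completeness of the algebra is used. Applied to a closed subalgebra, this produces an
inverse inside that subalgebra, hence a limit of polynomials when the subalgebra is generated by one
element. -/
theorem isUnit_of_norm_sub_algebraMap_lt {a : A} {c : ℂ}
    (h : ‖a - algebraMap ℂ A c‖ < ‖c‖) : IsUnit a := by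
  have hc : c ≠ 0 := by
    rintro rfl
    simpa using (norm_nonneg _).trans_lt h
  have h1 : ‖c⁻¹ • (algebraMap ℂ A c - a)‖ < 1 := by
    rw [norm_smul, norm_inv, norm_sub_rev, inv_mul_lt_one₀ (norm_pos_iff.mpr hc)]
    exact h
  have h2 : IsUnit (1 - c⁻¹ • (algebraMap ℂ A c - a)) := (Units.oneSub _ h1).isUnit
  have h3 : a = algebraMap ℂ A c * (1 - c⁻¹ • (algebraMap ℂ A c - a)) := by
    rw [← Algebra.smul_def, smul_sub, smul_smul, mul_inv_cancel₀ hc, one_smul,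
      Algebra.algebraMap_eq_smul_one]
    abel
  rw [h3]
  exact ((IsUnit.mk0 c hc).map (algebraMap ℂ A)).mul h2

end Perturbation

/-! ### Polygons around a compact convex set -/

section Polygon

/-- The point with parameter `t` on the `j`-th edge of the polygon with vertices `w 0, w 1, …`. -/
def edge (w : ℕ → ℂ) (j : ℕ) (t : ℝ) : ℂ := w j + t * (w (j + 1) - w j)

theorem continuous_edge (w : ℕ → ℂ) (j : ℕ) : Continuous (edge w j) := by
  unfold edge
  fun_prop

theorem hasDerivAt_edge (w : ℕ → ℂ) (j : ℕ) (t : ℝ) :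
    HasDerivAt (edge w j) (w (j + 1) - w j) t := by
  have h := ((Complex.ofRealCLM.hasDerivAt (x := t)).mul_const (w (j + 1) - w j)).const_add (w j)
  exact h.congr_deriv (by simp)

/-- The integral over the first `n` edges of the polygon with vertices `w 0, w 1, …`. -/
def polyIntegral {X : Type*} [NormedAddCommGroup X] [NormedSpace ℂ X] (n : ℕ) (w : ℕ → ℂ)
    (F : ℂ → X) : X :=
  ∑ j ∈ Finset.range n, ∫ t in (0 : ℝ)..1, (w (j + 1) - w j) • F (edge w j t)

/-- A compact convex set `W` lies strictly to the left of all edges of the closed polygon with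
vertices `w 0, …, w n = w 0`, and the polygon winds once around it. -/
structure Encloses (n : ℕ) (w : ℕ → ℂ) (W : Set ℂ) : Prop where
  closed : w n = w 0
  left : ∀ j < n, ∃ c > 0, ∀ z ∈ W, ∀ t, c ≤ (conj (w (j + 1) - w j) * (z - edge w j t)).im
  winding : ∃ z₀ ∈ W, polyIntegral n w (fun σ => (σ - z₀)⁻¹) = 2 * Real.pi * I

/-- After division by a, the segment starts at 1 and then stays in the open upper half-plane, so the
principal logarithm is a primitive along it. -/
theorem integral_edge_inv {a b : ℂ} (h : 0 < (conj a * b).im) :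
    ∫ t in (0 : ℝ)..1, (b - a) / (a + t * (b - a)) = Complex.log (b / a) := by
  have ha : a ≠ 0 := by
    rintro rfl
    simp at h
  have him : 0 < (b / a).im := by
    have : b / a = ((normSq a)⁻¹ : ℝ) * (conj a * b) := by
      rw [div_eq_mul_inv, Complex.inv_def]
      ring
    rw [this, Complex.im_ofReal_mul]
    exact mul_pos (inv_pos.mpr (normSq_pos.mpr ha)) h
  have hslit : ∀ t ∈ Set.uIcc (0 : ℝ) 1, 1 + (t : ℂ) * (b / a - 1) ∈ slitPlane := by
    intro t ht
    rw [Set.uIcc_of_le zero_le_one] at ht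
    rcases ht.1.eq_or_lt with rfl | h0
    · simp
    · right
      simp only [Complex.add_im, Complex.one_im, Complex.im_ofReal_mul, Complex.sub_im, sub_zero,
        zero_add]
      positivity
  have hne : ∀ t ∈ Set.uIcc (0 : ℝ) 1, a + t * (b - a) ≠ 0 := by
    intro t ht h0
    apply slitPlane_ne_zero (hslit t ht)
    field_simp
    linear_combination h0
  rw [intervalIntegral.integral_eq_sub_of_hasDerivAt
    (f := fun t : ℝ => Complex.log (1 + (t : ℂ) * (b / a - 1)))]
  · simp
  · intro t ht
    have h1 : HasDerivAt (fun t : ℝ => 1 + (t : ℂ) * (b / a - 1)) (b / a - 1) t := by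
      simpa using ((Complex.ofRealCLM.hasDerivAt (x := t)).mul_const (b / a - 1)).const_add 1
    refine (h1.clog_real (hslit t ht)).congr_deriv ?_
    have := slitPlane_ne_zero (hslit t ht)
    rw [eq_comm]
    rw [div_eq_div_iff (hne t ht) this]
    field_simp
  · refine ContinuousOn.intervalIntegrable (ContinuousOn.div (by fun_prop) (by fun_prop) hne)

/-- A set inside a convex set `S` at distance `δ` from the boundary lies on the left of every
chord of length less than `δ`. -/
theorem left_of_chord {S W : Set ℂ} {δ : ℝ} (hS : Convex ℝ S) (hW : Convex ℝ W) (h0 : 0 ∈ W)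
    (hδ : 0 < δ) (hWS : ∀ z ∈ W, Metric.ball z δ ⊆ S) {a b : ℂ} (haS : a ∈ S) (hbS : b ∈ S)
    (ha : a ∉ interior S) (hb : b ∉ interior S) (hab : dist a b < δ) (him : 0 < (conj a * b).im)
    {y : ℂ} (hy : y ∈ W) : 0 < (conj (b - a) * (y - a)).im := by
  by_contra! hneg
  have hint : ∀ z ∈ W, Metric.ball z δ ⊆ interior S := fun z hz =>
    interior_maximal (hWS z hz) Metric.isOpen_ball
  have hba : b - a ≠ 0 := by
    intro h
    rw [sub_eq_zero.mp h, mul_comm, Complex.mul_conj, Complex.ofReal_im] at him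
    exact him.false
  set g₀ := (conj a * b).im
  set g₁ := (conj (b - a) * (y - a)).im with hg₁
  -- The signed distance to the line ab is affine on the segment from 0 to y, with end values
  -- proportional to g₀ > 0 and g₁ ≤ 0. Its zero l gives a point of W on that line.
  set l := g₀ / (g₀ - g₁) with hl
  have hl0 : 0 ≤ l := div_nonneg him.le (by linarith)
  have hl1 : l ≤ 1 := (div_le_one (by linarith)).mpr (by linarith)
  set z : ℂ := l * y with hz
  have hzW : z ∈ W := by
    have := hW h0 hy (sub_nonneg.mpr hl1) hl0 (by ring)
    simpa [hz] using this
  have hzG : (conj (b - a) * (z - a)).im = 0 := by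
    have h1 : (conj (b - a) * (z - a)).im = (1 - l) * g₀ + l * g₁ := by
      simp only [hz, hg₁, g₀, Complex.mul_im, Complex.sub_re, Complex.sub_im, Complex.conj_re,
        Complex.conj_im, map_sub, Complex.ofReal_re, Complex.ofReal_im, Complex.mul_re]
      ring
    rw [h1, hl]
    have : g₀ - g₁ ≠ 0 := by linarith
    field_simp
    ring
  obtain ⟨t, ht⟩ : ∃ t : ℝ, z = a + t * (b - a) := by
    refine ⟨(conj (b - a) * (z - a)).re / normSq (b - a), ?_⟩
    have h2 : conj (b - a) * (z - a) = ((conj (b - a) * (z - a)).re : ℂ) := by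
      apply Complex.ext <;> simp only [hzG, Complex.ofReal_re, Complex.ofReal_im]
    have h3 : (normSq (b - a) : ℂ) ≠ 0 := by
      simpa [normSq_eq_zero] using hba
    rw [Complex.ofReal_div, ← h2]
    field_simp
    rw [← Complex.mul_conj]
    ring
  have hzi : z ∈ interior S := hint z hzW (Metric.mem_ball_self hδ)
  -- If z lies outside the chord, the endpoint nearer to z is strictly between the interior point z
  -- and the other endpoint, hence interior. If z lies on the chord, then a is within δ of z, hence
  -- interior. Both contradict the choice of a and b.
  rcases lt_or_ge t 0 with ht0 | ht0
  · apply ha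
    apply hS.openSegment_interior_self_subset_interior hzi hbS
    refine ⟨1 / (1 - t), -t / (1 - t), by apply div_pos <;> linarith, by apply div_pos <;> linarith,
      ?_, ?_⟩
    · rw [← add_div, ← sub_eq_add_neg, div_self (by linarith)]
    · rw [ht]
      simp only [Complex.real_smul]
      have : (1 - t : ℂ) ≠ 0 := by
        exact_mod_cast (by linarith : (1 - t : ℝ) ≠ 0)
      push_cast
      field_simp
      ring
  rcases le_or_gt t 1 with ht1 | ht1
  · apply ha
    apply hint z hzW
    rw [Metric.mem_ball, dist_comm, dist_eq_norm, ht, add_sub_cancel_left, norm_mul,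
      Complex.norm_real, Real.norm_of_nonneg ht0, ← dist_eq_norm, dist_comm]
    exact (mul_le_of_le_one_left dist_nonneg ht1).trans_lt hab
  · apply hb
    apply hS.openSegment_interior_self_subset_interior hzi haS
    refine ⟨1 / t, (t - 1) / t, by positivity, div_pos (by linarith) (by linarith), ?_, ?_⟩
    · field_simp
      ring
    · rw [ht]
      simp only [Complex.real_smul]
      have : (t : ℂ) ≠ 0 := by
        exact_mod_cast (by linarith : t ≠ 0)
      push_cast
      field_simp
      ring

/-- The boundary of the thickening, seen from z₀ in W, is parametrized continuously by angle through
the gauge. Sampling at n equal angles gives an inscribed polygon; its chords stay in the thickening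
by convexity, and when they are shorter than δ they leave W on the left. -/
theorem exists_encloses_cthickening {W : Set ℂ} (hW : Convex ℝ W) (hK : IsCompact W)
    (hne : W.Nonempty) {δ : ℝ} (hδ : 0 < δ) :
    ∃ (n : ℕ) (w : ℕ → ℂ), Encloses n w W ∧
      ∀ j < n, ∀ t ∈ Set.Icc (0 : ℝ) 1, edge w j t ∈ Metric.cthickening δ W := by
  obtain ⟨z₀, hz₀⟩ := hne
  set S : Set ℂ := (fun x => z₀ + x) ⁻¹' Metric.cthickening δ W with hSdef
  set W' : Set ℂ := (fun x => z₀ + x) ⁻¹' W with hWdef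
  have hS : Convex ℝ S := (hW.cthickening δ).translate_preimage_right z₀
  have hW' : Convex ℝ W' := hW.translate_preimage_right z₀
  have h0 : (0 : ℂ) ∈ W' := by simpa [hWdef] using hz₀
  have hball : ∀ z ∈ W', Metric.ball z δ ⊆ S := by
    intro z hz x hx
    apply Metric.thickening_subset_cthickening
    rw [Metric.mem_thickening_iff]
    exact ⟨z₀ + z, hz, by simpa using hx⟩
  have hnhds : S ∈ nhds 0 := Filter.mem_of_superset (Metric.ball_mem_nhds 0 hδ) (hball 0 h0)
  have hcl : IsClosed S := Metric.isClosed_cthickening.preimage (by fun_prop)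
  have hbdd : Bornology.IsBounded S := by
    have h1 : S = (fun x => -z₀ + x) '' Metric.cthickening δ W := by
      ext x
      simp [hSdef]
    rw [h1]
    exact (hK.cthickening.image (by fun_prop)).isBounded
  set e : ℝ → ℂ := fun s => Complex.exp (s * I) with he
  have hene : ∀ s, e s ≠ 0 := fun s => Complex.exp_ne_zero _
  have hgpos : ∀ s, 0 < gauge S (e s) := fun s =>
    (gauge_pos (absorbent_nhds_zero hnhds)
      (NormedSpace.isVonNBounded_iff ℝ |>.mpr hbdd)).mpr (hene s)
  set ρ : ℝ → ℝ := fun s => (gauge S (e s))⁻¹ with hρ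
  have hρpos : ∀ s, 0 < ρ s := fun s => inv_pos.mpr (hgpos s)
  set x : ℝ → ℂ := fun s => ρ s * e s with hx
  have hxc : Continuous x := by
    have : Continuous ρ := Continuous.inv₀ ((continuous_gauge hS hnhds).comp (by fun_prop))
      fun s => (hgpos s).ne'
    fun_prop
  have hfr : ∀ s, x s ∈ frontier S := by
    intro s
    rw [← gauge_eq_one_iff_mem_frontier hS hnhds, hx]
    simp only
    rw [← Complex.real_smul, gauge_smul_of_nonneg (hρpos s).le, smul_eq_mul, hρ]
    exact inv_mul_cancel₀ (hgpos s).ne'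
  have hxS : ∀ s, x s ∈ S := fun s => hcl.frontier_subset (hfr s)
  have hxi : ∀ s, x s ∉ interior S := fun s => (hfr s).2
  have huc := isCompact_Icc.uniformContinuousOn_of_continuous
    (hxc.continuousOn (s := Set.Icc 0 (2 * Real.pi)))
  rw [Metric.uniformContinuousOn_iff] at huc
  obtain ⟨η, hη, huc⟩ := huc δ hδ
  have hpi := Real.pi_pos
  -- n > 2 keeps the angular step below π, so consecutive vertices turn counterclockwise; n > 2π/η
  -- makes the chords shorter than δ.
  obtain ⟨n, hn⟩ := exists_nat_gt (max 2 (2 * Real.pi / η))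
  have hn2 : (2 : ℝ) < n := (le_max_left _ _).trans_lt hn
  have hn0 : (0 : ℝ) < n := by linarith
  have hnη : 2 * Real.pi / n < η := by
    have := (le_max_right _ _).trans_lt hn
    rw [div_lt_iff₀ hη] at this
    rw [div_lt_iff₀ hn0]
    linarith
  set s : ℕ → ℝ := fun j => 2 * Real.pi * j / n with hs
  have hs1 : ∀ j, s (j + 1) = s j + 2 * Real.pi / n := by
    intro j
    simp only [hs]
    push_cast
    ring
  have hsI : ∀ j ≤ n, s j ∈ Set.Icc 0 (2 * Real.pi) := by
    intro j hj
    refine ⟨by positivity, ?_⟩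
    simp only [hs]
    rw [div_le_iff₀ hn0]
    have : (j : ℝ) ≤ n := by exact_mod_cast hj
    gcongr
  have hsn : s n = 2 * Real.pi := by
    simp only [hs]
    field_simp
  have hs0 : s 0 = 0 := by simp [hs]
  have hen : e (s n) = e (s 0) := by simp [he, hsn, hs0]
  have hρn : ρ (s n) = ρ (s 0) := by simp only [hρ, hen]
  have hang : 2 * Real.pi / n < Real.pi := by
    rw [div_lt_iff₀ hn0]
    nlinarith
  have heq : ∀ j, e (s (j + 1)) = Complex.exp ((2 * Real.pi / n : ℝ) * I) * e (s j) := by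
    intro j
    simp only [he, hs1]
    rw [← Complex.exp_add]
    congr 1
    push_cast
    ring
  have hcross : ∀ j, 0 < (conj (x (s j)) * x (s (j + 1))).im := by
    intro j
    have h1 : conj (x (s j)) * x (s (j + 1)) =
        ((ρ (s j) * ρ (s (j + 1)) * normSq (e (s j)) : ℝ) : ℂ) *
          Complex.exp ((2 * Real.pi / n : ℝ) * I) := by
      simp only [hx, heq, map_mul, Complex.conj_ofReal]
      push_cast
      rw [← Complex.mul_conj]
      ring
    rw [h1, Complex.im_ofReal_mul, Complex.exp_ofReal_mul_I_im]
    exact mul_pos (mul_pos (mul_pos (hρpos _) (hρpos _)) (normSq_pos.mpr (hene _)))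
      (Real.sin_pos_of_pos_of_lt_pi (by positivity) hang)
  have hdist : ∀ j < n, dist (x (s j)) (x (s (j + 1))) < δ := by
    intro j hj
    apply huc _ (hsI j hj.le) _ (hsI (j + 1) hj)
    rw [hs1, dist_self_add_right, Real.norm_of_nonneg (by positivity)]
    exact hnη
  refine ⟨n, fun j => z₀ + x (s j), ⟨?_, ?_, z₀, hz₀, ?_⟩, ?_⟩
  · simp only [hx, hρn, hen]
  · intro j hj
    have hpos : ∀ z ∈ W, 0 < (conj (x (s (j + 1)) - x (s j)) * (z - z₀ - x (s j))).im := by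
      intro z hz
      exact left_of_chord hS hW' h0 hδ hball (hxS _) (hxS _) (hxi _) (hxi _) (hdist j hj)
        (hcross j) (y := z - z₀) (by simpa [hWdef] using hz)
    obtain ⟨z₁, hz₁, hmin⟩ := hK.exists_isMinOn ⟨z₀, hz₀⟩
      (f := fun z => (conj (x (s (j + 1)) - x (s j)) * (z - z₀ - x (s j))).im) (by fun_prop)
    refine ⟨_, hpos z₁ hz₁, fun z hz t => (hmin hz).trans_eq ?_⟩
    simp only [edge, add_sub_add_left_eq_sub]
    simp only [Complex.mul_im, Complex.sub_re, Complex.sub_im, Complex.conj_re, Complex.add_re,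
      Complex.add_im, Complex.conj_im, Complex.ofReal_re, Complex.ofReal_im, Complex.mul_re]
    ring
  -- Each edge contributes the logarithm of the ratio of its end vertices: the moduli telescope
  -- around the closed polygon and the n angles 2π/n add up to 2π.
  · have h1 : ∀ j, ∫ t in (0 : ℝ)..1, (z₀ + x (s (j + 1)) - (z₀ + x (s j))) •
        (edge (fun j => z₀ + x (s j)) j t - z₀)⁻¹ =
        ((Real.log (ρ (s (j + 1))) - Real.log (ρ (s j)) : ℝ) : ℂ) + (2 * Real.pi / n : ℝ) * I := by
      intro j
      have h2 := integral_edge_inv (hcross j)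
      have h3 : x (s (j + 1)) / x (s j) =
          ((ρ (s (j + 1)) / ρ (s j) : ℝ) : ℂ) * Complex.exp ((2 * Real.pi / n : ℝ) * I) := by
        simp only [hx, heq]
        have := hene (s j)
        have h4 : (ρ (s j) : ℂ) ≠ 0 := by exact_mod_cast (hρpos (s j)).ne'
        push_cast
        field_simp
      have h5 : (2 * Real.pi / n : ℝ) > 0 := by positivity
      have him : ((2 * Real.pi / n : ℝ) * I).im = 2 * Real.pi / n := by
        rw [Complex.im_ofReal_mul, I_im, mul_one]
      rw [h3, Complex.log_ofReal_mul (div_pos (hρpos _) (hρpos _)) (Complex.exp_ne_zero _),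
        Complex.log_exp (by rw [him]; linarith) (by rw [him]; linarith),
          Real.log_div (hρpos _).ne' (hρpos _).ne'] at h2
      rw [← h2]
      congr 1
      ext t
      simp only [edge, add_sub_add_left_eq_sub, smul_eq_mul, div_eq_mul_inv]
      congr 2
      ring
    simp only [polyIntegral]
    rw [Finset.sum_congr rfl fun j _ => h1 j, Finset.sum_add_distrib, ← Complex.ofReal_sum,
      Finset.sum_range_sub (fun j => Real.log (ρ (s j))), hρn, sub_self, Finset.sum_const,
      Finset.card_range, nsmul_eq_mul]
    have : (n : ℂ) ≠ 0 := by exact_mod_cast hn0.ne'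
    push_cast
    field_simp
    ring
  · intro j hj t ht
    have h1 := hS (hxS (s j)) (hxS (s (j + 1))) (sub_nonneg.mpr ht.2) ht.1 (by ring)
    rw [hSdef, Set.mem_preimage] at h1
    convert h1 using 1
    simp only [edge, Complex.real_smul]
    push_cast
    ring

end Polygon

/-! ### Calculus of integrals along polygons -/

section PolyIntegral

/-- The union of the first `n` edges of a polygon. -/
def polyTrace (n : ℕ) (w : ℕ → ℂ) : Set ℂ := ⋃ j ∈ Finset.range n, edge w j '' Set.Icc 0 1

theorem isCompact_polyTrace (n : ℕ) (w : ℕ → ℂ) : IsCompact (polyTrace n w) :=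
  (Finset.range n).isCompact_biUnion fun j _ => isCompact_Icc.image (continuous_edge w j)

theorem edge_mem_polyTrace {n : ℕ} (w : ℕ → ℂ) {j : ℕ} (hj : j < n) {t : ℝ}
    (ht : t ∈ Set.Icc (0 : ℝ) 1) : edge w j t ∈ polyTrace n w :=
  Set.mem_biUnion (Finset.mem_range.mpr hj) ⟨t, ht, rfl⟩

theorem mem_polyTrace {n : ℕ} {w : ℕ → ℂ} {σ : ℂ} :
    σ ∈ polyTrace n w ↔ ∃ j < n, ∃ t ∈ Set.Icc (0 : ℝ) 1, edge w j t = σ := by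
  simp [polyTrace]

variable {X Y : Type*} [NormedAddCommGroup X] [NormedSpace ℂ X] [NormedAddCommGroup Y]
  [NormedSpace ℂ Y] {n : ℕ} {w : ℕ → ℂ}

theorem continuousOn_comp_edge {Z : Type*} [TopologicalSpace Z] {n : ℕ} {w : ℕ → ℂ}
    {F : ℂ → Z} (hF : ContinuousOn F (polyTrace n w)) {j : ℕ}
    (hj : j < n) : ContinuousOn (fun t => F (edge w j t)) (Set.Icc 0 1) :=
  hF.comp (continuous_edge w j).continuousOn fun _ ht => edge_mem_polyTrace w hj ht

theorem intervalIntegrable_edge {F : ℂ → X} (hF : ContinuousOn F (polyTrace n w)) {j : ℕ}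
    (hj : j < n) : IntervalIntegrable (fun t => (w (j + 1) - w j) • F (edge w j t))
      MeasureTheory.volume 0 1 := by
  apply ContinuousOn.intervalIntegrable
  rw [Set.uIcc_of_le zero_le_one]
  exact (continuousOn_comp_edge hF hj).const_smul _

theorem polyIntegral_congr {F G : ℂ → X} (h : Set.EqOn F G (polyTrace n w)) :
    polyIntegral n w F = polyIntegral n w G := by
  refine Finset.sum_congr rfl fun j hj => intervalIntegral.integral_congr fun t ht => ?_
  rw [Set.uIcc_of_le zero_le_one] at ht
  simp only [h (edge_mem_polyTrace w (Finset.mem_range.mp hj) ht)]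

theorem polyIntegral_add {F G : ℂ → X} (hF : ContinuousOn F (polyTrace n w))
    (hG : ContinuousOn G (polyTrace n w)) :
    polyIntegral n w (fun σ => F σ + G σ) = polyIntegral n w F + polyIntegral n w G := by
  simp only [polyIntegral, smul_add]
  rw [← Finset.sum_add_distrib]
  exact Finset.sum_congr rfl fun j hj => intervalIntegral.integral_add
    (intervalIntegrable_edge hF (Finset.mem_range.mp hj))
    (intervalIntegrable_edge hG (Finset.mem_range.mp hj))

theorem polyIntegral_smul (c : ℂ) (F : ℂ → X) :
    polyIntegral n w (fun σ => c • F σ) = c • polyIntegral n w F := by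
  simp only [polyIntegral, smul_comm _ c, intervalIntegral.integral_smul, Finset.smul_sum]

theorem polyIntegral_sub {F G : ℂ → X} (hF : ContinuousOn F (polyTrace n w))
    (hG : ContinuousOn G (polyTrace n w)) :
    polyIntegral n w (fun σ => F σ - G σ) = polyIntegral n w F - polyIntegral n w G := by
  simp only [polyIntegral, smul_sub]
  rw [← Finset.sum_sub_distrib]
  exact Finset.sum_congr rfl fun j hj => intervalIntegral.integral_sub
    (intervalIntegrable_edge hF (Finset.mem_range.mp hj))
    (intervalIntegrable_edge hG (Finset.mem_range.mp hj))

theorem re_polyIntegral_nonneg {F : ℂ → ℂ} (hF : ContinuousOn F (polyTrace n w))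
    (h : ∀ j < n, ∀ t ∈ Set.Icc (0 : ℝ) 1, 0 ≤ ((w (j + 1) - w j) * F (edge w j t)).re) :
    0 ≤ (polyIntegral n w F).re := by
  rw [polyIntegral, Complex.re_sum]
  refine Finset.sum_nonneg fun j hj => ?_
  have h1 := Complex.reCLM.intervalIntegral_comp_comm
    (intervalIntegrable_edge hF (Finset.mem_range.mp hj))
  rw [Complex.reCLM_apply] at h1
  rw [← h1]
  exact intervalIntegral.integral_nonneg zero_le_one fun t ht => h j (Finset.mem_range.mp hj) t ht

theorem clm_polyIntegral [CompleteSpace X] [CompleteSpace Y] (L : X →L[ℂ] Y) {F : ℂ → X}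
    (hF : ContinuousOn F (polyTrace n w)) :
    L (polyIntegral n w F) = polyIntegral n w (fun σ => L (F σ)) := by
  simp only [polyIntegral, map_sum]
  refine Finset.sum_congr rfl fun j hj => ?_
  rw [← L.intervalIntegral_comp_comm (intervalIntegrable_edge hF (Finset.mem_range.mp hj))]
  simp only [map_smul]

theorem norm_polyIntegral_le {F : ℂ → X} {C : ℝ} (hC : ∀ σ ∈ polyTrace n w, ‖F σ‖ ≤ C) :
    ‖polyIntegral n w F‖ ≤ C * ∑ j ∈ Finset.range n, ‖w (j + 1) - w j‖ := by
  rw [Finset.mul_sum]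
  refine norm_sum_le_of_le _ fun j hj => ?_
  have := intervalIntegral.norm_integral_le_of_norm_le_const (a := (0 : ℝ)) (b := 1)
    (f := fun t => (w (j + 1) - w j) • F (edge w j t)) (C := C * ‖w (j + 1) - w j‖) ?_
  · simpa using this
  · intro t ht
    rw [Set.uIoc_of_le zero_le_one] at ht
    rw [norm_smul, mul_comm]
    exact mul_le_mul_of_nonneg_right
      (hC _ (edge_mem_polyTrace w (Finset.mem_range.mp hj) (Set.Ioc_subset_Icc_self ht)))
      (norm_nonneg _)

theorem polyIntegral_eq_zero [CompleteSpace X] (hw : w n = w 0) {F G : ℂ → X}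
    (hF : ContinuousOn F (polyTrace n w)) (hG : ∀ σ ∈ polyTrace n w, HasDerivAt G (F σ) σ) :
    polyIntegral n w F = 0 := by
  have h : ∀ j ∈ Finset.range n, ∫ t in (0 : ℝ)..1, (w (j + 1) - w j) • F (edge w j t) =
      G (w (j + 1)) - G (w j) := by
    intro j hj
    rw [intervalIntegral.integral_eq_sub_of_hasDerivAt (f := fun t => G (edge w j t)) ?_
      (intervalIntegrable_edge hF (Finset.mem_range.mp hj))]
    · simp [edge]
    · intro t ht
      rw [Set.uIcc_of_le zero_le_one] at ht
      exact (hG _ (edge_mem_polyTrace w (Finset.mem_range.mp hj) ht)).scomp t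
        (hasDerivAt_edge w j t)
  rw [polyIntegral, Finset.sum_congr rfl h, Finset.sum_range_sub (fun j => G (w j)), hw, sub_self]

/-- With N+1 equal steps the total variation is at most C/(N+1), which tends to 0. This replaces
differentiation with respect to the homotopy parameter. -/
theorem eq_of_norm_sub_le_sq {Z : Type*} [NormedAddCommGroup Z] {f : ℝ → Z} {C : ℝ}
    (h : ∀ s ∈ Set.Icc (0 : ℝ) 1, ∀ s' ∈ Set.Icc (0 : ℝ) 1, ‖f s' - f s‖ ≤ C * (s' - s) ^ 2) :
    f 1 = f 0 := by
  have hN : ∀ N : ℕ, ‖f 1 - f 0‖ ≤ C * (1 / ((N : ℝ) + 1)) := by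
    intro N
    have hN0 : (0 : ℝ) < N + 1 := by positivity
    have h1 : f 1 - f 0 = ∑ i ∈ Finset.range (N + 1),
        (f ((i + 1 : ℕ) / ((N : ℝ) + 1)) - f ((i : ℕ) / ((N : ℝ) + 1))) := by
      rw [Finset.sum_range_sub (fun i : ℕ => f (i / ((N : ℝ) + 1)))]
      push_cast
      rw [div_self hN0.ne', zero_div]
    have hmem : ∀ i ≤ N + 1, ((i : ℕ) / ((N : ℝ) + 1)) ∈ Set.Icc (0 : ℝ) 1 := by
      intro i hi
      refine ⟨by positivity, (div_le_one hN0).mpr ?_⟩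
      exact_mod_cast hi
    rw [h1]
    refine (norm_sum_le_of_le _ fun i hi => h _ (hmem i (Finset.mem_range.mp hi).le) _
      (hmem (i + 1) (Finset.mem_range.mp hi))).trans_eq ?_
    have h2 : ∀ i : ℕ, ((i + 1 : ℕ) : ℝ) / ((N : ℝ) + 1) - i / ((N : ℝ) + 1) =
        1 / ((N : ℝ) + 1) := by
      intro i
      push_cast
      ring
    simp only [h2, Finset.sum_const, Finset.card_range, nsmul_eq_mul]
    push_cast
    field_simp
  have hlim : Filter.Tendsto (fun N : ℕ => C * (1 / ((N : ℝ) + 1))) Filter.atTop (nhds (C * 0)) :=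
    tendsto_one_div_add_atTop_nhds_zero_nat.const_mul C
  rw [mul_zero] at hlim
  rw [← sub_eq_zero, ← norm_le_zero_iff]
  exact ge_of_tendsto' hlim hN

end PolyIntegral

/-! ### Cauchy's formula in a Banach algebra -/

section Cauchy

variable {A : Type*} [NormedRing A] [NormedAlgebra ℂ A] [CompleteSpace A] {n : ℕ} {w : ℕ → ℂ}

/-- The resolvent `(σ - a)⁻¹`. -/
def resolv (a : A) (σ : ℂ) : A := Ring.inverse (algebraMap ℂ A σ - a)

theorem hasDerivAt_resolv {a : A} {σ : ℂ} (h : IsUnit (algebraMap ℂ A σ - a)) :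
    HasDerivAt (resolv a) (-(resolv a σ * resolv a σ)) σ := by
  obtain ⟨u, hu⟩ := h
  have h1 : HasDerivAt (fun σ : ℂ => algebraMap ℂ A σ - a) 1 σ := by
    have := ((ContinuousLinearMap.toSpanSingleton ℂ (1 : A)).hasDerivAt (x := σ)).sub_const a
    simpa [Algebra.algebraMap_eq_smul_one, Function.comp_def] using this
  have h2 := hasFDerivAt_ringInverse (𝕜 := ℂ) u
  rw [hu] at h2
  have h3 := h2.comp_hasDerivAt σ h1
  refine h3.congr_deriv ?_
  simp [resolv, ← hu]

theorem continuousOn_resolv {a : A} {s : Set ℂ} (h : ∀ σ ∈ s, IsUnit (algebraMap ℂ A σ - a)) :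
    ContinuousOn (resolv a) s :=
  fun σ hσ => (hasDerivAt_resolv (h σ hσ)).continuousAt.continuousWithinAt

/-- The integral of the resolvent over a closed polygon is invariant under a homotopy that
contracts `a` to a scalar. -/
theorem polyIntegral_resolv (hw : w n = w 0) {a : A} {z₀ : ℂ}
    (h : ∀ s ∈ Set.Icc (0 : ℝ) 1, ∀ σ ∈ polyTrace n w, IsUnit
      (algebraMap ℂ A σ - (algebraMap ℂ A z₀ + (s : ℂ) • (a - algebraMap ℂ A z₀)))) :
    polyIntegral n w (resolv a) = polyIntegral n w (resolv (algebraMap ℂ A z₀)) := by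
  set b := a - algebraMap ℂ A z₀ with hb
  set c : ℝ → A := fun s => algebraMap ℂ A z₀ + (s : ℂ) • b with hc
  have hcont : ContinuousOn (fun p : ℝ × ℂ => resolv (c p.1) p.2)
      (Set.Icc (0 : ℝ) 1 ×ˢ polyTrace n w) := by
    rintro ⟨s, σ⟩ ⟨hs, hσ⟩
    obtain ⟨u, hu⟩ := h s hs σ hσ
    have h1 := NormedRing.inverse_continuousAt u
    rw [hu] at h1
    have h2 : ContinuousAt (fun p : ℝ × ℂ => algebraMap ℂ A p.2 - c p.1) (s, σ) := by
      have : Continuous (algebraMap ℂ A) := continuous_algebraMap ℂ A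
      simp only [hc]
      fun_prop
    exact (ContinuousAt.comp_of_eq h1 h2 rfl).continuousWithinAt
  obtain ⟨M, hM⟩ := ((isCompact_Icc.prod (isCompact_polyTrace n w)).image_of_continuousOn
    hcont.norm).bddAbove
  have hM' : ∀ s ∈ Set.Icc (0 : ℝ) 1, ∀ σ ∈ polyTrace n w, ‖resolv (c s) σ‖ ≤ M :=
    fun s hs σ hσ => hM ⟨(s, σ), ⟨hs, hσ⟩, rfl⟩
  have hr : ∀ s ∈ Set.Icc (0 : ℝ) 1, ContinuousOn (resolv (c s)) (polyTrace n w) :=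
    fun s hs => continuousOn_resolv (h s hs)
  have key : polyIntegral n w (resolv (c 1)) = polyIntegral n w (resolv (c 0)) := by
    refine eq_of_norm_sub_le_sq (f := fun s => polyIntegral n w (resolv (c s)))
      (C := M ^ 3 * ‖b‖ ^ 2 * ∑ j ∈ Finset.range n, ‖w (j + 1) - w j‖) fun s hs s' hs' => ?_
    have hcomm : ∀ σ ∈ polyTrace n w, Commute b (resolv (c s) σ) := by
      intro σ hσ
      obtain ⟨u, hu⟩ := h s hs σ hσ
      have h1 : Commute b (u : A) := by
        rw [hu]
        exact (Algebra.commute_algebraMap_right σ b).sub_right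
          ((Algebra.commute_algebraMap_right z₀ b).add_right ((Commute.refl b).smul_right _))
      rw [resolv, ← hu, Ring.inverse_unit]
      exact h1.units_inv_right
    set d : ℂ := ((s' - s : ℝ) : ℂ) with hd
    -- The resolvent identity applied twice isolates the first-order term in s' - s and leaves a
    -- remainder of second order.
    have hdiff : ∀ σ ∈ polyTrace n w, resolv (c s') σ = resolv (c s) σ +
        (d • (resolv (c s) σ * b * resolv (c s) σ) + d ^ 2 •
          (resolv (c s') σ * b * resolv (c s) σ * b * resolv (c s) σ)) := by
      intro σ hσ
      obtain ⟨u, hu⟩ := h s hs σ hσ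
      obtain ⟨u', hu'⟩ := h s' hs' σ hσ
      have h1 : (u : A) - u' = d • b := by
        rw [hu, hu', hd]
        push_cast
        module
      have h2 : resolv (c s) σ = (↑u⁻¹ : A) := by rw [resolv, ← hu, Ring.inverse_unit]
      have h3 : resolv (c s') σ = (↑u'⁻¹ : A) := by rw [resolv, ← hu', Ring.inverse_unit]
      have h4 : (↑u'⁻¹ : A) = (↑u⁻¹ : A) + d • ((↑u'⁻¹ : A) * b * (↑u⁻¹ : A)) := by
        rw [← smul_mul_assoc, ← mul_smul_comm, ← h1, mul_sub, sub_mul, Units.inv_mul, one_mul,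
          mul_assoc, Units.mul_inv, mul_one]
        abel
      rw [h2, h3]
      nth_rw 1 [h4]
      congr 1
      nth_rw 1 [h4]
      simp only [add_mul, smul_add, smul_mul_assoc, smul_smul, sq]
    -- Since b commutes with the resolvent, the first-order term has the primitive -(resolvent · b),
    -- so its integral over the closed polygon vanishes.
    have hzero : polyIntegral n w (fun σ => resolv (c s) σ * b * resolv (c s) σ) = 0 := by
      refine polyIntegral_eq_zero hw (((hr s hs).mul continuousOn_const).mul (hr s hs))
        (G := fun σ => -(resolv (c s) σ * b)) fun σ hσ => ?_
      refine ((hasDerivAt_resolv (h s hs σ hσ)).mul_const b).neg.congr_deriv ?_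
      rw [neg_mul, neg_neg, mul_assoc, mul_assoc, (hcomm σ hσ).eq]
    have c1 : ContinuousOn (fun σ => d • (resolv (c s) σ * b * resolv (c s) σ))
        (polyTrace n w) :=
      (((hr s hs).mul (continuousOn_const (c := b))).mul (hr s hs)).const_smul d
    have c2 : ContinuousOn
        (fun σ => d ^ 2 • (resolv (c s') σ * b * resolv (c s) σ * b * resolv (c s) σ))
        (polyTrace n w) := (((((hr s' hs').mul (continuousOn_const (c := b))).mul (hr s hs)).mul
          (continuousOn_const (c := b))).mul (hr s hs)).const_smul (d ^ 2)
    have hsum' := polyIntegral_add (hr s hs) (c1.add c2)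
    simp only [Pi.add_apply] at hsum'
    rw [polyIntegral_congr hdiff, hsum',
      show polyIntegral n w (_ + _) = _ from polyIntegral_add c1 c2,
      polyIntegral_smul, polyIntegral_smul, hzero, smul_zero, zero_add, add_sub_cancel_left,
      norm_smul, norm_pow, hd, Complex.norm_real, Real.norm_eq_abs, sq_abs, mul_comm]
    refine mul_le_mul_of_nonneg_right (norm_polyIntegral_le fun σ hσ => ?_) (sq_nonneg _)
    have m1 := hM' s hs σ hσ
    have m2 := hM' s' hs' σ hσ
    have hM0 : 0 ≤ M := (norm_nonneg _).trans m1
    calc ‖resolv (c s') σ * b * resolv (c s) σ * b * resolv (c s) σ‖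
        ≤ M * ‖b‖ * M * ‖b‖ * M := by
          refine (norm_mul_le _ _).trans (mul_le_mul ?_ m1 (norm_nonneg _) (by positivity))
          refine (norm_mul_le _ _).trans (mul_le_mul_of_nonneg_right ?_ (norm_nonneg _))
          refine (norm_mul_le _ _).trans (mul_le_mul ?_ m1 (norm_nonneg _) (by positivity))
          exact (norm_mul_le _ _).trans (mul_le_mul_of_nonneg_right m2 (norm_nonneg _))
      _ = M ^ 3 * ‖b‖ ^ 2 := by ring
  simpa [hc, hb] using key

theorem polyIntegral_resolv_algebraMap [Nontrivial A] {z₀ : ℂ} (h : ∀ σ ∈ polyTrace n w, σ ≠ z₀) :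
    polyIntegral n w (resolv (algebraMap ℂ A z₀)) =
      algebraMap ℂ A (polyIntegral n w fun σ => (σ - z₀)⁻¹) := by
  have hc : ContinuousOn (fun σ => (σ - z₀)⁻¹) (polyTrace n w) :=
    ContinuousOn.inv₀ (by fun_prop) fun σ hσ => sub_ne_zero.mpr (h σ hσ)
  have := clm_polyIntegral (Algebra.linearMap ℂ A).toContinuousLinearMap hc
  simp only [LinearMap.coe_toContinuousLinearMap', Algebra.linearMap_apply] at this
  rw [this]
  refine polyIntegral_congr fun σ hσ => ?_
  simp only [resolv]
  rw [← map_sub]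
  have h0 : σ - z₀ ≠ 0 := sub_ne_zero.mpr (h σ hσ)
  have h1 := ((Units.mk0 (σ - z₀) h0).map (algebraMap ℂ A).toMonoidHom)
  rw [show algebraMap ℂ A (σ - z₀) =
    ((Units.map (algebraMap ℂ A : ℂ →* A) (Units.mk0 (σ - z₀) h0) : Aˣ) : A) from rfl,
    Ring.inverse_unit]
  simp

/-- The identity σ R(σ) = 1 + a R(σ) trades a power of σ for a power of a; the extra terms σ^k · 1
have primitives and integrate to 0. -/
theorem polyIntegral_pow_resolv (hw : w n = w 0) {a : A}
    (h : ∀ σ ∈ polyTrace n w, IsUnit (algebraMap ℂ A σ - a)) (k : ℕ) :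
    polyIntegral n w (fun σ => σ ^ k • resolv a σ) = a ^ k * polyIntegral n w (resolv a) := by
  have hr := continuousOn_resolv h
  induction k with
  | zero => simp
  | succ k ih =>
    have h1 : Set.EqOn (fun σ => σ ^ (k + 1) • resolv a σ)
        (fun σ => σ ^ k • (1 : A) + a * (σ ^ k • resolv a σ)) (polyTrace n w) := by
      intro σ hσ
      simp only
      rw [mul_smul_comm, ← smul_add, pow_succ, mul_smul]
      congr 1
      rw [← sub_eq_iff_eq_add, Algebra.smul_def, ← sub_mul]
      exact Ring.mul_inverse_cancel _ (h σ hσ)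
    have c1 : ContinuousOn (fun σ : ℂ => σ ^ k • (1 : A)) (polyTrace n w) := by fun_prop
    have c2 : ContinuousOn (fun σ : ℂ => σ ^ k • resolv a σ) (polyTrace n w) :=
      ContinuousOn.smul (by fun_prop) hr
    rw [polyIntegral_congr h1, polyIntegral_add (G := fun σ => a * σ ^ k • resolv a σ) c1
      (continuousOn_const.mul c2)]
    have h2 : polyIntegral n w (fun σ : ℂ => σ ^ k • (1 : A)) = 0 := by
      refine polyIntegral_eq_zero hw c1 (G := fun σ => (σ ^ (k + 1) / (k + 1)) • (1 : A))
        fun σ _ => ?_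
      refine (((hasDerivAt_pow (k + 1) σ).div_const _).smul_const 1).congr_deriv ?_
      have : (k + 1 : ℂ) ≠ 0 := by exact_mod_cast Nat.succ_ne_zero k
      congr 1
      push_cast
      field_simp
    have h3 := clm_polyIntegral (ContinuousLinearMap.mul ℂ A a) c2
    simp only [ContinuousLinearMap.mul_apply'] at h3
    rw [h2, zero_add, ← h3, ih, ← mul_assoc, pow_succ']

/-- Cauchy's formula for polynomials of an element of a Banach algebra. -/
theorem polyIntegral_eval_resolv (hw : w n = w 0) {a : A}
    (h : ∀ σ ∈ polyTrace n w, IsUnit (algebraMap ℂ A σ - a)) (p : Polynomial ℂ) :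
    polyIntegral n w (fun σ => p.eval σ • resolv a σ) =
      Polynomial.aeval a p * polyIntegral n w (resolv a) := by
  have hr := continuousOn_resolv h
  induction p using Polynomial.induction_on' with
  | add p q hp hq =>
    simp only [Polynomial.eval_add, add_smul, map_add, add_mul]
    rw [polyIntegral_add (F := fun σ => p.eval σ • resolv a σ)
      (G := fun σ => q.eval σ • resolv a σ) (p.continuous.continuousOn.smul hr)
      (q.continuous.continuousOn.smul hr), hp, hq]
  | monomial k c =>
    simp only [Polynomial.eval_monomial, mul_smul, Polynomial.aeval_monomial]
    rw [polyIntegral_smul, polyIntegral_pow_resolv hw h, Algebra.smul_def, mul_assoc]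

end Cauchy

/-! ### The double layer potential kernel -/

section Kernel

variable {E : Type*} [NormedAddCommGroup E] [InnerProductSpace ℂ E] {n : ℕ} {w : ℕ → ℂ}

theorem exists_norm_one_mul_eq (a : ℂ) : ∃ l : ℂ, ‖l‖ = 1 ∧ (‖a‖ : ℂ) * l = a := by
  by_cases h : a = 0
  · exact ⟨1, by simp, by simp [h]⟩
  · have h' : (‖a‖ : ℂ) ≠ 0 := by simpa using h
    exact ⟨a / ‖a‖, by simp [h], by field_simp⟩

/-- The continuous linear functional `T ↦ ⟪y, T x⟫`. -/
def matrixCoeff (y x : E) : (E →L[ℂ] E) →L[ℂ] ℂ :=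
  (innerSL ℂ y).comp (ContinuousLinearMap.apply ℂ E x)

theorem matrixCoeff_apply (y x : E) (T : E →L[ℂ] E) : matrixCoeff y x T = inner ℂ y (T x) := rfl

/-- Cauchy–Schwarz for the real part of an accretive operator. -/
theorem re_accretive_nonneg {Q : E →L[ℂ] E} (hQ : ∀ x, 0 ≤ (inner ℂ x (Q x)).re) {C : ℝ} {a : ℂ}
    (ha : ‖a‖ ≤ C) (x y : E) :
    0 ≤ (C * inner ℂ x (Q x) + C * inner ℂ y (Q y) - a * inner ℂ y (Q x) -
      conj a * inner ℂ x (Q y)).re := by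
  obtain ⟨l, hl, hal⟩ := exists_norm_one_mul_eq (conj a)
  rw [Complex.norm_conj] at hal
  have hal' : (‖a‖ : ℂ) * conj l = a := by
    have := congrArg conj hal
    simpa using this
  have hll : conj l * l = 1 := by
    rw [← Complex.normSq_eq_conj_mul_self, Complex.normSq_eq_norm_sq, hl]
    simp
  -- The expression splits as C - |a| times the forms at x and y, plus |a| times the form at x - l
  -- y, where l is the phase of the conjugate of a.
  have h1 : C * inner ℂ x (Q x) + C * inner ℂ y (Q y) - a * inner ℂ y (Q x) -
      conj a * inner ℂ x (Q y) = ((C - ‖a‖ : ℝ) : ℂ) * (inner ℂ x (Q x) + inner ℂ y (Q y)) +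
        (‖a‖ : ℂ) * inner ℂ (x - l • y) (Q (x - l • y)) := by
    simp only [map_sub, map_smul, inner_sub_left, inner_sub_right, inner_smul_left,
      inner_smul_right]
    rw [← hal, ← hal']
    have hn : ‖(‖a‖ : ℂ) * conj l‖ = ‖a‖ := by rw [hal']
    rw [hn]
    push_cast
    linear_combination (-(‖a‖ : ℂ) * inner ℂ y (Q y)) * hll
  rw [h1, Complex.add_re, Complex.re_ofReal_mul, Complex.re_ofReal_mul, Complex.add_re]
  have := hQ x
  have := hQ y
  have := hQ (x - l • y)
  have : 0 ≤ C - ‖a‖ := by linarith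
  positivity

theorem two_pi_I_inv : (2 * Real.pi * I : ℂ)⁻¹ = ((2 * Real.pi)⁻¹ : ℝ) * (-I) := by
  rw [mul_inv, Complex.inv_I]
  push_cast
  ring

/-- The resolvent kernel on an edge that has the numerical range on its left is accretive. -/
theorem re_inner_resolv_nonneg {T : E →L[ℂ] E} {σ d : ℂ}
    (hT : IsUnit (algebraMap ℂ (E →L[ℂ] E) σ - T))
    (hleft : ∀ z ∈ opRange T, 0 ≤ (conj d * (z - σ)).im) (x : E) :
    0 ≤ (inner ℂ x ((((2 * Real.pi * I : ℂ)⁻¹ * d) • resolv T σ) x)).re := by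
  -- Writing x = (σ - T)y turns the form of the resolvent at x into the conjugate of the form of σ -
  -- T at y, whose sign is controlled by the numerical range.
  set y := resolv T σ x with hy
  have hx : x = (algebraMap ℂ (E →L[ℂ] E) σ - T) y := by
    have := Ring.mul_inverse_cancel _ hT
    rw [hy, ← mul_apply_eq_comp, resolv, this, one_apply_eq_self]
  have h1 : 0 ≤ (conj d * inner ℂ y ((T - algebraMap ℂ (E →L[ℂ] E) σ) y)).im := by
    by_cases hy0 : y = 0
    · simp [hy0]
    obtain ⟨z, hz, hyz⟩ := exists_opRange_inner_eq T hy0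
    have h2 : inner ℂ y ((T - algebraMap ℂ (E →L[ℂ] E) σ) y) = ((‖y‖ ^ 2 : ℝ) : ℂ) * (z - σ) := by
      rw [sub_apply, inner_sub_right, hyz, Algebra.algebraMap_eq_smul_one, smul_apply,
        one_apply_eq_self, inner_smul_right, inner_self_eq_norm_sq_to_K]
      push_cast
      simp only [coe_algebraMap]
      ring
    rw [h2, mul_left_comm, Complex.im_ofReal_mul]
    exact mul_nonneg (sq_nonneg _) (hleft z hz)
  have h3 : inner ℂ x y = -conj (inner ℂ y ((T - algebraMap ℂ (E →L[ℂ] E) σ) y)) := by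
    rw [hx, inner_conj_symm, ← inner_neg_left]
    congr 1
    simp only [sub_apply]
    abel
  rw [smul_apply, inner_smul_right, ← hy, h3]
  have h5 : (2 * Real.pi * I : ℂ)⁻¹ * d * -conj (inner ℂ y ((T - algebraMap ℂ (E →L[ℂ] E) σ) y)) =
      ((2 * Real.pi)⁻¹ : ℝ) * (I * conj (conj d *
        inner ℂ y ((T - algebraMap ℂ (E →L[ℂ] E) σ) y))) := by
    rw [two_pi_I_inv, map_mul, Complex.conj_conj]
    ring
  rw [h5, Complex.re_ofReal_mul, Complex.I_mul_re, Complex.conj_im, neg_neg]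
  have := Real.pi_pos
  positivity

/-- The double layer potential bound: the resolvent kernel on a polygon that has the numerical
range of `T` on its left is accretive with total mass one. -/
theorem norm_cauchy_add_adjoint_le [CompleteSpace E] {T : E →L[ℂ] E}
    (hT : ∀ σ ∈ polyTrace n w, IsUnit (algebraMap ℂ (E →L[ℂ] E) σ - T))
    (hleft : ∀ j < n, ∀ t ∈ Set.Icc (0 : ℝ) 1, ∀ z ∈ opRange T,
      0 ≤ (conj (w (j + 1) - w j) * (z - edge w j t)).im)
    (hmass : polyIntegral n w (resolv T) = algebraMap ℂ (E →L[ℂ] E) (2 * Real.pi * I))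
    {f : ℂ → ℂ} (hf : ContinuousOn f (polyTrace n w)) {C : ℝ} (hC0 : 0 ≤ C)
    (hC : ∀ σ ∈ polyTrace n w, ‖f σ‖ ≤ C) :
    ‖(2 * Real.pi * I : ℂ)⁻¹ • polyIntegral n w (fun σ => f σ • resolv T σ) +
      ContinuousLinearMap.adjoint ((2 * Real.pi * I : ℂ)⁻¹ •
        polyIntegral n w (fun σ => conj (f σ) • resolv T σ))‖ ≤ 2 * C := by
  set κ : ℂ := 2 * Real.pi * I with hκ
  have hκ0 : κ ≠ 0 := Complex.two_pi_I_ne_zero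
  set G₁ := κ⁻¹ • polyIntegral n w (fun σ => f σ • resolv T σ) with hG₁
  set G₂ := κ⁻¹ • polyIntegral n w (fun σ => conj (f σ) • resolv T σ) with hG₂
  have hr := continuousOn_resolv hT
  have hcf : ContinuousOn (fun σ => conj (f σ)) (polyTrace n w) :=
    Complex.continuous_conj.comp_continuousOn hf
  have hbound : ∀ x y : E, ‖inner ℂ y ((G₁ + ContinuousLinearMap.adjoint G₂) x)‖ ≤
      C * (‖x‖ ^ 2 + ‖y‖ ^ 2) := by
    intro x y
    obtain ⟨u, hu, hzu⟩ := exists_norm_one_mul_eq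
      (inner ℂ y ((G₁ + ContinuousLinearMap.adjoint G₂) x))
    set ω := conj u with hω
    have hωu : ω * u = 1 := by
      rw [hω, ← Complex.normSq_eq_conj_mul_self, Complex.normSq_eq_norm_sq, hu]
      simp
    have c1 : ContinuousOn (fun σ => f σ • resolv T σ) (polyTrace n w) := hf.smul hr
    have c2 : ContinuousOn (fun σ => conj (f σ) • resolv T σ) (polyTrace n w) := hcf.smul hr
    set L₁ := (κ⁻¹ * C) • (matrixCoeff x x + matrixCoeff y y)
    set L₂ := (κ⁻¹ * ω) • matrixCoeff y x
    set L₃ := (κ⁻¹ * conj ω) • matrixCoeff x y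
    have d1 : ContinuousOn (fun σ => L₁ (resolv T σ)) (polyTrace n w) :=
      L₁.continuous.comp_continuousOn hr
    have d2 : ContinuousOn (fun σ => L₂ (f σ • resolv T σ)) (polyTrace n w) :=
      L₂.continuous.comp_continuousOn c1
    have d3 : ContinuousOn (fun σ => L₃ (conj (f σ) • resolv T σ)) (polyTrace n w) :=
      L₃.continuous.comp_continuousOn c2
    have d12 : ContinuousOn (fun σ => L₁ (resolv T σ) - L₂ (f σ • resolv T σ))
      (polyTrace n w) := d1.sub d2
    -- The accretive inequality is integrated over the polygon with a = ω f. The phase ω makes the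
    -- matrix coefficient of `G₁ + adjoint G₂` real and nonnegative, and the mass condition
    -- evaluates the diagonal terms.
    have hpos := re_polyIntegral_nonneg (F := fun σ => L₁ (resolv T σ) - L₂ (f σ • resolv T σ) -
      L₃ (conj (f σ) • resolv T σ)) (d12.sub d3) (by
        intro j hj t ht
        have h1 := re_accretive_nonneg (Q := (κ⁻¹ * (w (j + 1) - w j)) • resolv T (edge w j t))
          (re_inner_resolv_nonneg (hT _ (edge_mem_polyTrace w hj ht)) (hleft j hj t ht))
          (C := C) (a := ω * f (edge w j t))
          (by rw [norm_mul, hω, Complex.norm_conj, hu, one_mul]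
              exact hC _ (edge_mem_polyTrace w hj ht)) x y
        refine h1.trans_eq (congrArg Complex.re ?_)
        simp only [L₁, L₂, L₃, smul_apply, add_apply, matrixCoeff_apply,
          inner_smul_right, smul_eq_mul, map_mul]
        ring)
    rw [polyIntegral_sub d12 d3, polyIntegral_sub d1 d2, ← clm_polyIntegral L₁ hr,
      ← clm_polyIntegral L₂ c1, ← clm_polyIntegral L₃ c2, hmass] at hpos
    have e1 : L₁ (algebraMap ℂ (E →L[ℂ] E) κ) = ((C * (‖x‖ ^ 2 + ‖y‖ ^ 2) : ℝ) : ℂ) := by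
      rw [Algebra.algebraMap_eq_smul_one]
      simp only [L₁, smul_apply, add_apply, matrixCoeff_apply, one_apply_eq_self,
        inner_smul_right, inner_self_eq_norm_sq_to_K, smul_eq_mul, coe_algebraMap]
      push_cast
      field_simp
    have e2 : L₂ (polyIntegral n w fun σ => f σ • resolv T σ) = ω * inner ℂ y (G₁ x) := by
      simp only [L₂, smul_apply, matrixCoeff_apply, hG₁, inner_smul_right, smul_eq_mul]
      ring
    have e3 : L₃ (polyIntegral n w fun σ => conj (f σ) • resolv T σ) =
        conj (ω * inner ℂ y (ContinuousLinearMap.adjoint G₂ x)) := by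
      rw [ContinuousLinearMap.adjoint_inner_right, map_mul, inner_conj_symm]
      simp only [L₃, smul_apply, matrixCoeff_apply, hG₂, inner_smul_right, smul_eq_mul]
      ring
    rw [e1, e2, e3, Complex.sub_re, Complex.sub_re, Complex.ofReal_re, Complex.conj_re,
      sub_sub, ← Complex.add_re, ← mul_add, ← inner_add_right, ← add_apply, ← hzu, mul_left_comm,
      hωu, mul_one, Complex.ofReal_re] at hpos
    linarith
  refine ContinuousLinearMap.opNorm_le_bound _ (by positivity) fun x => ?_
  set S := G₁ + ContinuousLinearMap.adjoint G₂
  by_cases hx : S x = 0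
  · rw [hx, norm_zero]
    positivity
  have hSx : ‖S x‖ ≠ 0 := norm_ne_zero_iff.mpr hx
  -- The vector S x is rescaled to the norm of x, which balances the two squares in `hbound`.
  have h1 := hbound x (((‖x‖ / ‖S x‖ : ℝ) : ℂ) • S x)
  rw [inner_smul_left, Complex.conj_ofReal, inner_self_eq_norm_sq_to_K, norm_smul, norm_mul,
    Complex.norm_real, Real.norm_of_nonneg (by positivity), norm_pow] at h1
  simp only [coe_algebraMap, Complex.norm_real, norm_norm] at h1
  rw [div_mul_cancel₀ _ hSx, show ‖x‖ / ‖S x‖ * ‖S x‖ ^ 2 = ‖x‖ * ‖S x‖ by field_simp] at h1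
  have hx0 : 0 < ‖x‖ := by
    rw [norm_pos_iff]
    rintro rfl
    exact hx (map_zero S)
  refine le_of_mul_le_mul_left ?_ hx0
  linarith

end Kernel

/-! ### The closed algebra generated by the pair (id on S, T) -/

section SpectralPairs

/-- Multiplication by -i turns the strict separation of S from the edge's line into a lower bound on
a real part, the form needed for coercivity. -/
theorem Encloses.exists_pos {n : ℕ} {w : ℕ → ℂ} {S : Set ℂ} (h : Encloses n w S) {σ : ℂ}
    (hσ : σ ∈ polyTrace n w) : ∃ ξ : ℂ, ∃ c > 0, ξ ≠ 0 ∧ ∀ z ∈ S, c ≤ (ξ * (z - σ)).re := by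
  obtain ⟨j, hj, t, -, rfl⟩ := mem_polyTrace.mp hσ
  obtain ⟨c, hc, hz⟩ := h.left j hj
  refine ⟨-I * conj (w (j + 1) - w j), c, hc, ?_, fun z hzS => ?_⟩
  · obtain ⟨z, hzS, -⟩ := h.winding
    intro h0
    have h1 := hz z hzS 0
    have h2 : conj (w (j + 1) - w j) = 0 := by simpa using h0
    rw [h2, zero_mul, Complex.zero_im] at h1
    linarith
  · refine (hz z hzS t).trans_eq ?_
    rw [mul_assoc]
    simp

variable {E : Type*} [NormedAddCommGroup E] [InnerProductSpace ℂ E]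
  {S : Set ℂ}

/-- The pair of the identity function on `S` and the operator `T`. -/
def funOp (S : Set ℂ) (T : E →L[ℂ] E) : C(S, ℂ) × (E →L[ℂ] E) :=
  (ContinuousMap.restrict S (ContinuousMap.id ℂ), T)

/-- A pair of a function and an operator, both with real part bounded below by a positive constant,
is a perturbation of a multiple of the identity. -/
theorem exists_norm_pair_sub_lt [CompactSpace S] (g : C(S, ℂ)) (T : E →L[ℂ] E) {c : ℝ} (hc : 0 < c)
    (hg : ∀ z, c ≤ (g z).re) (hT : ∀ x, c * ‖x‖ ^ 2 ≤ (inner ℂ x (T x)).re) :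
    ∃ R : ℝ, 0 < R ∧
      ‖((g, T) : C(S, ℂ) × (E →L[ℂ] E)) - algebraMap ℂ (C(S, ℂ) × (E →L[ℂ] E)) R‖ < R := by
  set b := max ‖g‖ ‖T‖
  set R := (b ^ 2 + 1) / (2 * c)
  have hR : b ^ 2 < 2 * c * R := by
    simp only [R]
    field_simp
    linarith
  have hR0 : 0 < R := by positivity
  refine ⟨R, hR0, ?_⟩
  rw [Prod.norm_def, max_lt_iff]
  refine ⟨?_, norm_sub_smul_id_lt T hc (le_max_right _ _) hT hR⟩
  rw [ContinuousMap.norm_lt_iff _ hR0]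
  intro z
  have h1 : ‖g z‖ ≤ b := (g.norm_coe_le_norm z).trans (le_max_left _ _)
  have h2 : ‖g z - R‖ ^ 2 = ‖g z‖ ^ 2 - 2 * R * (g z).re + R ^ 2 := by
    rw [← Complex.normSq_eq_norm_sq, ← Complex.normSq_eq_norm_sq, Complex.normSq_apply,
      Complex.normSq_apply]
    simp only [Complex.sub_re, Complex.sub_im, Complex.ofReal_re, Complex.ofReal_im]
    ring
  have h3 : ‖g z‖ ^ 2 ≤ b ^ 2 := by gcongr
  have h4 : ‖g z - R‖ ^ 2 < R ^ 2 := by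
    rw [h2]
    nlinarith [hg z]
  exact lt_of_pow_lt_pow_left₀ 2 hR0.le h4

variable [CompleteSpace E]

/-- The generator of the closed algebra generated by `funOp S T`. -/
def funOpGen (S : Set ℂ) [CompactSpace S] (T : E →L[ℂ] E) : Algebra.elemental ℂ (funOp S T) :=
  ⟨funOp S T, Algebra.elemental.self_mem ℂ _⟩

/-- Contracting towards z₀ keeps values in S by convexity. After multiplication by ξ, both the
function and the operator have real part at least c, so the pair is a small perturbation of a large
scalar, and the Neumann series inverts it inside the closed algebra generated by `funOp S T`. -/
theorem isUnit_funOpGen [CompactSpace S] {n : ℕ} {w : ℕ → ℂ} (h : Encloses n w S) (hS : Convex ℝ S)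
    {T : E →L[ℂ] E} (hT : opRange T ⊆ S) {z₀ : ℂ} (hz₀ : z₀ ∈ S) {s : ℝ}
    (hs : s ∈ Set.Icc (0 : ℝ) 1) {σ : ℂ} (hσ : σ ∈ polyTrace n w) :
    IsUnit (algebraMap ℂ (Algebra.elemental ℂ (funOp S T)) σ -
      (algebraMap ℂ _ z₀ + (s : ℂ) • (funOpGen S T - algebraMap ℂ _ z₀))) := by
  obtain ⟨ξ, c, hc, hξ, hpos⟩ := h.exists_pos hσ
  have hmem : ∀ z ∈ S, z₀ + s * (z - z₀) ∈ S := by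
    intro z hz
    convert hS hz₀ hz (sub_nonneg.mpr hs.2) hs.1 (by ring) using 1
    simp only [Complex.real_smul]
    push_cast
    ring
  have hq : ∀ x : E, c * ‖x‖ ^ 2 ≤ (inner ℂ x ((ξ • (algebraMap ℂ (E →L[ℂ] E) z₀ +
      (s : ℂ) • (T - algebraMap ℂ (E →L[ℂ] E) z₀) - algebraMap ℂ (E →L[ℂ] E) σ)) x)).re := by
    intro x
    by_cases hx : x = 0
    · simp [hx]
    obtain ⟨z, hz, hxz⟩ := exists_opRange_inner_eq T hx
    have h1 : inner ℂ x ((ξ • (algebraMap ℂ (E →L[ℂ] E) z₀ +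
        (s : ℂ) • (T - algebraMap ℂ (E →L[ℂ] E) z₀) - algebraMap ℂ (E →L[ℂ] E) σ)) x) =
        ((‖x‖ ^ 2 : ℝ) : ℂ) * (ξ * (z₀ + s * (z - z₀) - σ)) := by
      have hself : inner ℂ x x = (‖x‖ : ℂ) ^ 2 := inner_self_eq_norm_sq_to_K x
      simp only [Algebra.algebraMap_eq_smul_one, smul_apply, sub_apply, add_apply,
        one_apply_eq_self, inner_smul_right, inner_sub_right, inner_add_right, hxz, hself]
      push_cast
      ring
    rw [h1, Complex.re_ofReal_mul, mul_comm]
    exact mul_le_mul_of_nonneg_left (hpos _ (hmem z (hT hz))) (sq_nonneg _)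
  obtain ⟨R, hR, hlt⟩ := exists_norm_pair_sub_lt
    (ξ • (algebraMap ℂ C(S, ℂ) z₀ + (s : ℂ) • (ContinuousMap.restrict S (ContinuousMap.id ℂ) -
      algebraMap ℂ C(S, ℂ) z₀) - algebraMap ℂ C(S, ℂ) σ)) _ hc
    (fun z => by simpa using hpos _ (hmem z z.2)) hq
  have hu : IsUnit (ξ • (algebraMap ℂ (Algebra.elemental ℂ (funOp S T)) z₀ +
      (s : ℂ) • (funOpGen S T - algebraMap ℂ _ z₀) - algebraMap ℂ _ σ)) := by
    refine isUnit_of_norm_sub_algebraMap_lt (c := (R : ℂ)) ?_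
    rw [Complex.norm_real, Real.norm_of_nonneg hR.le]
    exact hlt
  have h2 := (IsUnit.mk0 _ (neg_ne_zero.mpr (inv_ne_zero hξ))).map
    (algebraMap ℂ (Algebra.elemental ℂ (funOp S T)))
  have h3 := h2.mul hu
  rw [← Algebra.smul_def, neg_smul, smul_smul, inv_mul_cancel₀ hξ, one_smul, neg_sub] at h3
  exact h3

/-- The homotopy that contracts the generator to the scalar z₀ identifies the mass of the resolvent
with 2πi times the winding number 1. It takes place in the closed algebra, so Cauchy transforms
there are limits of polynomials in the pair. -/
theorem polyIntegral_resolv_funOpGen [CompactSpace S] [Nontrivial E] {n : ℕ} {w : ℕ → ℂ}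
    (h : Encloses n w S)
    (hS : Convex ℝ S) {T : E →L[ℂ] E} (hT : opRange T ⊆ S) :
    (∀ σ ∈ polyTrace n w,
      IsUnit (algebraMap ℂ (Algebra.elemental ℂ (funOp S T)) σ - funOpGen S T)) ∧
    polyIntegral n w (resolv (funOpGen S T)) = algebraMap ℂ _ (2 * Real.pi * I) := by
  obtain ⟨z₀, hz₀, hwind⟩ := h.winding
  constructor
  · intro σ hσ
    simpa using isUnit_funOpGen h hS hT hz₀ (s := 1) ⟨zero_le_one, le_rfl⟩ hσ
  · rw [polyIntegral_resolv h.closed fun s hs σ hσ => isUnit_funOpGen h hS hT hz₀ hs hσ,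
      polyIntegral_resolv_algebraMap, hwind]
    intro σ hσ h0
    obtain ⟨ξ, c, hc, -, hpos⟩ := h.exists_pos hσ
    have := hpos z₀ hz₀
    rw [h0, sub_self, mul_zero, Complex.zero_re] at this
    linarith

variable {A B : Type*} [NormedRing A] [NormedAlgebra ℂ A] [NormedRing B] [NormedAlgebra ℂ B]

theorem algHom_resolv (φ : A →ₐ[ℂ] B) {a : A} {σ : ℂ} (h : IsUnit (algebraMap ℂ A σ - a)) :
    φ (resolv a σ) = resolv (φ a) σ := by
  obtain ⟨u, hu⟩ := h
  have h1 : algebraMap ℂ B σ - φ a = (Units.map (φ : A →* B) u : Bˣ) := by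
    simp [hu]
  rw [resolv, resolv, h1, Ring.inverse_unit, ← hu, Ring.inverse_unit, ← map_inv]
  rfl

theorem algHom_polyIntegral [CompleteSpace A] [CompleteSpace B] (φ : A →ₐ[ℂ] B)
    (hφ : Continuous φ) {n : ℕ} {w : ℕ → ℂ} {a : A}
    (h : ∀ σ ∈ polyTrace n w, IsUnit (algebraMap ℂ A σ - a)) {f : ℂ → ℂ}
    (hf : ContinuousOn f (polyTrace n w)) :
    φ (polyIntegral n w fun σ => f σ • resolv a σ) =
      polyIntegral n w fun σ => f σ • resolv (φ a) σ := by
  have h1 := clm_polyIntegral (⟨φ.toLinearMap, hφ⟩ : A →L[ℂ] B) (hf.smul (continuousOn_resolv h))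
  refine Eq.trans h1 (polyIntegral_congr fun σ hσ => ?_)
  change φ (f σ • resolv a σ) = _
  rw [map_smul, algHom_resolv φ (h σ hσ)]

/-- The double layer potential bound for a representation of a Banach algebra. -/
theorem norm_aeval_add_adjoint_le [CompleteSpace A] {n : ℕ} {w : ℕ → ℂ} (h : Encloses n w S) {a : A}
    (hunit : ∀ σ ∈ polyTrace n w, IsUnit (algebraMap ℂ A σ - a))
    (hmass : polyIntegral n w (resolv a) = algebraMap ℂ A (2 * Real.pi * I))
    (φ : A →ₐ[ℂ] (E →L[ℂ] E)) (hφ : Continuous φ) (hr : opRange (φ a) ⊆ S)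
    (p : Polynomial ℂ) {C : ℝ} (hC0 : 0 ≤ C) (hC : ∀ σ ∈ polyTrace n w, ‖p.eval σ‖ ≤ C) :
    ‖Polynomial.aeval (φ a) p + ContinuousLinearMap.adjoint (φ ((2 * Real.pi * I : ℂ)⁻¹ •
      polyIntegral n w fun σ => conj (p.eval σ) • resolv a σ))‖ ≤ 2 * C := by
  have hunit' : ∀ σ ∈ polyTrace n w, IsUnit (algebraMap ℂ (E →L[ℂ] E) σ - φ a) := by
    intro σ hσ
    simpa using (hunit σ hσ).map φ
  have hmass' : polyIntegral n w (resolv (φ a)) = algebraMap ℂ (E →L[ℂ] E) (2 * Real.pi * I) := by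
    have := algHom_polyIntegral φ hφ hunit (f := fun _ => 1) continuousOn_const
    simp only [one_smul] at this
    rw [← this, show (fun σ => resolv a σ) = resolv a from rfl, hmass, AlgHom.commutes]
  have hp : ContinuousOn (fun σ => p.eval σ) (polyTrace n w) := p.continuous.continuousOn
  have key := norm_cauchy_add_adjoint_le hunit' (fun j hj t ht z hz => by
    obtain ⟨c, hc, hcz⟩ := h.left j hj
    exact hc.le.trans (hcz z (hr hz) t)) hmass' hp hC0 hC
  have hc : (2 * Real.pi * I : ℂ) ≠ 0 := Complex.two_pi_I_ne_zero
  rw [map_smul, algHom_polyIntegral φ hφ hunit (f := fun σ => conj (p.eval σ))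
    (Complex.continuous_conj.comp_continuousOn hp)]
  rw [polyIntegral_eval_resolv h.closed hunit', hmass', ← Algebra.commutes,
    ← Algebra.smul_def, smul_smul, inv_mul_cancel₀ hc, one_smul] at key
  exact key

end SpectralPairs

/-! ### Bounds for Crouzeix's constant -/

section Crouzeix

variable {E : Type*} [NormedAddCommGroup E] [InnerProductSpace ℂ E] [CompleteSpace E]

theorem exists_cthickening_eval_le {K : Set ℂ} (hK : IsCompact K) (p : Polynomial ℂ) {C C' : ℝ}
    (hC : ∀ z ∈ K, ‖p.eval z‖ ≤ C) (hCC : C < C') :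
    ∃ δ > 0, ∀ z ∈ Metric.cthickening δ K, ‖p.eval z‖ ≤ C' := by
  obtain ⟨δ, hδ, h⟩ := hK.exists_cthickening_subset_open (t := {z | ‖p.eval z‖ < C'})
    (isOpen_lt (by fun_prop) continuous_const) fun z hz => (hC z hz).trans_lt hCC
  exact ⟨δ, hδ, fun z hz => (h hz).le⟩

/-- The closed algebra generated by the pair of the identity function on `S` and `T`, projected
to operators. -/
def elemOp (S : Set ℂ) [CompactSpace S] (T : E →L[ℂ] E) :
    Algebra.elemental ℂ (funOp S T) →ₐ[ℂ] (E →L[ℂ] E) :=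
  (AlgHom.snd ℂ C(S, ℂ) (E →L[ℂ] E)).comp (Subalgebra.val _)

/-- The closed algebra generated by the pair of the identity function on `S` and `T`, evaluated at
a point of `S` and viewed as operators on `ℂ`. -/
def elemEval (S : Set ℂ) [CompactSpace S] (T : E →L[ℂ] E) (z : S) :
    Algebra.elemental ℂ (funOp S T) →ₐ[ℂ] (ℂ →L[ℂ] ℂ) :=
  (Algebra.ofId ℂ (ℂ →L[ℂ] ℂ)).comp ((ContinuousMap.evalAlgHom ℂ ℂ z).comp
    ((AlgHom.fst ℂ C(S, ℂ) (E →L[ℂ] E)).comp (Subalgebra.val _)))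

theorem elemEval_apply (S : Set ℂ) [CompactSpace S] (T : E →L[ℂ] E) (z : S)
    (x : Algebra.elemental ℂ (funOp S T)) :
    elemEval S T z x = algebraMap ℂ (ℂ →L[ℂ] ℂ) (x.1.1 z) := rfl

theorem continuous_elemOp (S : Set ℂ) [CompactSpace S] (T : E →L[ℂ] E) :
    Continuous (elemOp S T) := continuous_snd.comp continuous_subtype_val

theorem continuous_elemEval (S : Set ℂ) [CompactSpace S] (T : E →L[ℂ] E) (z : S) :
    Continuous (elemEval S T z) :=
  (continuous_algebraMap ℂ (ℂ →L[ℂ] ℂ)).comp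
    ((continuous_eval_const z).comp (continuous_fst.comp continuous_subtype_val))

theorem opRange_algebraMap_subset (z : ℂ) : opRange (algebraMap ℂ (ℂ →L[ℂ] ℂ) z) ⊆ {z} := by
  rintro _ ⟨x, hx, rfl⟩
  rw [Algebra.algebraMap_eq_smul_one, smul_apply, one_apply_eq_self, inner_smul_right,
    inner_self_eq_norm_sq_to_K, hx]
  simp

theorem aeval_elemental_fst {S : Set ℂ} [CompactSpace S] {T : E →L[ℂ] E} (p : Polynomial ℂ)
    (z : S) : (Polynomial.aeval (funOpGen S T) p).1.1 z = p.eval (z : ℂ) := by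
  have h : (Polynomial.aeval (funOpGen S T) p).1.1 z =
      ((ContinuousMap.evalAlgHom ℂ ℂ z).comp ((AlgHom.fst ℂ C(S, ℂ) (E →L[ℂ] E)).comp
        (Subalgebra.val (Algebra.elemental ℂ (funOp S T))))) (Polynomial.aeval (funOpGen S T) p) :=
    rfl
  rw [h, ← Polynomial.aeval_algHom_apply, ← Polynomial.coe_aeval_eq_eval]
  rfl

theorem aeval_elemental_snd {S : Set ℂ} [CompactSpace S] {T : E →L[ℂ] E} (p : Polynomial ℂ) :
    (Polynomial.aeval (funOpGen S T) p).1.2 = Polynomial.aeval T p := by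
  have h : (Polynomial.aeval (funOpGen S T) p).1.2 =
      elemOp S T (Polynomial.aeval (funOpGen S T) p) :=
    rfl
  rw [h, ← Polynomial.aeval_algHom_apply]
  rfl

/-- `M` is a constant for the inequality `‖p(T)‖ ≤ M max_S |p|`. -/
def IsSpectralConst (S : Set ℂ) (T : E →L[ℂ] E) (M : ℝ) : Prop :=
  ∀ (p : Polynomial ℂ) (C : ℝ), (∀ z ∈ S, ‖p.eval z‖ ≤ C) → ‖Polynomial.aeval T p‖ ≤ M * C

/-- Polynomials in the pair are dense in the algebra and the inequality is closed. The extension is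
needed because the Cauchy transform of the conjugate of p is not a polynomial. -/
theorem IsSpectralConst.norm_snd_le {S : Set ℂ} [CompactSpace S] {T : E →L[ℂ] E} {M : ℝ}
    (h : IsSpectralConst S T M) (x : Algebra.elemental ℂ (funOp S T)) :
    ‖x.1.2‖ ≤ M * ‖x.1.1‖ := by
  have hcl : IsClosed {y : C(S, ℂ) × (E →L[ℂ] E) | ‖y.2‖ ≤ M * ‖y.1‖} :=
    isClosed_le (by fun_prop) (by fun_prop)
  have hx : x.1 ∈ closure (Algebra.adjoin ℂ {funOp S T} : Set (C(S, ℂ) × (E →L[ℂ] E))) := x.2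
  refine hcl.closure_subset_iff.mpr ?_ hx
  intro y hy
  rw [SetLike.mem_coe, Algebra.adjoin_singleton_eq_range_aeval] at hy
  obtain ⟨p, rfl⟩ := hy
  have h2 : (Polynomial.aeval (funOp S T) p).2 = Polynomial.aeval T p :=
    (Polynomial.aeval_algHom_apply (AlgHom.snd ℂ C(S, ℂ) (E →L[ℂ] E)) (funOp S T) p).symm
  change ‖(Polynomial.aeval (funOp S T) p).2‖ ≤ M * ‖(Polynomial.aeval (funOp S T) p).1‖
  rw [h2]
  refine h p _ fun z hz => ?_
  have h1 : (Polynomial.aeval (funOp S T) p).1 ⟨z, hz⟩ = p.eval z := by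
    have := (Polynomial.aeval_algHom_apply ((ContinuousMap.evalAlgHom ℂ ℂ (⟨z, hz⟩ : S)).comp
      (AlgHom.fst ℂ C(S, ℂ) (E →L[ℂ] E))) (funOp S T) p).symm
    rw [← Polynomial.coe_aeval_eq_eval]
    exact this
  rw [← h1]
  exact ContinuousMap.norm_coe_le_norm _ _

/-- A crude Cauchy estimate over a polygon in the thickening, where |p| ≤ C and the resolvent is
bounded. The constant may depend on ε: it only shows that the set of admissible constants is
nonempty. -/
theorem exists_isSpectralConst [Nontrivial E] [FiniteDimensional ℂ E] (T : E →L[ℂ] E) {ε : ℝ}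
    (hε : 0 < ε) : ∃ M, 0 ≤ M ∧ IsSpectralConst (Metric.cthickening ε (opRange T)) T M := by
  have : CompactSpace (opRange T) := isCompact_iff_compactSpace.mp (isCompact_opRange T)
  obtain ⟨n, w, hw, hedge⟩ := exists_encloses_cthickening (convex_opRange T)
    (isCompact_opRange T) (opRange_nonempty T) hε
  obtain ⟨hunit, hmass⟩ := polyIntegral_resolv_funOpGen hw (convex_opRange T) (T := T) subset_rfl
  set a := funOpGen (opRange T) T
  have hr := continuousOn_resolv hunit
  obtain ⟨M, hM⟩ := ((isCompact_polyTrace n w).image_of_continuousOn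
    ((continuous_elemOp (opRange T) T).comp_continuousOn hr).norm).bddAbove
  have hM' : ∀ σ ∈ polyTrace n w, ‖elemOp (opRange T) T (resolv a σ)‖ ≤ M := fun σ hσ =>
    hM ⟨σ, hσ, rfl⟩
  set κ : ℂ := 2 * Real.pi * I
  have hκ : κ ≠ 0 := Complex.two_pi_I_ne_zero
  refine ⟨‖κ⁻¹‖ * (max M 0 * ∑ j ∈ Finset.range n, ‖w (j + 1) - w j‖), by positivity,
    fun p C hC => ?_⟩
  have h1 := polyIntegral_eval_resolv hw.closed hunit p
  rw [hmass] at h1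
  have h2 : Polynomial.aeval T p =
      κ⁻¹ • polyIntegral n w fun σ => p.eval σ • elemOp (opRange T) T (resolv a σ) := by
    have h3 := clm_polyIntegral (⟨(elemOp (opRange T) T).toLinearMap,
      continuous_elemOp (opRange T) T⟩ : _ →L[ℂ] (E →L[ℂ] E))
      (p.continuous.continuousOn.smul hr)
    change elemOp (opRange T) T (polyIntegral n w fun σ => p.eval σ • resolv a σ) =
      polyIntegral n w fun σ => elemOp (opRange T) T (p.eval σ • resolv a σ) at h3
    simp only [map_smul] at h3
    rw [← h3, h1, map_mul, AlgHom.commutes, ← Algebra.commutes, ← Algebra.smul_def, smul_smul,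
      inv_mul_cancel₀ hκ, one_smul, ← aeval_elemental_snd (S := opRange T)]
    rfl
  rw [h2, norm_smul, mul_assoc]
  refine mul_le_mul_of_nonneg_left ?_ (norm_nonneg _)
  refine (norm_polyIntegral_le (C := C * max M 0) fun σ hσ => ?_).trans_eq (by ring)
  have hσC : ‖p.eval σ‖ ≤ C := by
    obtain ⟨j, hj, t, ht, rfl⟩ := mem_polyTrace.mp hσ
    exact hC _ (hedge j hj t ht)
  rw [norm_smul]
  exact mul_le_mul hσC ((hM' σ hσ).trans (le_max_left _ _)) (norm_nonneg _)
    ((norm_nonneg _).trans hσC)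

/-- The bootstrap inequality of Ransford and Schwenninger, with the elementary bound of the Cauchy
transform. -/
theorem IsSpectralConst.pow_four_le [Nontrivial E] {S : Set ℂ} (hSc : IsCompact S)
    (hS : Convex ℝ S) {T : E →L[ℂ] E} (hT : opRange T ⊆ S) {M : ℝ} (hM0 : 0 ≤ M)
    (hM : IsSpectralConst S T M) {p : Polynomial ℂ} {C : ℝ} (hC : ∀ z ∈ S, ‖p.eval z‖ ≤ C) :
    ‖Polynomial.aeval T p‖ ^ 4 ≤ (2 * M ^ 3 + 3 * M ^ 2) * C ^ 4 := by
  have : CompactSpace S := isCompact_iff_compactSpace.mp hSc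
  have hne : S.Nonempty := (opRange_nonempty T).mono hT
  have hC0 : 0 ≤ C := by
    obtain ⟨z, hz⟩ := hne
    exact (norm_nonneg _).trans (hC z hz)
  set A := Polynomial.aeval T p with hA
  have hAM : ‖A‖ ≤ M * C := hM p C hC
  have key : ∀ C' > C, ‖A‖ ^ 4 ≤ 2 * C' * (M * C) ^ 3 + M * (C * (2 * C' + C) * C) * (M * C) := by
    intro C' hCC
    have hC'0 : 0 ≤ C' := hC0.trans hCC.le
    obtain ⟨δ, hδ, hpδ⟩ := exists_cthickening_eval_le hSc p hC hCC
    obtain ⟨n, w, hw, hedge⟩ := exists_encloses_cthickening hS hSc hne hδ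
    obtain ⟨hunit, hmass⟩ := polyIntegral_resolv_funOpGen hw hS hT
    have hpw : ∀ σ ∈ polyTrace n w, ‖p.eval σ‖ ≤ C' := by
      intro σ hσ
      obtain ⟨j, hj, t, ht, rfl⟩ := mem_polyTrace.mp hσ
      exact hpδ _ (hedge j hj t ht)
    set a := funOpGen S T with ha
    set g := (2 * Real.pi * I : ℂ)⁻¹ • polyIntegral n w fun σ => conj (p.eval σ) • resolv a σ
    have h1 : ‖A + star (elemOp S T g)‖ ≤ 2 * C' :=
      norm_aeval_add_adjoint_le hw hunit hmass (elemOp S T) (continuous_elemOp S T) hT p hC'0 hpw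
    -- The same double layer bound in the one-dimensional representation at z bounds |p(z) + conj
    -- g(z)| by 2C', and hence |g(z)|.
    have h2 : ∀ z : S, ‖g.1.1 z‖ ≤ 2 * C' + C := by
      intro z
      have h3 := norm_aeval_add_adjoint_le hw hunit hmass (elemEval S T z)
        (continuous_elemEval S T z) (by
          rw [elemEval_apply]
          refine (opRange_algebraMap_subset _).trans ?_
          rintro _ rfl
          exact z.2) p hC'0 hpw
      have h4 : Polynomial.aeval (elemEval S T z a) p =
              algebraMap ℂ (ℂ →L[ℂ] ℂ) (p.eval (z : ℂ)) := by
        rw [elemEval_apply, Polynomial.aeval_algebraMap_apply, Polynomial.coe_aeval_eq_eval]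
        rfl
      rw [h4, elemEval_apply, ← ContinuousLinearMap.star_eq_adjoint, ← algebraMap_star_comm,
        ← map_add, norm_algebraMap'] at h3
      have h5 : ‖g.1.1 z‖ = ‖(p.eval (z : ℂ) + star (g.1.1 z)) - p.eval (z : ℂ)‖ := by
        rw [add_sub_cancel_left, norm_star]
      rw [h5]
      exact (norm_sub_le _ _).trans (add_le_add h3 (hC z z.2))
    set f := Polynomial.aeval a p with hf
    have hfA : elemOp S T f = A := aeval_elemental_snd p
    set G := elemOp S T g
    -- AGA is the operator part of f g f, an element of the closed algebra, so the constant M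
    -- applies to it with the supremum of |p g p| on S.
    have h6 : ‖A * G * A‖ ≤ M * (C * (2 * C' + C) * C) := by
      have h7 := hM.norm_snd_le (f * g * f)
      have h8 : (f * g * f).1.2 = A * G * A := by
        rw [← hfA, ← map_mul, ← map_mul]
        rfl
      rw [h8] at h7
      refine h7.trans (mul_le_mul_of_nonneg_left ?_ hM0)
      rw [ContinuousMap.norm_le _ (by positivity)]
      intro z
      have h9 : (f * g * f).1.1 z = p.eval (z : ℂ) * g.1.1 z * p.eval (z : ℂ) := by
        rw [← aeval_elemental_fst (T := T) p z]
        rfl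
      have hz := hC z z.2
      rw [h9, norm_mul, norm_mul]
      have := h2 z
      gcongr
    -- The first term on the right contains A + G*, bounded by 2C'; the second contains AGA. The
    -- C*-identity makes the norm of the left side ‖A‖⁴.
    have h10 : A * star A * (A * star A) =
        A * star (A + star G) * A * star A - A * G * A * star A := by
      rw [star_add, star_star]
      noncomm_ring
    have h11 : ‖A * star A * (A * star A)‖ = ‖A‖ ^ 4 := by
      have : star (A * star A) = A * star A := by rw [star_mul, star_star]
      nth_rw 2 [← this]
      rw [CStarRing.norm_self_mul_star, CStarRing.norm_self_mul_star]
      ring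
    rw [← h11, h10]
    refine (norm_sub_le _ _).trans (add_le_add ?_ ?_)
    · calc ‖A * star (A + star G) * A * star A‖
          ≤ ‖A‖ * ‖A + star G‖ * ‖A‖ * ‖A‖ := by
            refine (norm_mul_le _ _).trans ?_
            rw [norm_star]
            refine mul_le_mul_of_nonneg_right ((norm_mul_le _ _).trans ?_) (norm_nonneg _)
            refine mul_le_mul_of_nonneg_right ((norm_mul_le _ _).trans ?_) (norm_nonneg _)
            rw [norm_star]
        _ ≤ (M * C) * (2 * C') * (M * C) * (M * C) := by gcongr
        _ = 2 * C' * (M * C) ^ 3 := by ring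
    · refine (norm_mul_le _ _).trans ?_
      rw [norm_star]
      gcongr
  -- The polygon lies outside S, so |p| is only bounded there by C' > C; now C' decreases to C.
  have hlim : Filter.Tendsto
      (fun C' => 2 * C' * (M * C) ^ 3 + M * (C * (2 * C' + C) * C) * (M * C))
        (nhdsWithin C (Set.Ioi C))
      (nhds (2 * C * (M * C) ^ 3 + M * (C * (2 * C + C) * C) * (M * C))) :=
    (Continuous.tendsto (by fun_prop) C).mono_left nhdsWithin_le_nhds
  refine (ge_of_tendsto hlim (Filter.eventually_of_mem self_mem_nhdsWithin key)).trans_eq ?_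
  ring

/-- The best constant M on the thickening satisfies M⁴ ≤ 2M³ + 3M², that is M²(M - 3)(M + 1) ≤ 0. -/
theorem isSpectralConst_cthickening [Nontrivial E] [FiniteDimensional ℂ E] (T : E →L[ℂ] E) {ε : ℝ}
    (hε : 0 < ε) : IsSpectralConst (Metric.cthickening ε (opRange T)) T 3 := by
  set S := Metric.cthickening ε (opRange T)
  have hSc : IsCompact S := (isCompact_opRange T).cthickening
  have hS : Convex ℝ S := (convex_opRange T).cthickening ε
  have hT : opRange T ⊆ S := Metric.self_subset_cthickening _
  set K := {M | 0 ≤ M ∧ IsSpectralConst S T M}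
  have hKne : K.Nonempty := exists_isSpectralConst T hε
  have hKbdd : BddBelow K := ⟨0, fun M hM => hM.1⟩
  have hC0 : ∀ {p : Polynomial ℂ} {C : ℝ}, (∀ z ∈ S, ‖p.eval z‖ ≤ C) → 0 ≤ C := by
    intro p C hC
    obtain ⟨z, hz⟩ := (opRange_nonempty T).mono hT
    exact (norm_nonneg _).trans (hC z hz)
  set M := sInf K
  have hM0 : 0 ≤ M := le_csInf hKne fun M hM => hM.1
  have hM : IsSpectralConst S T M := by
    intro p C hC
    rcases (hC0 hC).eq_or_lt with h0 | h0
    · obtain ⟨M', hM'⟩ := hKne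
      have := hM'.2 p C hC
      rw [← h0, mul_zero] at this ⊢
      exact this
    · rw [← div_le_iff₀ h0]
      refine le_csInf hKne fun M' hM' => ?_
      rw [div_le_iff₀ h0]
      exact hM'.2 p C hC
  -- The bootstrap makes this fourth root admissible too, so minimality of M gives M ≤ r.
  set r := √(√(2 * M ^ 3 + 3 * M ^ 2)) with hr
  have hr4 : r ^ 4 = 2 * M ^ 3 + 3 * M ^ 2 := by
    rw [hr, show (4 : ℕ) = 2 * 2 from rfl, pow_mul, Real.sq_sqrt (Real.sqrt_nonneg _),
      Real.sq_sqrt (by positivity)]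
  have hMr : M ≤ r := by
    refine csInf_le hKbdd ⟨Real.sqrt_nonneg _, fun p C hC => ?_⟩
    have h1 := hM.pow_four_le hSc hS hT hM0 hC
    rw [← hr4, ← mul_pow] at h1
    have := hC0 hC
    exact (pow_le_pow_iff_left₀ (norm_nonneg _) (by positivity) (by norm_num)).mp h1
  have hM3 : M ≤ 3 := by
    have h1 : M ^ 4 ≤ 2 * M ^ 3 + 3 * M ^ 2 := by
      rw [← hr4]
      gcongr
    by_contra! h
    have h2 : 0 < M ^ 2 * ((M - 3) * (M + 1)) := by
      have : 0 < M - 3 := by linarith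
      positivity
    nlinarith
  intro p C hC
  exact (hM p C hC).trans (mul_le_mul_of_nonneg_right hM3 (hC0 hC))

/-- Crouzeix's inequality with constant `3`. -/
theorem norm_aeval_le_three_mul [Nontrivial E] [FiniteDimensional ℂ E] (T : E →L[ℂ] E)
    (p : Polynomial ℂ) {C : ℝ} (hC : ∀ z ∈ opRange T, ‖p.eval z‖ ≤ C) :
    ‖Polynomial.aeval T p‖ ≤ 3 * C := by
  have key : ∀ C' > C, ‖Polynomial.aeval T p‖ ≤ 3 * C' := by
    intro C' hCC
    obtain ⟨δ, hδ, h⟩ := exists_cthickening_eval_le (isCompact_opRange T) p hC hCC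
    exact isSpectralConst_cthickening T hδ p C' h
  have hlim : Filter.Tendsto (fun C' : ℝ => 3 * C') (nhdsWithin C (Set.Ioi C)) (nhds (3 * C)) :=
    (Continuous.tendsto (by fun_prop) C).mono_left nhdsWithin_le_nhds
  exact ge_of_tendsto hlim (Filter.eventually_of_mem self_mem_nhdsWithin key)

theorem op_aeval {n : ℕ} (A : Matrix (Fin n) (Fin n) ℂ) (p : Polynomial ℂ) :
    op (Polynomial.aeval A p) = Polynomial.aeval (op A) p :=
  (Polynomial.aeval_algHom_apply
    ((Matrix.toEuclideanCLM (n := Fin n) (𝕜 := ℂ)).toAlgEquiv.toAlgHom) A p).symm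

theorem isCrouzeixBound_three : IsCrouzeixBound 3 := by
  intro n A p C hC0 hC
  rw [op_aeval]
  rcases n.eq_zero_or_pos with rfl | hn
  · have h : Polynomial.aeval (op A) p = 0 := Subsingleton.elim _ _
    rw [h, norm_zero]
    positivity
  · have : Nonempty (Fin n) := ⟨⟨0, hn⟩⟩
    rw [numericalRange_eq_opRange] at hC
    exact norm_aeval_le_three_mul (op A) p hC

/-- The nilpotent 2×2 block has norm at least 1, while |z| ≤ 1/2 on its numerical range; test with p
= X. -/
theorem IsCrouzeixBound.two_le {K : ℝ} (h : IsCrouzeixBound K) : 2 ≤ K := by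
  set J : Matrix (Fin 2) (Fin 2) ℂ := !![0, 1; 0, 0]
  have hnorm : 1 ≤ ‖op J‖ := by
    have h1 : op J (EuclideanSpace.single 1 1) = EuclideanSpace.single 0 1 := by
      ext i
      fin_cases i <;> simp [J, Matrix.ofLp_toEuclideanCLM]
    have h2 := (op J).le_opNorm (EuclideanSpace.single 1 1)
    rw [h1] at h2
    simpa using h2
  have hrange : ∀ z ∈ numericalRange J, ‖Polynomial.X.eval z‖ ≤ (1 / 2 : ℝ) := by
    rw [numericalRange_eq_opRange]
    rintro _ ⟨x, hx, rfl⟩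
    have h1 : inner ℂ x (op J x) = x 1 * conj (x 0) := by
      simp [PiLp.inner_apply, J, Matrix.ofLp_toEuclideanCLM, Matrix.mulVec, dotProduct]
    have h2 : ‖x 0‖ ^ 2 + ‖x 1‖ ^ 2 = 1 := by
      have := EuclideanSpace.norm_sq_eq x
      rw [hx, Fin.sum_univ_two] at this
      linarith
    rw [Polynomial.eval_X, h1, norm_mul, Complex.norm_conj]
    nlinarith [sq_nonneg (‖x 0‖ - ‖x 1‖)]
  have h3 := h 2 J Polynomial.X (1 / 2) (by norm_num) hrange
  rw [Polynomial.aeval_X] at h3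
  linarith

theorem isCrouzeixBound_crouzeixConstant : IsCrouzeixBound crouzeixConstant := by
  intro n A p C hC0 hC
  have hne : {K | IsCrouzeixBound K}.Nonempty := ⟨3, isCrouzeixBound_three⟩
  rcases hC0.eq_or_lt with h0 | h0
  · have := isCrouzeixBound_three n A p C hC0 hC
    rw [← h0, mul_zero] at this ⊢
    exact this
  · rw [← div_le_iff₀ h0]
    refine le_csInf hne fun K hK => ?_
    rw [div_le_iff₀ h0]
    exact hK n A p C hC0 hC

theorem two_le_crouzeixConstant : 2 ≤ crouzeixConstant :=
  le_csInf ⟨3, isCrouzeixBound_three⟩ fun _ hK => hK.two_le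

theorem crouzeixConstant_le_three : crouzeixConstant ≤ 3 :=
  csInf_le ⟨2, fun _ hK => hK.two_le⟩ isCrouzeixBound_three

end Crouzeix

/-! ### Divided differences on convex sets -/

section QuotientBound

open Polynomial

theorem iterate_derivative_X_sub_C_mul (a : ℂ) (D : ℂ[X]) (n : ℕ) :
    derivative^[n + 1] ((X - C a) * D) =
      (X - C a) * derivative^[n + 1] D + (n + 1 : ℂ[X]) * derivative^[n] D := by
  induction n with
  | zero =>
    simp [derivative_mul]
    ring
  | succ n ih =>
    rw [Function.iterate_succ_apply', ih, derivative_add, derivative_mul, derivative_mul,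
      derivative_sub, derivative_X, derivative_C, ← Function.iterate_succ_apply' (f := derivative)
      (n := n + 1), ← Function.iterate_succ_apply' (f := derivative) (n := n)]
    simp
    ring

/-- A divided difference with respect to one node loses one derivative. -/
theorem norm_eval_iterate_derivative_quotient_le {S : Set ℂ} (hS : Convex ℝ S) {a : ℂ} (ha : a ∈ S)
    {B D : ℂ[X]} {b : ℂ} (hB : B = (X - C a) * D + C b) {n : ℕ} {c : ℝ}
    (hc : ∀ z ∈ S, ‖(derivative^[n + 1] B).eval z‖ ≤ c) {z : ℂ} (hz : z ∈ S) :
    ‖(derivative^[n] D).eval z‖ ≤ c / (n + 1) := by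
  set γ : ℝ → ℂ := fun t => a + t * (z - a) with hγ
  have hγd : ∀ t, HasDerivAt γ (z - a) t := by
    intro t
    have h := ((Complex.ofRealCLM.hasDerivAt (x := t)).mul_const (z - a)).const_add a
    exact h.congr_deriv (by simp)
  have hn1 : (n + 1 : ℂ) ≠ 0 := by exact_mod_cast Nat.succ_ne_zero n
  have hB' : ∀ t : ℝ, (derivative^[n + 1] B).eval (γ t) =
      t * (z - a) * (derivative^[n + 1] D).eval (γ t) +
        (n + 1) * (derivative^[n] D).eval (γ t) := by
    intro t
    rw [hB, iterate_map_add, iterate_derivative_X_sub_C_mul, iterate_derivative_C (by omega)]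
    simp [hγ]
  -- By Leibniz, B^(n+1) = (X - a)D^(n+1) + (n+1)D^(n). Hence the factor t^(n+1) makes g'(t) = t^n
  -- B^(n+1)(γ t), and integrating c t^n over [0,1] gives c/(n+1).
  set g : ℝ → ℂ := fun t => (t : ℂ) ^ (n + 1) * (derivative^[n] D).eval (γ t) with hg
  have hgd : ∀ t : ℝ, HasDerivAt g ((t : ℂ) ^ n * (derivative^[n + 1] B).eval (γ t)) t := by
    intro t
    have h1 : HasDerivAt (fun t : ℝ => (t : ℂ) ^ (n + 1)) ((n + 1) * (t : ℂ) ^ n) t := by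
      have := (hasDerivAt_pow (n + 1) (t : ℂ)).comp_ofReal
      simpa using this
    have h2 : HasDerivAt (fun t : ℝ => (derivative^[n] D).eval (γ t))
        ((derivative^[n + 1] D).eval (γ t) * (z - a)) t := by
      have := ((derivative^[n] D).hasDerivAt (γ t)).comp t (hγd t)
      rw [← Function.iterate_succ_apply' (f := derivative)] at this
      exact this
    refine (h1.mul h2).congr_deriv ?_
    rw [hB', pow_succ]
    ring
  have hbd : ∀ t : ℝ, HasDerivAt (fun t : ℝ => c * t ^ (n + 1) / (n + 1)) (c * t ^ n) t := by
    intro t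
    refine (((hasDerivAt_pow (n + 1) t).const_mul c).div_const _).congr_deriv ?_
    have : (n + 1 : ℝ) ≠ 0 := by positivity
    push_cast
    field_simp
  have key := image_norm_le_of_norm_deriv_right_le_deriv_boundary (f := g)
    (f' := fun t => (t : ℂ) ^ n * (derivative^[n + 1] B).eval (γ t)) (a := 0) (b := 1)
    (B := fun t : ℝ => c * t ^ (n + 1) / (n + 1)) (B' := fun t => c * t ^ n)
    (fun t _ => (hgd t).continuousAt.continuousWithinAt) (fun t _ => (hgd t).hasDerivWithinAt)
    (by simp [hg]) hbd (fun t ht => by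
      have hmem : γ t ∈ S := by
        convert hS ha hz (sub_nonneg.mpr ht.2.le) ht.1 (by ring) using 1
        simp only [hγ, Complex.real_smul]
        push_cast
        ring
      rw [norm_mul, norm_pow, Complex.norm_real, Real.norm_of_nonneg ht.1, mul_comm]
      exact mul_le_mul_of_nonneg_right (hc _ hmem) (pow_nonneg ht.1 n))
    (Set.right_mem_Icc.mpr zero_le_one)
  simpa [hg, hγ] using key

/-- The quotient of a polynomial by a product of `n` linear factors with roots in a convex set is
bounded there by the `n`-th derivative over `n!`. -/
theorem norm_eval_quotient_le {S : Set ℂ} (hS : Convex ℝ S) (l : List ℂ) (hl : ∀ a ∈ l, a ∈ S)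
    {B g R : ℂ[X]} (hB : B = (l.map fun a => X - C a).prod * g + R) (hR : R.degree < l.length)
    {c : ℝ} (hc : ∀ z ∈ S, ‖(derivative^[l.length] B).eval z‖ ≤ c) {z : ℂ} (hz : z ∈ S) :
    ‖g.eval z‖ ≤ c / (l.length.factorial : ℝ) := by
  induction l generalizing B R c with
  | nil =>
    have hR0 : R = 0 := by
      rw [← degree_eq_bot]
      simpa [Nat.WithBot.lt_zero_iff] using hR
    have := hc z hz
    simpa [hB, hR0] using this
  | cons a l ih =>
    -- Dividing the remainder by X - a as well shows that the divided difference of B at a is again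
    -- a product of the remaining factors with g, plus a remainder of degree one less.
    set R' := R /ₘ (X - C a)
    have hRR : R = (X - C a) * R' + C (R.eval a) := by
      have := modByMonic_add_div R (X - C a)
      rw [modByMonic_X_sub_C_eq_C_eval] at this
      rw [add_comm]
      exact this.symm
    have hR' : R'.degree < l.length := by
      by_cases h0 : R' = 0
      · rw [h0, degree_zero]
        exact WithBot.bot_lt_coe _
      have h1 : R ≠ 0 := by
        rintro rfl
        exact h0 (zero_divByMonic _)
      have h2 : R'.natDegree = R.natDegree - 1 := by
        simpa using natDegree_divByMonic R (monic_X_sub_C a)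
      rw [degree_eq_natDegree h1, List.length_cons, Nat.cast_lt] at hR
      have h3 : 0 < R.natDegree := by
        by_contra! h
        apply h0
        rw [divByMonic_eq_zero_iff (monic_X_sub_C a), degree_X_sub_C]
        have := natDegree_eq_zero_iff_degree_le_zero.mp (Nat.le_zero.mp h)
        exact this.trans_lt (by norm_num)
      rw [degree_eq_natDegree h0, Nat.cast_lt]
      omega
    have h4 := ih (fun b hb => hl b (List.mem_cons_of_mem _ hb)) (R := R') rfl hR'
      (c := c / (l.length + 1)) fun z hz =>
        norm_eval_iterate_derivative_quotient_le hS (hl a List.mem_cons_self)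
          (b := R.eval a) (B := B) (by
            rw [hB]
            nth_rw 1 [hRR]
            rw [List.map_cons, List.prod_cons]
            ring) hc hz
    rw [List.length_cons, Nat.factorial_succ]
    convert h4 using 1
    push_cast
    rw [div_div]

end QuotientBound

/-! ### The Arnoldi process and its error on polynomials -/

section Arnoldi

variable {M : ℕ} (Z : Matrix (Fin M) (Fin M) ℂ) (v : EuclideanSpace ℂ (Fin M))

theorem op_arnoldiVec (hv : ‖v‖ = 1) (j : ℕ) : op Z (arnoldiVec Z v j) =
    ∑ i ∈ Finset.range (j + 2), arnoldiCoeff Z v i j • arnoldiVec Z v i := by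
  rw [Finset.sum_range_succ, arnoldiCoeff_succ Z v hv j, arnoldiVec_succ, Finset.sum_range]
  set w := op Z (arnoldiVec Z v j) -
    ∑ i : Fin (j + 1), arnoldiCoeff Z v i j • arnoldiVec Z v i with hw
  -- This also holds at a breakdown, where w and the next vector are both 0.
  have h : (‖w‖ : ℂ) • ((‖w‖ : ℂ)⁻¹ • w) = w := by
    by_cases h0 : w = 0
    · simp [h0]
    · rw [smul_smul, mul_inv_cancel₀ (by simpa using h0), one_smul]
  rw [h, hw]
  abel

theorem arnoldiVec_inner_eq_zero (hv : ‖v‖ = 1) {i j : ℕ} (h : i ≠ j) :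
    inner ℂ (arnoldiVec Z v i) (arnoldiVec Z v j) = 0 :=
  (arnoldiVec_orth Z v hv (max i j)).2.1 i (le_max_left _ _) j (le_max_right _ _) h

theorem norm_arnoldiVec_le (hv : ‖v‖ = 1) (i : ℕ) : ‖arnoldiVec Z v i‖ ≤ 1 := by
  rcases (arnoldiVec_orth Z v hv i).1 i le_rfl with h | h
  · simp [h]
  · exact h.le

theorem arnoldiCoeff_eq_zero (hv : ‖v‖ = 1) {i j : ℕ} (h : j + 1 < i) :
    arnoldiCoeff Z v i j = 0 := by
  rw [arnoldiCoeff, op_arnoldiVec Z v hv, inner_sum]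
  refine Finset.sum_eq_zero fun l hl => ?_
  rw [Finset.mem_range] at hl
  rw [inner_smul_right, arnoldiVec_inner_eq_zero Z v hv (by omega), mul_zero]

theorem op_arnoldiVec_eq_sum (hv : ‖v‖ = 1) {j m : ℕ} (hj : j < m) : op Z (arnoldiVec Z v j) =
    ∑ i ∈ Finset.range (m + 1), arnoldiCoeff Z v i j • arnoldiVec Z v i := by
  rw [op_arnoldiVec Z v hv]
  refine Finset.sum_subset (by intro i; simp only [Finset.mem_range]; omega) fun i _ hi => ?_
  rw [Finset.mem_range, not_lt] at hi
  rw [arnoldiCoeff_eq_zero Z v hv (by omega), zero_smul]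

/-- The linear combination of the Arnoldi vectors with coefficients `y`. -/
def arnoldiLin (m : ℕ) : (Fin m → ℂ) →ₗ[ℂ] EuclideanSpace ℂ (Fin M) :=
  Fintype.linearCombination ℂ (fun i : Fin m => arnoldiVec Z v i)

theorem arnoldiLin_apply (m : ℕ) (y : Fin m → ℂ) :
    arnoldiLin Z v m y = ∑ i : Fin m, y i • arnoldiVec Z v i := rfl

theorem toLp_arnoldiBasis_mulVec (m : ℕ) (y : Fin m → ℂ) :
    WithLp.toLp 2 (arnoldiBasis Z v m *ᵥ y) = arnoldiLin Z v m y := by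
  ext a
  simp [arnoldiLin_apply, arnoldiBasis, Matrix.mulVec, dotProduct, mul_comm]

/-- The Arnoldi relation `Z V_m = V_m H_m + h_{m+1,m} v_{m+1} e_mᵀ`. -/
theorem op_arnoldiLin (hv : ‖v‖ = 1) (m : ℕ) (y : Fin m → ℂ) :
    op Z (arnoldiLin Z v m y) = arnoldiLin Z v m (arnoldiHess Z v m *ᵥ y) +
      (∑ j : Fin m, arnoldiCoeff Z v m j * y j) • arnoldiVec Z v m := by
  have h1 : op Z (arnoldiLin Z v m y) = ∑ i ∈ Finset.range (m + 1),
      (∑ j : Fin m, arnoldiCoeff Z v i j * y j) • arnoldiVec Z v i := by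
    rw [arnoldiLin_apply, map_sum]
    simp only [map_smul, Finset.sum_smul]
    rw [Finset.sum_comm]
    refine Finset.sum_congr rfl fun j _ => ?_
    rw [op_arnoldiVec_eq_sum Z v hv j.2, Finset.smul_sum]
    exact Finset.sum_congr rfl fun i _ => by rw [smul_smul, mul_comm]
  rw [h1, Finset.sum_range_succ, Finset.sum_range, arnoldiLin_apply]
  rfl

/-- The first unit vector. -/
def firstVec (m : ℕ) : Fin m → ℂ := fun i => if (i : ℕ) = 0 then 1 else 0

/-- Each multiplication by the Hessenberg matrix moves the last nonzero position down by at most one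
and multiplies the entry there by a subdiagonal coefficient. -/
theorem arnoldiHess_pow_firstVec (hv : ‖v‖ = 1) {m d : ℕ} (hd : d < m) :
    (∀ i : Fin m, d < i → (arnoldiHess Z v m ^ d *ᵥ firstVec m) i = 0) ∧
    ∀ i : Fin m, (i : ℕ) = d → (arnoldiHess Z v m ^ d *ᵥ firstVec m) i =
      ∏ l ∈ Finset.range d, arnoldiCoeff Z v (l + 1) l := by
  induction d with
  | zero =>
    constructor
    · intro i hi
      simp only [pow_zero, Matrix.one_mulVec, firstVec]
      exact if_neg hi.ne'
    · intro i hi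
      simp [firstVec, hi]
  | succ d ih =>
    obtain ⟨h1, h2⟩ := ih (by omega)
    set y := arnoldiHess Z v m ^ d *ᵥ firstVec m
    have hy : arnoldiHess Z v m ^ (d + 1) *ᵥ firstVec m = arnoldiHess Z v m *ᵥ y := by
      rw [pow_succ', ← Matrix.mulVec_mulVec]
    rw [hy]
    constructor
    · intro i hi
      rw [Matrix.mulVec, dotProduct]
      refine Finset.sum_eq_zero fun j _ => ?_
      rcases lt_or_ge d (j : ℕ) with hj | hj
      · rw [h1 j hj, mul_zero]
      · rw [arnoldiHess, Matrix.of_apply, arnoldiCoeff_eq_zero Z v hv (by omega), zero_mul]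
    · intro i hi
      rw [Matrix.mulVec, dotProduct, Finset.sum_eq_single (⟨d, by omega⟩ : Fin m)]
      · rw [h2 _ rfl, arnoldiHess, Matrix.of_apply, hi, Finset.prod_range_succ, mul_comm]
      · intro j _ hj
        rcases lt_or_ge d (j : ℕ) with hj' | hj'
        · rw [h1 j hj', mul_zero]
        · have : (j : ℕ) ≠ d := fun h => hj (Fin.ext h)
          rw [arnoldiHess, Matrix.of_apply, arnoldiCoeff_eq_zero Z v hv (by omega), zero_mul]
      · simp

theorem sum_arnoldiCoeff_last (hv : ‖v‖ = 1) {m d : ℕ} (hd : d + 1 = m) :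
    ∑ j : Fin m, arnoldiCoeff Z v m j * (arnoldiHess Z v m ^ d *ᵥ firstVec m) j =
      ∏ l ∈ Finset.range m, arnoldiCoeff Z v (l + 1) l := by
  subst hd
  rw [Finset.sum_eq_single (⟨d, by omega⟩ : Fin (d + 1))]
  · rw [(arnoldiHess_pow_firstVec Z v hv (Nat.lt_succ_self d)).2 ⟨d, by omega⟩ rfl,
      Finset.prod_range_succ,
      mul_comm]
  · intro j _ hj
    have : (j : ℕ) ≠ d := fun h => hj (Fin.ext h)
    rw [arnoldiCoeff_eq_zero Z v hv (by omega), zero_mul]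
  · simp

/-- The rank-one term of the Arnoldi relation sees only the last component, which is still zero for
the powers of H_m applied to e_1 that occur before the m-th step. -/
theorem op_pow_apply_of_lt (hv : ‖v‖ = 1) {m d : ℕ} (hd : d < m) :
    op (Z ^ d) v = arnoldiLin Z v m (arnoldiHess Z v m ^ d *ᵥ firstVec m) := by
  induction d with
  | zero =>
    rw [pow_zero, pow_zero, Matrix.one_mulVec, arnoldiLin_apply,
      Finset.sum_eq_single (⟨0, hd⟩ : Fin m)]
    · simp [firstVec, arnoldiVec]
    · intro j _ hj
      have : (j : ℕ) ≠ 0 := fun h => hj (Fin.ext h)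
      simp [firstVec, this]
    · simp
  | succ d ih =>
    have h1 : op (Z ^ (d + 1)) v = op Z (op (Z ^ d) v) := by
      rw [pow_succ', op, map_mul, mul_apply_eq_comp]
    rw [h1, ih (by omega), op_arnoldiLin Z v hv, pow_succ', ← Matrix.mulVec_mulVec]
    convert add_zero _
    convert zero_smul ℂ _
    refine Finset.sum_eq_zero fun j _ => ?_
    by_cases hj : (j : ℕ) + 1 = m
    · rw [(arnoldiHess_pow_firstVec Z v hv (by omega)).1 j (by omega), mul_zero]
    · rw [arnoldiCoeff_eq_zero Z v hv (by omega), zero_mul]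

theorem op_pow_apply_self (hv : ‖v‖ = 1) {m : ℕ} (hm : 1 ≤ m) :
    op (Z ^ m) v = arnoldiLin Z v m (arnoldiHess Z v m ^ m *ᵥ firstVec m) +
      (∏ l ∈ Finset.range m, arnoldiCoeff Z v (l + 1) l) • arnoldiVec Z v m := by
  obtain ⟨d, rfl⟩ : ∃ d, m = d + 1 := ⟨m - 1, by omega⟩
  have h1 : op (Z ^ (d + 1)) v = op Z (op (Z ^ d) v) := by
    rw [pow_succ', op, map_mul, mul_apply_eq_comp]
  rw [h1, op_pow_apply_of_lt Z v hv (Nat.lt_succ_self d), op_arnoldiLin Z v hv,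
    sum_arnoldiCoeff_last Z v hv rfl, pow_succ', ← Matrix.mulVec_mulVec]

/-- The Arnoldi approximation is exact for polynomials of degree less than `m`. -/
theorem op_aeval_apply_of_degree_lt (hv : ‖v‖ = 1) {m : ℕ} {p : Polynomial ℂ} (hp : p.degree < m) :
    op (Polynomial.aeval Z p) v =
      arnoldiLin Z v m (Polynomial.aeval (arnoldiHess Z v m) p *ᵥ firstVec m) := by
  rw [Polynomial.aeval_eq_sum_range, Polynomial.aeval_eq_sum_range, op, map_sum,
    Matrix.sum_mulVec, map_sum, sum_apply]
  refine Finset.sum_congr rfl fun d hd => ?_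
  rw [map_smul, smul_apply, Matrix.smul_mulVec, map_smul]
  by_cases hc : p.coeff d = 0
  · rw [hc, zero_smul, zero_smul]
  · have hdm : d < m := by
      have := (Polynomial.le_degree_of_ne_zero hc).trans_lt hp
      exact_mod_cast this
    rw [← op_pow_apply_of_lt Z v hv hdm]

/-- The approximation is exact for q - X^m, and q(H_m) = 0 by Cayley–Hamilton, so only the defect of
the m-th power remains. -/
theorem op_aeval_charpoly_apply (hv : ‖v‖ = 1) {m : ℕ} (hm : 1 ≤ m) :
    op (Polynomial.aeval Z (arnoldiHess Z v m).charpoly) v =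
      (∏ l ∈ Finset.range m, arnoldiCoeff Z v (l + 1) l) • arnoldiVec Z v m := by
  set H := arnoldiHess Z v m
  set q := H.charpoly
  have hq : q.Monic := H.charpoly_monic
  have hdeg : q.degree = m := by
    rw [Matrix.charpoly_degree_eq_dim, Fintype.card_fin]
  have hlt : (q - Polynomial.X ^ m).degree < (m : WithBot ℕ) := by
    have := Polynomial.degree_sub_lt_left (p := q) (q := Polynomial.X ^ m) (by rw [hdeg]; simp)
      hq.ne_zero (by rw [hq.leadingCoeff]; simp)
    rwa [hdeg] at this
  have h1 := op_aeval_apply_of_degree_lt Z v hv hlt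
  have h2 : Polynomial.aeval H (q - Polynomial.X ^ m) = - H ^ m := by
    rw [map_sub, Matrix.aeval_self_charpoly, map_pow, Polynomial.aeval_X, zero_sub]
  rw [h2, map_sub, map_pow, Polynomial.aeval_X, op, map_sub, sub_apply,
    sub_eq_iff_eq_add, op_pow_apply_self Z v hv hm, Matrix.neg_mulVec, map_neg] at h1
  rw [op, h1, neg_add_cancel_left]

/-- The error of the Arnoldi approximation of a polynomial. -/
theorem op_aeval_sub_arnoldiLin (hv : ‖v‖ = 1) {m : ℕ} (hm : 1 ≤ m) (p : Polynomial ℂ) :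
    op (Polynomial.aeval Z p) v -
        arnoldiLin Z v m (Polynomial.aeval (arnoldiHess Z v m) p *ᵥ firstVec m) =
      op (Polynomial.aeval Z (p /ₘ (arnoldiHess Z v m).charpoly))
        ((∏ l ∈ Finset.range m, arnoldiCoeff Z v (l + 1) l) • arnoldiVec Z v m) := by
  set H := arnoldiHess Z v m
  set q := H.charpoly
  have hq : q.Monic := H.charpoly_monic
  have hdeg : q.degree = m := by
    rw [Matrix.charpoly_degree_eq_dim, Fintype.card_fin]
  -- Both p and its remainder modulo q take the same value at H_m, and the remainder is reproduced
  -- exactly; only the quotient applied to q(Z)v is left.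
  have hp := Polynomial.modByMonic_add_div p q
  have h1 : Polynomial.aeval H p = Polynomial.aeval H (p %ₘ q) := by
    conv_lhs => rw [← hp]
    rw [map_add, map_mul, Matrix.aeval_self_charpoly, zero_mul, add_zero]
  have h2 : (p %ₘ q).degree < m := hdeg ▸ Polynomial.degree_modByMonic_lt p hq
  rw [h1, ← op_aeval_apply_of_degree_lt Z v hv h2, ← op_aeval_charpoly_apply Z v hv hm]
  have h3 : op (Polynomial.aeval Z p) v = op (Polynomial.aeval Z (p %ₘ q)) v +
      op (Polynomial.aeval Z (p /ₘ q)) (op (Polynomial.aeval Z q) v) := by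
    conv_lhs => rw [← hp]
    rw [mul_comm, map_add, map_mul, op, map_add, map_mul, add_apply, mul_apply_eq_comp]
  rw [h3, add_sub_cancel_left]

theorem norm_arnoldiVec_eq_one (hv : ‖v‖ = 1) {m : ℕ}
    (hbreak : ∀ i : ℕ, i + 1 < m → arnoldiCoeff Z v (i + 1) i ≠ 0) {i : ℕ} (hi : i < m) :
    ‖arnoldiVec Z v i‖ = 1 := by
  rcases (arnoldiVec_orth Z v hv i).1 i le_rfl with h | h
  · rcases i with _ | i
    · rwa [arnoldiVec]
    · exact absurd (by rw [arnoldiCoeff, h, inner_zero_left]) (hbreak i hi)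
  · exact h

/-- The numerical range of `H_m` is contained in that of `Z`. -/
theorem opRange_arnoldiHess_subset (hv : ‖v‖ = 1) {m : ℕ}
    (hbreak : ∀ i : ℕ, i + 1 < m → arnoldiCoeff Z v (i + 1) i ≠ 0) :
    opRange (op (arnoldiHess Z v m)) ⊆ opRange (op Z) := by
  rintro _ ⟨x, hx, rfl⟩
  have horth : ∀ i j : Fin m, inner ℂ (arnoldiVec Z v i) (arnoldiVec Z v j) =
      if i = j then (1 : ℂ) else 0 := by
    intro i j
    split_ifs with h
    · rw [h, inner_self_eq_norm_sq_to_K, norm_arnoldiVec_eq_one Z v hv hbreak j.2]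
      simp
    · exact arnoldiVec_inner_eq_zero Z v hv fun h' => h (Fin.ext h')
  refine ⟨arnoldiLin Z v m x.ofLp, ?_, ?_⟩
  · have h1 : inner ℂ (arnoldiLin Z v m x.ofLp) (arnoldiLin Z v m x.ofLp) = inner ℂ x x := by
      simp only [arnoldiLin_apply, sum_inner, inner_sum, inner_smul_left, inner_smul_right, horth]
      simp only [PiLp.inner_apply, RCLike.inner_apply]
      simp
    rw [inner_self_eq_norm_sq_to_K, inner_self_eq_norm_sq_to_K, hx] at h1
    have h2 : ‖arnoldiLin Z v m x.ofLp‖ ^ 2 = 1 := by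
      have : ((‖arnoldiLin Z v m x.ofLp‖ ^ 2 : ℝ) : ℂ) = ((1 : ℝ) ^ 2 : ℝ) := by
        push_cast
        exact h1
      rw [Complex.ofReal_inj] at this
      linarith
    exact (pow_eq_one_iff_of_nonneg (norm_nonneg _) two_ne_zero).mp h2
  · have h1 : inner ℂ (arnoldiLin Z v m x.ofLp) (op Z (arnoldiLin Z v m x.ofLp)) =
        ∑ i : Fin m, ∑ j : Fin m, conj (x.ofLp i) * (x.ofLp j * arnoldiCoeff Z v i j) := by
      rw [arnoldiLin_apply, map_sum, sum_inner]
      refine Finset.sum_congr rfl fun i _ => ?_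
      rw [inner_sum]
      refine Finset.sum_congr rfl fun j _ => ?_
      rw [map_smul, inner_smul_left, inner_smul_right]
      rfl
    rw [h1]
    simp only [PiLp.inner_apply, Matrix.ofLp_toEuclideanCLM, Matrix.mulVec, dotProduct,
      arnoldiHess, Matrix.of_apply, RCLike.inner_apply]
    refine Finset.sum_congr rfl fun i _ => ?_
    rw [Finset.sum_mul]
    exact Finset.sum_congr rfl fun j _ => by ring

end Arnoldi

/-! ### Convexity of the lens and location of F(Z) -/

section Lens

/-- Directions spanning the dual cone of the sector of semiangle `θ` around the positive axis. -/
def dualDirs (θ : ℝ) : Set ℂ := {1, ⟨Real.sin θ, Real.cos θ⟩, ⟨Real.sin θ, -Real.cos θ⟩}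

theorem mem_sector_iff_cos {θ : ℝ} (hθ0 : 0 ≤ θ) (hθ : θ < Real.pi / 2) {l : ℂ} :
    l ∈ sector θ ↔ Real.cos θ * ‖l‖ ≤ -l.re := by
  by_cases hl : l = 0
  · simp [hl, sector, hθ0]
  have hl' : -l ≠ 0 := neg_ne_zero.mpr hl
  have hpos : 0 < ‖l‖ := norm_pos_iff.mpr hl
  have hpi := Real.pi_pos
  rw [sector, Set.mem_ofPred_eq, ← Real.strictAntiOn_cos.le_iff_ge (a := θ) (b := |arg (-l)|)
    ⟨hθ0, by linarith⟩ ⟨abs_nonneg _, abs_arg_le_pi _⟩, Real.cos_abs, Complex.cos_arg hl', norm_neg,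
    Complex.neg_re, le_div_iff₀ hpos]

/-- Half-plane conditions are linear in l, so they pass directly to quadratic forms. The direction 1
matters for θ = 0, where the other two only force the imaginary part to vanish. -/
theorem mem_sector_iff {θ : ℝ} (hθ0 : 0 ≤ θ) (hθ : θ < Real.pi / 2) {l : ℂ} :
    l ∈ sector θ ↔ ∀ ω ∈ dualDirs θ, 0 ≤ (ω * -l).re := by
  have hpi := Real.pi_pos
  have hc : 0 < Real.cos θ := Real.cos_pos_of_mem_Ioo ⟨by linarith, hθ⟩
  have hs : 0 ≤ Real.sin θ := Real.sin_nonneg_of_nonneg_of_le_pi hθ0 (by linarith)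
  have hsc := Real.sin_sq_add_cos_sq θ
  set c := Real.cos θ
  set s := Real.sin θ
  rw [mem_sector_iff_cos hθ0 hθ]
  have hn : ‖l‖ ^ 2 = l.re ^ 2 + l.im ^ 2 := by
    rw [← Complex.normSq_eq_norm_sq, Complex.normSq_apply]
    ring
  simp only [dualDirs, Set.mem_insert_iff, Set.mem_singleton_iff, forall_eq_or_imp, forall_eq,
    Complex.mul_re, Complex.neg_re, Complex.neg_im, Complex.one_re, Complex.one_im]
  constructor
  · intro h
    have h0 : 0 ≤ -l.re := (mul_nonneg hc.le (norm_nonneg l)).trans h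
    have h1 : (c * ‖l‖) ^ 2 ≤ (-l.re) ^ 2 := by
      have : 0 ≤ c * ‖l‖ := by positivity
      gcongr
    have h2 : (c * l.im) ^ 2 ≤ (s * -l.re) ^ 2 := by
      rw [mul_pow, hn] at h1
      have : s ^ 2 = 1 - c ^ 2 := by linarith
      rw [mul_pow, mul_pow, this]
      nlinarith
    have h3 := abs_le_of_sq_le_sq' h2 (mul_nonneg hs h0)
    refine ⟨by linarith, by linarith, by linarith⟩
  · rintro ⟨h0, h1, h2⟩
    have h3 : (c * l.im) ^ 2 ≤ (s * -l.re) ^ 2 := sq_le_sq' (by linarith) (by linarith)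
    refine le_of_sq_le_sq ?_ (by linarith)
    rw [mul_pow, hn]
    have : s ^ 2 = 1 - c ^ 2 := by linarith
    rw [mul_pow, mul_pow, this] at h3
    nlinarith

theorem re_nonneg_of_mem_dualDirs {θ : ℝ} (hθ0 : 0 ≤ θ) (hθ : θ < Real.pi / 2) {ω : ℂ}
    (hω : ω ∈ dualDirs θ) : 0 ≤ ω.re := by
  have hpi := Real.pi_pos
  have hs : 0 ≤ Real.sin θ := Real.sin_nonneg_of_nonneg_of_le_pi hθ0 (by linarith)
  rcases hω with rfl | rfl | rfl
  · simp
  · exact hs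
  · exact hs

/-- The intersection of disks whose points other than `0` form the lens. -/
def diskInter (θ : ℝ) : Set ℂ := {z | ∀ ω ∈ dualDirs θ, ω.re * ‖z‖ ^ 2 ≤ (ω * conj z).re}

theorem one_sub_ne_zero_of_mem_sector {θ δ : ℝ} (hθ0 : 0 ≤ θ) (hθ : θ < Real.pi / 2) (hδ : 0 < δ)
    {l : ℂ} (hl : l ∈ sector θ) : 1 ≤ (1 - (δ : ℂ) * l).re := by
  have h := (mem_sector_iff hθ0 hθ).mp hl 1 (Or.inl rfl)
  rw [one_mul, Complex.neg_re] at h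
  rw [Complex.sub_re, Complex.one_re, Complex.re_ofReal_mul]
  nlinarith

/-- For z = (1 - δλ)⁻¹ one has conj z - |z|² = δ|z|²(-λ), so each half-plane for -λ becomes a disk
(or half-plane) condition on z with 0 on its boundary. -/
theorem mem_lens_iff {θ δ : ℝ} (hθ0 : 0 ≤ θ) (hθ : θ < Real.pi / 2) (hδ : 0 < δ) {z : ℂ} :
    z ∈ lens δ θ ↔ z ≠ 0 ∧ z ∈ diskInter θ := by
  have hδ' : (δ : ℂ) ≠ 0 := by exact_mod_cast hδ.ne'
  have key : ∀ l : ℂ, (1 - (δ : ℂ) * l) ≠ 0 →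
      (l ∈ sector θ ↔ (1 - (δ : ℂ) * l)⁻¹ ∈ diskInter θ) := by
    intro l hl
    rw [mem_sector_iff hθ0 hθ, diskInter, Set.mem_ofPred_eq]
    refine forall₂_congr fun ω _ => ?_
    have h1 : ω * conj ((1 - (δ : ℂ) * l)⁻¹) - ω * ((‖(1 - (δ : ℂ) * l)⁻¹‖ ^ 2 : ℝ) : ℂ) =
        ((δ * ‖(1 - (δ : ℂ) * l)⁻¹‖ ^ 2 : ℝ) : ℂ) * (ω * -l) := by
      rw [← Complex.normSq_eq_norm_sq, Complex.ofReal_mul, ← Complex.mul_conj]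
      linear_combination (-ω * conj ((1 - (δ : ℂ) * l)⁻¹)) * (inv_mul_cancel₀ hl)
    have h2 := congrArg Complex.re h1
    rw [Complex.sub_re, Complex.re_mul_ofReal, Complex.re_ofReal_mul] at h2
    rw [← sub_nonneg (b := ω.re * _), h2]
    have h3 : 0 < δ * ‖(1 - (δ : ℂ) * l)⁻¹‖ ^ 2 := by
      have : 0 < ‖(1 - (δ : ℂ) * l)⁻¹‖ := norm_pos_iff.mpr (inv_ne_zero hl)
      positivity
    exact (mul_nonneg_iff_of_pos_left h3).symm
  constructor
  · rintro ⟨l, hl, rfl⟩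
    have h0 : (1 - (δ : ℂ) * l) ≠ 0 := by
      intro h
      have := one_sub_ne_zero_of_mem_sector hθ0 hθ hδ hl
      rw [h, Complex.zero_re] at this
      linarith
    exact ⟨inv_ne_zero h0, (key l h0).mp hl⟩
  · rintro ⟨hz, hzd⟩
    have h1 : 1 - (δ : ℂ) * ((1 - z⁻¹) / δ) = z⁻¹ := by
      field_simp
      ring
    have h2 := key ((1 - z⁻¹) / δ) (by rw [h1]; exact inv_ne_zero hz)
    rw [h1, inv_inv] at h2
    exact ⟨_, h2.mpr hzd, by simp only [h1, inv_inv]⟩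

theorem convex_diskInter {θ : ℝ} (hθ0 : 0 ≤ θ) (hθ : θ < Real.pi / 2) : Convex ℝ (diskInter θ) := by
  have h : diskInter θ = ⋂ ω ∈ dualDirs θ, {z | ω.re * ‖z‖ ^ 2 ≤ (ω * conj z).re} := by
    ext z
    simp [diskInter]
  rw [h]
  refine convex_iInter₂ fun ω hω => ?_
  have h1 : ConvexOn ℝ Set.univ fun z : ℂ => ω.re * ‖z‖ ^ 2 := by
    have := ((convexOn_univ_norm (E := ℂ)).pow (fun z _ => norm_nonneg z) 2).smul
      (re_nonneg_of_mem_dualDirs hθ0 hθ hω)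
    simpa using this
  have h2 : ConcaveOn ℝ Set.univ fun z : ℂ => (ω * conj z).re :=
    ((Complex.reLm ∘ₗ (LinearMap.mulLeft ℝ ω)) ∘ₗ Complex.conjAe.toLinearMap).concaveOn convex_univ
  have h3 := (h1.sub h2).convex_le 0
  simpa using h3

theorem isClosed_diskInter (θ : ℝ) : IsClosed (diskInter θ) := by
  have h : diskInter θ = ⋂ ω ∈ dualDirs θ, {z | ω.re * ‖z‖ ^ 2 ≤ (ω * conj z).re} := by
    ext z
    simp [diskInter]
  rw [h]
  exact isClosed_biInter fun ω _ => isClosed_le (by fun_prop) (by fun_prop)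

theorem one_mem_diskInter (θ : ℝ) : (1 : ℂ) ∈ diskInter θ := by
  intro ω _
  simp

theorem norm_sq_le_re_of_mem_diskInter {θ : ℝ} {z : ℂ} (hz : z ∈ diskInter θ) :
    ‖z‖ ^ 2 ≤ z.re := by
  simpa using hz 1 (Or.inl rfl)

theorem norm_le_one_of_mem_diskInter {θ : ℝ} {z : ℂ} (hz : z ∈ diskInter θ) : ‖z‖ ≤ 1 := by
  have h1 := norm_sq_le_re_of_mem_diskInter hz
  have h2 := Complex.re_le_norm z
  by_contra! h
  nlinarith

variable {M : ℕ} {L : Matrix (Fin M) (Fin M) ℂ} {θ δ : ℝ}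

theorem isUnit_op_of_injective {n : ℕ} {A : Matrix (Fin n) (Fin n) ℂ}
    (h : ∀ x, op A x = 0 → x = 0) : IsUnit A := by
  rw [← Matrix.mulVec_injective_iff_isUnit]
  refine (injective_iff_map_eq_zero (Matrix.mulVecLin A)).mpr ?_
  intro x hx
  have := h (WithLp.toLp 2 x) (by
    rw [op, Matrix.toEuclideanCLM_toLp]
    change WithLp.toLp 2 (Matrix.mulVecLin A x) = 0
    rw [hx]
    rfl)
  simpa using this

theorem op_one_sub_smul_apply (x : EuclideanSpace ℂ (Fin M)) :
    op (1 - (δ : ℂ) • L) x = x - (δ : ℂ) • op L x := by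
  rw [op, map_sub, map_one, map_smul, sub_apply, smul_apply, one_apply_eq_self]

theorem inner_neg_mem_dual (hθ0 : 0 ≤ θ) (hθ : θ < Real.pi / 2) (hL : opRange (op L) ⊆ sector θ)
    (y : EuclideanSpace ℂ (Fin M)) {ω : ℂ} (hω : ω ∈ dualDirs θ) :
    0 ≤ (ω * -inner ℂ y (op L y)).re := by
  by_cases hy : y = 0
  · simp [hy]
  obtain ⟨l, hl, hyl⟩ := exists_opRange_inner_eq (op L) hy
  rw [hyl, ← mul_neg, mul_left_comm, ← Complex.ofReal_pow, Complex.re_ofReal_mul]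
  exact mul_nonneg (sq_nonneg _) ((mem_sector_iff hθ0 hθ).mp (hL hl) ω hω)

theorem isUnit_one_sub_smul (hθ0 : 0 ≤ θ) (hθ : θ < Real.pi / 2) (hδ : 0 < δ)
    (hL : opRange (op L) ⊆ sector θ) : IsUnit (1 - (δ : ℂ) • L) := by
  refine isUnit_op_of_injective fun y hy => ?_
  rw [op_one_sub_smul_apply, sub_eq_zero] at hy
  have h1 := inner_neg_mem_dual hθ0 hθ hL y (ω := 1) (Or.inl rfl)
  have h2 : inner ℂ y y = (δ : ℂ) * inner ℂ y (op L y) := by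
    rw [← inner_smul_right, ← hy]
  rw [inner_self_eq_norm_sq_to_K] at h2
  have h3 : ‖y‖ ^ 2 = δ * (inner ℂ y (op L y)).re := by
    rw [← Complex.re_ofReal_mul, ← h2]
    simp only [coe_algebraMap]
    rw [← Complex.ofReal_pow, Complex.ofReal_re]
  rw [one_mul, Complex.neg_re] at h1
  have h4 : ‖y‖ ^ 2 ≤ 0 := by nlinarith
  exact norm_eq_zero.mp (pow_eq_zero_iff two_ne_zero |>.mp (le_antisymm h4 (sq_nonneg _)))

/-- For a unit vector x and y = Zx, x = y - δLy gives conj⟨x,y⟩ = ‖y‖² - δ⟨y,Ly⟩. Together with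
|⟨x,y⟩| ≤ ‖y‖, the half-plane inequalities for L become the disk inequalities for Z; y ≠ 0 makes the
real part positive. -/
theorem opRange_shiftInv_subset (hθ0 : 0 ≤ θ) (hθ : θ < Real.pi / 2) (hδ : 0 < δ)
    (hL : opRange (op L) ⊆ sector θ) {z : ℂ} (hz : z ∈ opRange (op (shiftInv δ L))) :
    z ∈ diskInter θ ∧ 0 < z.re := by
  obtain ⟨x, hx, rfl⟩ := hz
  set y := op (shiftInv δ L) x with hy
  have hu := isUnit_one_sub_smul hθ0 hθ hδ hL
  have hxy : x = y - (δ : ℂ) • op L y := by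
    rw [← op_one_sub_smul_apply, hy, shiftInv, op, op, ← mul_apply_eq_comp, ← map_mul,
      Matrix.mul_nonsing_inv _ ((Matrix.isUnit_iff_isUnit_det _).mp hu), map_one,
      one_apply_eq_self]
  have h1 : conj (inner ℂ x y) = ((‖y‖ ^ 2 : ℝ) : ℂ) + (δ : ℂ) * -inner ℂ y (op L y) := by
    rw [inner_conj_symm]
    nth_rw 1 [hxy]
    rw [inner_sub_right, inner_smul_right, inner_self_eq_norm_sq_to_K]
    push_cast
    simp only [coe_algebraMap]
    ring
  have h2 : ‖inner ℂ x y‖ ^ 2 ≤ ‖y‖ ^ 2 := by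
    have := norm_inner_le_norm (𝕜 := ℂ) x y
    rw [hx, one_mul] at this
    gcongr
  have h3 : inner ℂ x y ∈ diskInter θ := by
    intro ω hω
    rw [h1, mul_add, Complex.add_re, Complex.re_mul_ofReal, mul_left_comm, Complex.re_ofReal_mul]
    have := mul_le_mul_of_nonneg_left h2 (re_nonneg_of_mem_dualDirs hθ0 hθ hω)
    have := mul_nonneg hδ.le (inner_neg_mem_dual hθ0 hθ hL y hω)
    linarith
  refine ⟨h3, ?_⟩
  have hy0 : y ≠ 0 := by
    intro h
    rw [h, map_zero, smul_zero, sub_zero] at hxy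
    simp [hxy] at hx
  have h4 : (inner ℂ x y).re = ‖y‖ ^ 2 + δ * (-inner ℂ y (op L y)).re := by
    rw [← Complex.conj_re, h1, Complex.add_re, Complex.ofReal_re, Complex.re_ofReal_mul]
  have h5 := inner_neg_mem_dual hθ0 hθ hL y (ω := 1) (Or.inl rfl)
  rw [one_mul] at h5
  rw [h4]
  have : 0 < ‖y‖ := norm_pos_iff.mpr hy0
  positivity

end Lens

/-! ### Attainment of the maximum on the lens -/

section Maximum

open Filter Topology

theorem rdFun_zero_apply (τ : ℝ) (z : ℂ) : rdFun τ 0 z = Complex.exp (τ * (1 - z⁻¹)) := by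
  rw [rdFun, phi_zero, Ring.inverse_eq_inv, smul_eq_mul]

/-- Functions of the form exp(τ(1 - 1/z)) z^k Q(1/z) are stable under differentiation; the witness
in the induction step is the product and chain rule in the variable 1/z. -/
theorem exists_iteratedDeriv_eq (τ : ℝ) (k n : ℕ) : ∃ Q : Polynomial ℂ, ∀ z : ℂ, z ≠ 0 →
    iteratedDeriv n (fun w : ℂ => rdFun τ 0 w * w ^ k) z =
      Complex.exp (τ * (1 - z⁻¹)) * (z ^ k * Q.eval z⁻¹) := by
  induction n with
  | zero => exact ⟨1, fun z _ => by simp [rdFun_zero_apply]⟩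
  | succ n ih =>
    obtain ⟨Q, hQ⟩ := ih
    refine ⟨Polynomial.C (τ : ℂ) * Polynomial.X ^ 2 * Q + Polynomial.C (k : ℂ) * Polynomial.X * Q -
      Polynomial.X ^ 2 * Polynomial.derivative Q, fun z hz => ?_⟩
    have h1 : iteratedDeriv n (fun w : ℂ => rdFun τ 0 w * w ^ k) =ᶠ[𝓝 z]
        fun z => Complex.exp (τ * (1 - z⁻¹)) * (z ^ k * Q.eval z⁻¹) := by
      filter_upwards [isOpen_ne.mem_nhds hz] with w hw using hQ w hw
    rw [iteratedDeriv_succ, h1.deriv_eq]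
    have d1 : HasDerivAt (fun z : ℂ => Complex.exp (τ * (1 - z⁻¹)))
        (Complex.exp (τ * (1 - z⁻¹)) * (τ * (z⁻¹) ^ 2)) z := by
      refine ((((hasDerivAt_inv hz).const_sub 1).const_mul (τ : ℂ)).cexp).congr_deriv ?_
      field_simp
    have d2 : HasDerivAt (fun z : ℂ => Q.eval z⁻¹) ((Polynomial.derivative Q).eval z⁻¹ *
        -(z⁻¹) ^ 2) z := by
      refine ((Q.hasDerivAt z⁻¹).comp z (hasDerivAt_inv hz)).congr_deriv ?_
      field_simp
    have d3 : HasDerivAt (fun z : ℂ => z ^ k) (k * z ^ k * z⁻¹) z := by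
      refine (hasDerivAt_pow k z).congr_deriv ?_
      rcases k with _ | k
      · simp
      · rw [Nat.add_sub_cancel, pow_succ]
        field_simp
    have d4 : HasDerivAt (fun z : ℂ => Complex.exp (τ * (1 - z⁻¹)) * (z ^ k * Q.eval z⁻¹)) _ z :=
      d1.mul (d3.mul d2)
    rw [d4.deriv]
    simp only [Polynomial.eval_sub, Polynomial.eval_add, Polynomial.eval_mul, Polynomial.eval_C,
      Polynomial.eval_pow, Polynomial.eval_X]
    ring

theorem tendsto_norm_eval_mul_exp_neg (Q : Polynomial ℂ) {b : ℝ} (hb : 0 < b) :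
    Tendsto (fun x : ℝ => (∑ i ∈ Finset.range (Q.natDegree + 1), ‖Q.coeff i‖ * x ^ i) *
      Real.exp (-b * x)) atTop (𝓝 0) := by
  simp only [Finset.sum_mul]
  rw [← Finset.sum_const_zero (s := Finset.range (Q.natDegree + 1))]
  refine tendsto_finsetSum _ fun i _ => ?_
  have h := (tendsto_rpow_mul_exp_neg_mul_atTop_nhds_zero i b hb).const_mul ‖Q.coeff i‖
  rw [mul_zero] at h
  refine h.congr fun x => ?_
  rw [Real.rpow_natCast, mul_assoc]

/-- The derivatives of `f₀(z) zᵏ` attain their maximum modulus on the lens. -/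
theorem exists_max_iteratedDeriv {θ δ τ : ℝ} (hθ0 : 0 ≤ θ) (hθ : θ < Real.pi / 2) (hδ : 0 < δ)
    (hτ : 0 < τ) (k n : ℕ) : ∃ z₀ ∈ lens δ θ, ∀ z ∈ lens δ θ,
      ‖iteratedDeriv n (fun w : ℂ => rdFun τ 0 w * w ^ k) z‖ ≤
        ‖iteratedDeriv n (fun w : ℂ => rdFun τ 0 w * w ^ k) z₀‖ := by
  obtain ⟨Q, hQ⟩ := exists_iteratedDeriv_eq τ k n
  have hpi := Real.pi_pos
  have hc : 0 < Real.cos θ := Real.cos_pos_of_mem_Ioo ⟨by linarith, hθ⟩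
  have hc1 := Real.cos_le_one θ
  set c := Real.cos θ
  -- The lens is not closed, as 0 is missing, so the problem is pulled back to the closed sector.
  -- There Re u ≥ cos θ |u|, and the exponential forces F to 0 at infinity.
  set u : ℂ → ℂ := fun l => 1 - (δ : ℂ) * l with hu
  set F : ℂ → ℝ := fun l => ‖Complex.exp (τ * (1 - u l)) * ((u l)⁻¹ ^ k * Q.eval (u l))‖ with hF
  have hre : ∀ l ∈ sector θ, 1 ≤ (u l).re := fun l hl =>
    one_sub_ne_zero_of_mem_sector hθ0 hθ hδ hl
  have hu0 : ∀ l ∈ sector θ, u l ≠ 0 := by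
    intro l hl h
    have := hre l hl
    rw [h, Complex.zero_re] at this
    linarith
  have hFeq : ∀ l ∈ sector θ,
      ‖iteratedDeriv n (fun w : ℂ => rdFun τ 0 w * w ^ k) (u l)⁻¹‖ = F l := by
    intro l hl
    rw [hQ _ (inv_ne_zero (hu0 l hl)), inv_inv]
  have hcl : IsClosed (sector θ) := by
    have : sector θ = {l | c * ‖l‖ ≤ -l.re} := by
      ext l
      exact mem_sector_iff_cos hθ0 hθ
    rw [this]
    exact isClosed_le (by fun_prop) (by fun_prop)
  have h0 : (0 : ℂ) ∈ sector θ := by simp [sector, hθ0]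
  have hcont : ContinuousOn F (sector θ) := by
    have h1 : ContinuousOn (fun l => (u l)⁻¹) (sector θ) :=
      ContinuousOn.inv₀ (by fun_prop) hu0
    have h2 : Continuous u := by fun_prop
    have h3 : Continuous fun l => Q.eval (u l) := Q.continuous.comp h2
    exact ((by fun_prop : Continuous fun l => Complex.exp (τ * (1 - u l))).continuousOn.mul
      ((h1.pow k).mul h3.continuousOn)).norm
  suffices h : ∃ l₀ ∈ sector θ, ∀ l ∈ sector θ, F l ≤ F l₀ by
    obtain ⟨l₀, hl₀, hmax⟩ := h
    refine ⟨(u l₀)⁻¹, ⟨l₀, hl₀, rfl⟩, ?_⟩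
    rintro _ ⟨l, hl, rfl⟩
    rw [hFeq l₀ hl₀]
    exact (hFeq l hl).trans_le (hmax l hl)
  -- A positive value of F is needed as the level to which decay at infinity is compared; if there
  -- is none, any point is a maximum.
  by_cases hall : ∀ l ∈ sector θ, F l ≤ 0
  · exact ⟨0, h0, fun l hl => (hall l hl).trans (norm_nonneg _)⟩
  push Not at hall
  obtain ⟨l₁, hl₁, hpos⟩ := hall
  have hbound : ∀ l ∈ sector θ, F l ≤ Real.exp τ *
      ((∑ i ∈ Finset.range (Q.natDegree + 1), ‖Q.coeff i‖ * ‖u l‖ ^ i) *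
        Real.exp (-(τ * c) * ‖u l‖)) := by
    intro l hl
    have h1 : c * ‖u l‖ ≤ (u l).re := by
      have h2 := (mem_sector_iff_cos hθ0 hθ).mp hl
      have h3 : ‖u l‖ ≤ 1 + δ * ‖l‖ := by
        refine (norm_sub_le _ _).trans ?_
        rw [norm_one, norm_mul, Complex.norm_real, Real.norm_of_nonneg hδ.le]
      have h4 : (u l).re = 1 + δ * -l.re := by
        simp only [hu, Complex.sub_re, Complex.one_re, Complex.re_ofReal_mul]
        ring
      rw [h4]
      have h5 := mul_le_mul_of_nonneg_left h2 hδ.le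
      have h6 := mul_le_mul_of_nonneg_left h3 hc.le
      nlinarith
    have h2 : ‖Complex.exp (τ * (1 - u l))‖ ≤ Real.exp τ * Real.exp (-(τ * c) * ‖u l‖) := by
      rw [Complex.norm_exp, ← Real.exp_add, Real.exp_le_exp, Complex.re_ofReal_mul, Complex.sub_re,
        Complex.one_re]
      nlinarith
    have h3 : ‖(u l)⁻¹ ^ k‖ ≤ 1 := by
      rw [norm_pow, norm_inv]
      refine pow_le_one₀ (by positivity) (inv_le_one_of_one_le₀ ?_)
      exact (hre l hl).trans (Complex.re_le_norm _)
    have h4 : ‖Q.eval (u l)‖ ≤ ∑ i ∈ Finset.range (Q.natDegree + 1), ‖Q.coeff i‖ * ‖u l‖ ^ i := by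
      rw [Polynomial.eval_eq_sum_range]
      refine norm_sum_le_of_le _ fun i _ => ?_
      rw [norm_mul, norm_pow]
    simp only [hF]
    rw [norm_mul, norm_mul]
    calc _ ≤ (Real.exp τ * Real.exp (-(τ * c) * ‖u l‖)) *
          (1 * ∑ i ∈ Finset.range (Q.natDegree + 1), ‖Q.coeff i‖ * ‖u l‖ ^ i) := by gcongr
      _ = _ := by ring
  have hlim : Tendsto (fun l => Real.exp τ *
      ((∑ i ∈ Finset.range (Q.natDegree + 1), ‖Q.coeff i‖ * ‖u l‖ ^ i) *
        Real.exp (-(τ * c) * ‖u l‖))) (cocompact ℂ) (𝓝 0) := by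
    have h1 : Tendsto (fun l => ‖u l‖) (cocompact ℂ) atTop := by
      refine tendsto_atTop_mono (f := fun l : ℂ => δ * ‖l‖ - 1) (fun l => ?_) ?_
      · have : ‖(δ : ℂ) * l‖ = δ * ‖l‖ := by
          rw [norm_mul, Complex.norm_real, Real.norm_of_nonneg hδ.le]
        have h2 := norm_sub_norm_le ((δ : ℂ) * l) 1
        rw [this, norm_one, norm_sub_rev] at h2
        exact h2
      · exact tendsto_atTop_add_const_right _ _
          ((tendsto_norm_cocompact_atTop (E := ℂ)).const_mul_atTop hδ)
    have h2 := ((tendsto_norm_eval_mul_exp_neg Q (mul_pos hτ hc)).comp h1).const_mul (Real.exp τ)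
    rw [mul_zero] at h2
    exact h2
  obtain ⟨l₀, hl₀, hmax⟩ := hcont.exists_isMaxOn' hcl hl₁ (by
    rw [eventually_inf_principal]
    filter_upwards [hlim.eventually_le_const hpos] with l hl hls
    exact (hbound l hls).trans hl)
  exact ⟨l₀, hl₀, fun l hl => hmax hl⟩

end Maximum

/-! ### Polynomial approximation of f_k -/

section Approximation

open Filter Topology

theorem summable_phi {A : Type*} [NormedRing A] [NormedAlgebra ℂ A] [CompleteSpace A] (k : ℕ)
    (a : A) : Summable fun j : ℕ => ((Nat.factorial (j + k) : ℂ)⁻¹) • a ^ j := by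
  refine Summable.of_norm_bounded (NormedSpace.norm_expSeries_summable' (𝕂 := ℂ) a) fun j => ?_
  rw [norm_smul, norm_smul, norm_inv, norm_inv, Complex.norm_natCast, Complex.norm_natCast]
  gcongr
  omega

theorem map_rdFun {A B : Type*} [NormedRing A] [NormedAlgebra ℂ A] [CompleteSpace A] [Ring B]
    [Algebra ℂ B] [TopologicalSpace B] [T2Space B] (φ : A →ₐ[ℂ] B) (hφ : Continuous φ) {a : A}
    (ha : IsUnit a) (τ : ℝ) (k : ℕ) : φ (rdFun τ k a) = rdFun τ k (φ a) := by
  obtain ⟨u, rfl⟩ := ha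
  have h1 : φ (Ring.inverse (u : A)) = Ring.inverse (φ u) := by
    have h2 : φ u = (Units.map (φ : A →* B) u : Bˣ) := rfl
    rw [h2, Ring.inverse_unit, Ring.inverse_unit, ← map_inv]
    rfl
  have h2 := ((summable_phi k ((τ : ℂ) • (1 - Ring.inverse (u : A)))).hasSum.map φ hφ).tsum_eq
  rw [rdFun, phi, ← h2, rdFun, phi]
  refine tsum_congr fun j => ?_
  rw [Function.comp_apply, map_smul, map_pow, map_smul, map_sub, map_one, h1]

/-- Under this hypothesis a is invertible within the closed algebra it generates, so the series for
f_k(a) stays in that algebra, where polynomials in a are dense. -/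
theorem exists_seq_aeval_tendsto_rdFun {A : Type*} [NormedRing A] [NormedAlgebra ℂ A]
    [CompleteSpace A] {a : A} {R : ℂ} (h : ‖a - algebraMap ℂ A R‖ < ‖R‖) (τ : ℝ) (k : ℕ) :
    ∃ P : ℕ → Polynomial ℂ,
      Tendsto (fun N => Polynomial.aeval a (P N)) atTop (𝓝 (rdFun τ k a)) := by
  set b : Algebra.elemental ℂ a := ⟨a, Algebra.elemental.self_mem ℂ a⟩
  have hb : IsUnit b := isUnit_of_norm_sub_algebraMap_lt (c := R) h
  have h1 : rdFun τ k a ∈ closure (Algebra.adjoin ℂ {a} : Set A) := by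
    have h2 := map_rdFun (Subalgebra.val (Algebra.elemental ℂ a)) continuous_subtype_val hb τ k
    rw [show rdFun τ k a = _ from h2.symm]
    exact (rdFun τ k b).2
  obtain ⟨x, hx, hlim⟩ := mem_closure_iff_seq_limit.mp h1
  have h3 : ∀ N, ∃ p : Polynomial ℂ, Polynomial.aeval a p = x N := by
    intro N
    have := hx N
    rw [SetLike.mem_coe, Algebra.adjoin_singleton_eq_range_aeval] at this
    exact this
  choose P hP using h3
  exact ⟨P, by simpa only [hP] using hlim⟩

/-- Simultaneous polynomial approximation of `f_k` on a disk and at two coercive operators. -/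
theorem exists_polynomial_approx {E F : Type*} [NormedAddCommGroup E] [InnerProductSpace ℂ E]
    [CompleteSpace E] [NormedAddCommGroup F] [InnerProductSpace ℂ F] [CompleteSpace F]
    (T₁ : E →L[ℂ] E) (T₂ : F →L[ℂ] F) {c : ℝ} (hc : 0 < c)
    (h₁ : ∀ x, c * ‖x‖ ^ 2 ≤ (inner ℂ x (T₁ x)).re) (h₂ : ∀ x, c * ‖x‖ ^ 2 ≤ (inner ℂ x (T₂ x)).re)
    (τ : ℝ) (k : ℕ) : ∃ (P : ℕ → Polynomial ℂ) (R r : ℝ), r < R ∧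
      (∀ z : ℂ, ‖z‖ ≤ 1 → c ≤ z.re → z ∈ Metric.ball (R : ℂ) r) ∧
      IsUnit T₁ ∧ IsUnit T₂ ∧
      Tendsto (fun N => Polynomial.aeval T₁ (P N)) atTop (𝓝 (rdFun τ k T₁)) ∧
      Tendsto (fun N => Polynomial.aeval T₂ (P N)) atTop (𝓝 (rdFun τ k T₂)) ∧
      TendstoUniformlyOn (fun N z => (P N).eval z) (fun z => rdFun τ k z) atTop
        (Metric.ball (R : ℂ) r) := by
  set b := max 1 (max ‖T₁‖ ‖T₂‖)
  have hb1 : 1 ≤ b := le_max_left _ _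
  -- R is large enough for both operators to lie within distance less than R of R times the
  -- identity. Since 2cR > 1, points with |z| ≤ 1 and Re z ≥ c satisfy |z - R|² ≤ R² - (2cR - 1) <
  -- R², which leaves room for r < R and keeps 0 outside the disk.
  set R := (b ^ 2 + 1) / (2 * c)
  have hR : b ^ 2 < 2 * c * R := by
    simp only [R]
    field_simp
    linarith
  have hR0 : 0 < R := by positivity
  have hR1 : 1 < 2 * c * R := by nlinarith
  obtain ⟨r, hr1, hr2⟩ := exists_between (a₁ := √(R ^ 2 - (2 * c * R - 1))) (a₂ := R) (by
    rw [Real.sqrt_lt' hR0]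
    linarith)
  have hr0 : 0 < r := (Real.sqrt_nonneg _).trans_lt hr1
  set D := Metric.closedBall (R : ℂ) r
  have hD : CompactSpace D := isCompact_iff_compactSpace.mp (isCompact_closedBall _ _)
  -- Approximating f_k at this triple gives one sequence of polynomials that serves the disk and
  -- both operators.
  set a : C(D, ℂ) × ((E →L[ℂ] E) × (F →L[ℂ] F)) :=
    (ContinuousMap.restrict D (ContinuousMap.id ℂ), (T₁, T₂)) with ha
  have haR : ‖a - algebraMap ℂ _ (R : ℂ)‖ < ‖(R : ℂ)‖ := by
    rw [Complex.norm_real, Real.norm_of_nonneg hR0.le, Prod.norm_def, max_lt_iff, Prod.norm_def,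
      max_lt_iff]
    refine ⟨?_, norm_sub_smul_id_lt T₁ hc ((le_max_left _ _).trans (le_max_right _ _)) h₁ hR,
      norm_sub_smul_id_lt T₂ hc ((le_max_right _ _).trans (le_max_right _ _)) h₂ hR⟩
    rw [ContinuousMap.norm_lt_iff _ hR0]
    intro z
    have := z.2
    rw [mem_closedBall_iff_norm] at this
    exact this.trans_lt hr2
  have hu : IsUnit a := isUnit_of_norm_sub_algebraMap_lt haR
  obtain ⟨P, hP⟩ := exists_seq_aeval_tendsto_rdFun haR τ k
  set φ₀ := AlgHom.fst ℂ C(D, ℂ) ((E →L[ℂ] E) × (F →L[ℂ] F))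
  set φ₁ := (AlgHom.fst ℂ (E →L[ℂ] E) (F →L[ℂ] F)).comp
    (AlgHom.snd ℂ C(D, ℂ) ((E →L[ℂ] E) × (F →L[ℂ] F)))
  set φ₂ := (AlgHom.snd ℂ (E →L[ℂ] E) (F →L[ℂ] F)).comp
    (AlgHom.snd ℂ C(D, ℂ) ((E →L[ℂ] E) × (F →L[ℂ] F)))
  have c0 : Continuous φ₀ := continuous_fst
  have c1 : Continuous φ₁ := continuous_fst.comp continuous_snd
  have c2 : Continuous φ₂ := continuous_snd.comp continuous_snd
  have e1 : φ₁ a = T₁ := rfl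
  have e2 : φ₂ a = T₂ := rfl
  refine ⟨P, R, r, hr2, ?_, e1 ▸ hu.map φ₁, e2 ▸ hu.map φ₂, ?_, ?_, ?_⟩
  · intro z hz1 hzc
    rw [mem_ball_iff_norm]
    refine lt_of_le_of_lt (Real.le_sqrt_of_sq_le ?_) hr1
    have h3 : ‖z - R‖ ^ 2 = ‖z‖ ^ 2 - 2 * R * z.re + R ^ 2 := by
      rw [← Complex.normSq_eq_norm_sq, ← Complex.normSq_eq_norm_sq, Complex.normSq_apply,
        Complex.normSq_apply]
      simp only [Complex.sub_re, Complex.sub_im, Complex.ofReal_re, Complex.ofReal_im]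
      ring
    rw [h3]
    have h4 : ‖z‖ ^ 2 ≤ 1 := pow_le_one₀ (norm_nonneg _) hz1
    nlinarith
  · have := (c1.tendsto _).comp hP
    rw [map_rdFun φ₁ c1 hu, e1] at this
    refine this.congr fun N => ?_
    rw [Function.comp_apply, ← Polynomial.aeval_algHom_apply, e1]
  · have := (c2.tendsto _).comp hP
    rw [map_rdFun φ₂ c2 hu, e2] at this
    refine this.congr fun N => ?_
    rw [Function.comp_apply, ← Polynomial.aeval_algHom_apply, e2]
  · have h3 := (c0.tendsto _).comp hP
    rw [map_rdFun φ₀ c0 hu] at h3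
    rw [Metric.tendstoUniformlyOn_iff]
    intro ε hε
    filter_upwards [Metric.tendsto_nhds.mp h3 ε hε] with N hN z hz
    have hzD : z ∈ D := Metric.ball_subset_closedBall hz
    have hev : Continuous (ContinuousMap.evalAlgHom ℂ ℂ (⟨z, hzD⟩ : D)) := continuous_eval_const _
    have h4 : rdFun τ k (φ₀ a) ⟨z, hzD⟩ = rdFun τ k z :=
      map_rdFun (ContinuousMap.evalAlgHom ℂ ℂ (⟨z, hzD⟩ : D)) hev (hu.map φ₀) τ k
    have h5 : φ₀ (Polynomial.aeval a (P N)) ⟨z, hzD⟩ = (P N).eval z := by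
      rw [← Polynomial.aeval_algHom_apply]
      have := (Polynomial.aeval_algHom_apply (ContinuousMap.evalAlgHom ℂ ℂ (⟨z, hzD⟩ : D))
        (φ₀ a) (P N)).symm
      rw [← Polynomial.coe_aeval_eq_eval]
      exact this
    rw [← h4, ← h5, dist_comm]
    exact (ContinuousMap.dist_apply_le_dist _).trans_lt hN

theorem phi_eq_add_mul (k : ℕ) (a : ℂ) :
    phi k a = (Nat.factorial k : ℂ)⁻¹ + a * phi (k + 1) a := by
  rw [phi, (phi_summable k a).tsum_eq_zero_add, phi, ← tsum_mul_left]
  simp only [zero_add, pow_zero, smul_eq_mul, mul_one]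
  congr 1
  refine tsum_congr fun j => ?_
  rw [show j + (k + 1) = j + 1 + k by omega, pow_succ]
  ring

theorem phi_zero_eq_sum_add (k : ℕ) (a : ℂ) :
    phi 0 a = ∑ j ∈ Finset.range k, (Nat.factorial j : ℂ)⁻¹ * a ^ j + a ^ k * phi k a := by
  induction k with
  | zero => simp
  | succ k ih =>
    rw [ih, Finset.sum_range_succ, phi_eq_add_mul k]
    ring

/-- The polynomial `zᵏ ∑_{j<k} (τ (1 - 1/z))ʲ / j!`. -/
def taylorPart (τ : ℝ) (k : ℕ) : Polynomial ℂ :=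
  ∑ j ∈ Finset.range k, Polynomial.C ((Nat.factorial j : ℂ)⁻¹ * (τ : ℂ) ^ j) *
    ((Polynomial.X - Polynomial.C 1) ^ j * Polynomial.X ^ (k - j))

theorem degree_taylorPart_le (τ : ℝ) (k : ℕ) : (taylorPart τ k).degree ≤ k := by
  refine (Polynomial.degree_sum_le _ _).trans (Finset.sup_le fun j hj => ?_)
  rw [Finset.mem_range] at hj
  rw [← Polynomial.smul_eq_C_mul]
  refine (Polynomial.degree_smul_le _ _).trans ?_
  rw [Polynomial.degree_mul, Polynomial.degree_pow, Polynomial.degree_X_sub_C,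
    Polynomial.degree_X_pow, nsmul_eq_mul, mul_one, ← Nat.cast_add, Nat.cast_le]
  exact (Nat.add_sub_cancel' hj.le).le

/-- Taylor's formula for exp at τ(1 - 1/z), multiplied by z^k: the factor z^k clears the
denominators and turns the remainder's factor into τ^k (z - 1)^k. -/
theorem rdFun_zero_mul_pow (τ : ℝ) (k : ℕ) {z : ℂ} (hz : z ≠ 0) :
    rdFun τ 0 z * z ^ k =
      (τ : ℂ) ^ k * (z - 1) ^ k * rdFun τ k z + (taylorPart τ k).eval z := by
  have h1 : ((τ : ℂ) • (1 - Ring.inverse z)) * z = τ * (z - 1) := by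
    rw [Ring.inverse_eq_inv, smul_eq_mul]
    field_simp
  rw [rdFun, rdFun, phi_zero_eq_sum_add k, add_mul, add_comm, taylorPart,
    Polynomial.eval_finsetSum, Finset.sum_mul]
  set a := (τ : ℂ) • (1 - Ring.inverse z)
  congr 1
  · rw [← mul_pow, ← h1, mul_pow]
    exact mul_right_comm _ _ _
  · refine Finset.sum_congr rfl fun j hj => ?_
    rw [Finset.mem_range] at hj
    simp only [Polynomial.eval_mul, Polynomial.eval_C, Polynomial.eval_pow, Polynomial.eval_sub,
      Polynomial.eval_X]
    have h2 : z ^ k = z ^ j * z ^ (k - j) := by rw [← pow_add, Nat.add_sub_cancel' hj.le]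
    have h3 : (τ : ℂ) ^ j * (z - 1) ^ j = a ^ j * z ^ j := by rw [← mul_pow, ← h1, mul_pow]
    rw [h2]
    linear_combination (-(Nat.factorial j : ℂ)⁻¹ * z ^ (k - j)) * h3

/-- Derivatives of locally uniformly convergent polynomials converge. -/
theorem tendstoLocallyUniformlyOn_iterate_derivative {P : ℕ → Polynomial ℂ} {f : ℂ → ℂ} {U : Set ℂ}
    (hU : IsOpen U) (h : TendstoLocallyUniformlyOn (fun N z => (P N).eval z) f atTop U) (n : ℕ) :
    TendstoLocallyUniformlyOn (fun N z => (Polynomial.derivative^[n] (P N)).eval z)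
      (iteratedDeriv n f) atTop U := by
  induction n with
  | zero => simpa using h
  | succ n ih =>
    have h1 := ih.deriv (Eventually.of_forall fun N =>
      (Polynomial.differentiable _).differentiableOn) hU
    rw [iteratedDeriv_succ]
    convert h1 using 2 with N
    ext z
    rw [Function.comp_apply, Polynomial.deriv, Function.iterate_succ_apply']

/-- Polynomials close to `f_k` yield polynomials whose derivatives are close to those of
`f₀(z) zᵏ`. -/
theorem eventually_norm_iterate_derivative_le {P : ℕ → Polynomial ℂ} {τ R r : ℝ} {k n : ℕ}
    (hrR : r < R) (h : TendstoUniformlyOn (fun N z => (P N).eval z) (fun z => rdFun τ k z) atTop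
      (Metric.ball (R : ℂ) r)) {S : Set ℂ} (hS : IsCompact S) (hSU : S ⊆ Metric.ball (R : ℂ) r)
    {b : ℝ} (hb : ∀ z ∈ S, ‖iteratedDeriv n (fun w : ℂ => rdFun τ 0 w * w ^ k) z‖ ≤ b)
    {ε : ℝ} (hε : 0 < ε) : ∀ᶠ N in atTop, ∀ z ∈ S,
      ‖(Polynomial.derivative^[n] (Polynomial.C ((τ : ℂ) ^ k) *
        (Polynomial.X - Polynomial.C 1) ^ k * P N + taylorPart τ k)).eval z‖ ≤ b + ε := by
  set U := Metric.ball (R : ℂ) r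
  have hU0 : ∀ z ∈ U, z ≠ 0 := by
    rintro z hz rfl
    rw [mem_ball_iff_norm, zero_sub, norm_neg, Complex.norm_real, Real.norm_eq_abs] at hz
    linarith [le_abs_self R]
  obtain ⟨D, hD⟩ := (isCompact_closedBall (R : ℂ) r).exists_bound_of_continuousOn
    (f := fun z => (τ : ℂ) ^ k * (z - 1) ^ k) (by fun_prop)
  have hlim : TendstoUniformlyOn (fun N z => (Polynomial.C ((τ : ℂ) ^ k) *
      (Polynomial.X - Polynomial.C 1) ^ k * P N + taylorPart τ k).eval z)
      (fun w : ℂ => rdFun τ 0 w * w ^ k) atTop U := by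
    rw [Metric.tendstoUniformlyOn_iff] at h ⊢
    intro η hη
    filter_upwards [h (η / (|D| + 1)) (by positivity)] with N hN z hz
    rw [rdFun_zero_mul_pow τ k (hU0 z hz), dist_eq_norm]
    have h1 := hN z hz
    rw [dist_eq_norm, lt_div_iff₀ (by positivity)] at h1
    have h2 := hD z (Metric.ball_subset_closedBall hz)
    have h3 : (τ : ℂ) ^ k * (z - 1) ^ k * rdFun τ k z + (taylorPart τ k).eval z -
        (Polynomial.C ((τ : ℂ) ^ k) * (Polynomial.X - Polynomial.C 1) ^ k * P N +
          taylorPart τ k).eval z = (τ : ℂ) ^ k * (z - 1) ^ k * (rdFun τ k z - (P N).eval z) := by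
      simp only [Polynomial.eval_add, Polynomial.eval_mul, Polynomial.eval_C, Polynomial.eval_pow,
        Polynomial.eval_sub, Polynomial.eval_X]
      ring
    rw [h3, norm_mul]
    refine lt_of_le_of_lt (mul_le_mul_of_nonneg_right (h2.trans ((le_abs_self D).trans
      (le_add_of_nonneg_right zero_le_one))) (norm_nonneg _)) ?_
    rw [mul_comm]
    exact h1
  have h1 := tendstoLocallyUniformlyOn_iterate_derivative Metric.isOpen_ball
    hlim.tendstoLocallyUniformlyOn n
  have h2 := (tendstoLocallyUniformlyOn_iff_forall_isCompact Metric.isOpen_ball).mp h1 S hSU hS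
  filter_upwards [Metric.tendstoUniformlyOn_iff.mp h2 ε hε] with N hN z hz
  have h3 := hN z hz
  rw [dist_eq_norm, norm_sub_rev] at h3
  have h4 := norm_sub_norm_le ((Polynomial.derivative^[n] (Polynomial.C ((τ : ℂ) ^ k) *
    (Polynomial.X - Polynomial.C 1) ^ k * P N + taylorPart τ k)).eval z)
    (iteratedDeriv n (fun w : ℂ => rdFun τ 0 w * w ^ k) z)
  linarith [hb z hz]

end Approximation

/-! ### The error bound -/

section ErrorBound

open Filter Topology

theorem mem_opRange_of_mem_spectrum {n : ℕ} {A : Matrix (Fin n) (Fin n) ℂ} {μ : ℂ}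
    (h : μ ∈ spectrum ℂ A) : μ ∈ opRange (op A) := by
  by_contra hμ
  refine h (isUnit_op_of_injective fun x hx => ?_)
  by_contra hx0
  obtain ⟨w, hw, hxw⟩ := exists_opRange_inner_eq (op A) hx0
  have h1 : op A x = μ • x := by
    rw [op, map_sub, AlgHomClass.commutes, sub_apply, sub_eq_zero] at hx
    rw [op, ← hx, Algebra.algebraMap_eq_smul_one]
    rfl
  have h2 : ((‖x‖ : ℂ)) ^ 2 ≠ 0 := by
    simpa using hx0
  rw [h1, inner_smul_right, inner_self_eq_norm_sq_to_K, mul_comm] at hxw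
  exact hμ (mul_left_cancel₀ h2 hxw ▸ hw)

theorem charpoly_eq_list_prod {n : ℕ} (A : Matrix (Fin n) (Fin n) ℂ) :
    ∃ l : List ℂ, l.length = n ∧ (∀ a ∈ l, a ∈ opRange (op A)) ∧
      A.charpoly = (l.map fun a => Polynomial.X - Polynomial.C a).prod := by
  have hs : A.charpoly.Splits := IsAlgClosed.splits _
  have h1 := hs.eq_prod_roots_of_monic A.charpoly_monic
  have h2 : A.charpoly.roots.card = n := by
    rw [← hs.natDegree_eq_card_roots, Matrix.charpoly_natDegree_eq_dim, Fintype.card_fin]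
  refine ⟨A.charpoly.roots.toList, by rw [Multiset.length_toList, h2], fun a ha => ?_, ?_⟩
  · rw [Multiset.mem_toList] at ha
    exact mem_opRange_of_mem_spectrum
      (Matrix.mem_spectrum_of_isRoot_charpoly (Polynomial.isRoot_of_mem_roots ha))
  · conv_lhs => rw [h1]
    conv_lhs => rw [← Multiset.coe_toList A.charpoly.roots]
    rw [Multiset.map_coe, Multiset.prod_coe]

/-- `map_rdFun` needs a normed algebra as source, so the isomorphism is used from operators to
matrices and then inverted. -/
theorem op_rdFun {n : ℕ} {A : Matrix (Fin n) (Fin n) ℂ} (hA : IsUnit (op A)) (τ : ℝ) (k : ℕ) :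
    op (rdFun τ k A) = rdFun τ k (op A) := by
  set e := (Matrix.toEuclideanCLM (n := Fin n) (𝕜 := ℂ)).symm
  set φ : (EuclideanSpace ℂ (Fin n) →L[ℂ] EuclideanSpace ℂ (Fin n)) →ₐ[ℂ]
    Matrix (Fin n) (Fin n) ℂ := (e : _ ≃⋆ₐ[ℂ] _).toAlgEquiv.toAlgHom
  have hφ : Continuous φ := φ.toLinearMap.continuous_of_finiteDimensional
  have h1 := map_rdFun φ hφ hA τ k
  have h2 : φ (op A) = A := e.apply_symm_apply A
  rw [h2] at h1
  rw [← h1]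
  exact (Matrix.toEuclideanCLM (n := Fin n) (𝕜 := ℂ)).apply_symm_apply _

theorem rdFun_shiftInv {n : ℕ} {L : Matrix (Fin n) (Fin n) ℂ} {h δ : ℝ} (hδ : 0 < δ)
    (hu : IsUnit (1 - (δ : ℂ) • L)) (k : ℕ) :
    rdFun (h / δ) k (shiftInv δ L) = phi k ((h : ℂ) • L) := by
  obtain ⟨u, hu⟩ := hu
  have h1 : Ring.inverse (shiftInv δ L) = 1 - (δ : ℂ) • L := by
    rw [shiftInv, Matrix.nonsing_inv_eq_ringInverse, ← hu, Ring.inverse_unit, Ring.inverse_unit,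
      inv_inv]
  have h2 : (δ : ℂ) ≠ 0 := by exact_mod_cast hδ.ne'
  rw [rdFun, h1, sub_sub_cancel, smul_smul, Complex.ofReal_div, div_mul_cancel₀ _ h2]

/-- Besides the eigenvalues of H, the node 1 is used k times: τ^k (P /ₘ q) is the quotient of the
displayed polynomial by (X - 1)^k q, so m+k nodes produce (m+k)! and the factor τ^k. -/
theorem norm_quotient_eval_le {m k : ℕ} (hm : 1 ≤ m) {H : Matrix (Fin m) (Fin m) ℂ} {S : Set ℂ}
    (hS : Convex ℝ S) (h1 : (1 : ℂ) ∈ S) (hH : opRange (op H) ⊆ S) {τ : ℝ} (hτ : 0 < τ)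
    (P : Polynomial ℂ) {c : ℝ}
    (hc : ∀ z ∈ S, ‖(Polynomial.derivative^[m + k] (Polynomial.C ((τ : ℂ) ^ k) *
        (Polynomial.X - Polynomial.C 1) ^ k * P + taylorPart τ k)).eval z‖ ≤ c)
    {z : ℂ} (hz : z ∈ S) :
    ‖(P /ₘ H.charpoly).eval z‖ ≤ c * (1 / (τ ^ k * ((m + k).factorial : ℝ))) := by
  obtain ⟨l, hlen, hl, hq⟩ := charpoly_eq_list_prod H
  set q := H.charpoly
  have hqm : q.Monic := H.charpoly_monic
  have hqd : q.degree = m := by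
    rw [Matrix.charpoly_degree_eq_dim, Fintype.card_fin]
  have hlen' : (l ++ List.replicate k 1).length = m + k := by simp [hlen]
  have key := norm_eval_quotient_le hS (l ++ List.replicate k 1)
    (B := Polynomial.C ((τ : ℂ) ^ k) * (Polynomial.X - Polynomial.C 1) ^ k * P + taylorPart τ k)
    (g := Polynomial.C ((τ : ℂ) ^ k) * (P /ₘ q))
    (R := Polynomial.C ((τ : ℂ) ^ k) * ((Polynomial.X - Polynomial.C 1) ^ k * (P %ₘ q)) +
      taylorPart τ k) (c := c) (fun a ha => ?_) ?_ ?_ (by rwa [hlen']) hz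
  · rw [hlen', Polynomial.eval_mul, Polynomial.eval_C, norm_mul, norm_pow, Complex.norm_real,
      Real.norm_of_nonneg hτ.le] at key
    have h3 : 0 < τ ^ k := pow_pos hτ k
    have h4 : (0 : ℝ) < ((m + k).factorial : ℝ) := by positivity
    rw [le_div_iff₀ h4] at key
    rw [mul_one_div, le_div_iff₀ (by positivity)]
    linarith
  · rcases List.mem_append.mp ha with ha | ha
    · exact hH (hl a ha)
    · rw [List.eq_of_mem_replicate ha]
      exact h1
  · rw [List.map_append, List.prod_append, ← hq, List.map_replicate, List.prod_replicate]
    conv_lhs => rw [← Polynomial.modByMonic_add_div P q]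
    ring
  · rw [hlen']
    refine (Polynomial.degree_add_le _ _).trans_lt (max_lt ?_ ?_)
    · rw [← Polynomial.smul_eq_C_mul]
      refine (Polynomial.degree_smul_le _ _).trans_lt ?_
      by_cases hr : P %ₘ q = 0
      · rw [hr, mul_zero, Polynomial.degree_zero]
        exact WithBot.bot_lt_coe _
      · have h6 := Polynomial.degree_modByMonic_lt P hqm
        rw [hqd, ← Polynomial.natDegree_lt_iff_degree_lt hr] at h6
        rw [Polynomial.degree_mul, Polynomial.degree_pow, Polynomial.degree_X_sub_C,
          Polynomial.degree_eq_natDegree hr, nsmul_eq_mul, mul_one, ← Nat.cast_add, Nat.cast_lt]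
        omega
    -- Degree at most k is less than m+k because m ≥ 1.
    · refine (degree_taylorPart_le τ k).trans_lt ?_
      rw [Nat.cast_lt]
      omega

/-- The error bound, for any constant `K` for which the numerical range of `Z` is a `K`-spectral
set. -/
theorem norm_rdError_le {M : ℕ} (L : Matrix (Fin M) (Fin M) ℂ) (v : EuclideanSpace ℂ (Fin M))
    {θ h δ : ℝ} {k m : ℕ} (hθ0 : 0 ≤ θ) (hθ : θ < Real.pi / 2) (hh : 0 < h) (hδ : 0 < δ)
    (hL : opRange (op L) ⊆ sector θ) (hv : ‖v‖ = 1) (hm : 1 ≤ m)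
    (hbreak : ∀ i : ℕ, i + 1 < m → arnoldiCoeff (shiftInv δ L) v (i + 1) i ≠ 0) {K : ℝ}
    (hK0 : 0 ≤ K) (hK : ∀ (p : Polynomial ℂ) (C : ℝ), 0 ≤ C →
      (∀ z ∈ opRange (op (shiftInv δ L)), ‖p.eval z‖ ≤ C) →
      ‖op (Polynomial.aeval (shiftInv δ L) p)‖ ≤ K * C) {b : ℝ}
    (hb : ∀ z ∈ lens δ θ,
      ‖iteratedDeriv (m + k) (fun w : ℂ => rdFun (h / δ) 0 w * w ^ k) z‖ ≤ b) :
    ‖rdError L v h δ k m‖ ≤ K * (1 / ((h / δ) ^ k * ((m + k).factorial : ℝ))) * b *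
      ∏ i ∈ Finset.range m, ‖arnoldiCoeff (shiftInv δ L) v (i + 1) i‖ := by
  set τ := h / δ
  have hτ : 0 < τ := div_pos hh hδ
  set Z := shiftInv δ L with hZ
  set H := arnoldiHess Z v m with hH
  have : Nontrivial (EuclideanSpace ℂ (Fin M)) :=
    ⟨v, 0, fun h0 => by rw [h0, norm_zero] at hv; exact zero_ne_one hv⟩
  have hZr := fun z (hz : z ∈ opRange (op Z)) => opRange_shiftInv_subset hθ0 hθ hδ hL hz
  obtain ⟨w, hw, hwmin⟩ := (isCompact_opRange (op Z)).exists_isMinOn (opRange_nonempty (op Z))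
    Complex.continuous_re.continuousOn
  -- Compactness gives a positive lower bound of Re on F(Z). Taking the minimum with 1 keeps the
  -- node 1 in S, while c > 0 keeps S away from the singularity at 0.
  set c := min w.re 1
  have hc : 0 < c := lt_min (hZr w hw).2 one_pos
  set S := {z ∈ diskInter θ | c ≤ z.re}
  have hZS : opRange (op Z) ⊆ S := fun z hz =>
    ⟨(hZr z hz).1, (min_le_left _ _).trans (hwmin hz)⟩
  have hHS : opRange (op H) ⊆ S := (opRange_arnoldiHess_subset Z v hv hbreak).trans hZS
  have h1S : (1 : ℂ) ∈ S := ⟨one_mem_diskInter θ, min_le_right _ _⟩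
  have hSconv : Convex ℝ S := (convex_diskInter hθ0 hθ).inter (convex_halfSpace_re_ge c)
  have hSlens : S ⊆ lens δ θ := fun z hz => (mem_lens_iff hθ0 hθ hδ).mpr
    ⟨fun h0 => by have := hz.2; rw [h0, Complex.zero_re] at this; linarith, hz.1⟩
  have hScomp : IsCompact S := by
    refine (isCompact_closedBall (0 : ℂ) 1).of_isClosed_subset ((isClosed_diskInter θ).inter
      (isClosed_le continuous_const Complex.continuous_re)) fun z hz => ?_
    rw [mem_closedBall_zero_iff]
    exact norm_le_one_of_mem_diskInter hz.1
  have hcoer : ∀ {n : ℕ} (A : Matrix (Fin n) (Fin n) ℂ), opRange (op A) ⊆ S → ∀ x,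
      c * ‖x‖ ^ 2 ≤ (inner ℂ x (op A x)).re := by
    intro n A hA x
    have := re_mul_inner_ge (op A) (ω := 1) (c := c) (fun z hz => by
      rw [one_mul]; exact (hA hz).2) x
    rwa [one_mul] at this
  obtain ⟨P, R, r, hrR, hball, hu1, hu2, hlim1, hlim2, hunif⟩ :=
    exists_polynomial_approx (op Z) (op H) hc (hcoer Z hZS) (hcoer H hHS) τ k
  have hSU : S ⊆ Metric.ball (R : ℂ) r := fun z hz =>
    hball z (norm_le_one_of_mem_diskInter hz.1) hz.2
  have hb0 : 0 ≤ b := (norm_nonneg _).trans (hb 1 (hSlens h1S))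
  set lin : EuclideanSpace ℂ (Fin m) →ₗ[ℂ] EuclideanSpace ℂ (Fin M) :=
    (arnoldiLin Z v m).comp (WithLp.linearEquiv 2 ℂ (Fin m → ℂ)).toLinearMap
  have hlin : Continuous lin := lin.continuous_of_finiteDimensional
  have hlinop : ∀ A : Matrix (Fin m) (Fin m) ℂ, arnoldiLin Z v m (A *ᵥ firstVec m) =
      lin (op A (WithLp.toLp 2 (firstVec m))) := fun A => rfl
  have herr : Tendsto (fun N => op (Polynomial.aeval Z (P N)) v -
      arnoldiLin Z v m (Polynomial.aeval H (P N) *ᵥ firstVec m)) atTop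
      (𝓝 (rdError L v h δ k m)) := by
    have e1 : rdError L v h δ k m = rdFun τ k (op Z) v -
        lin (rdFun τ k (op H) (WithLp.toLp 2 (firstVec m))) := by
      rw [← op_rdFun hu1, ← op_rdFun hu2, ← hlinop, hZ,
        rdFun_shiftInv hδ (isUnit_one_sub_smul hθ0 hθ hδ hL), rdError, arnoldiApprox,
        toLp_arnoldiBasis_mulVec]
      rfl
    rw [e1]
    simp only [hlinop, op_aeval]
    refine Tendsto.sub ?_ ((hlin.tendsto _).comp ?_)
    · exact ((ContinuousLinearMap.apply ℂ _ v).continuous.tendsto _).comp hlim1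
    · exact ((ContinuousLinearMap.apply ℂ _
        (WithLp.toLp 2 (firstVec m))).continuous.tendsto _).comp hlim2
  refine le_of_forall_pos_le_add fun η hη => ?_
  set D := K * (1 / (τ ^ k * ((m + k).factorial : ℝ))) *
    ∏ i ∈ Finset.range m, ‖arnoldiCoeff Z v (i + 1) i‖ with hD
  have hD0 : 0 ≤ D := by positivity
  have hbound : ∀ ε > 0, ‖rdError L v h δ k m‖ ≤ D * (b + ε) := by
    intro ε hε
    refine le_of_tendsto herr.norm ?_
    filter_upwards [eventually_norm_iterate_derivative_le hrR hunif hScomp hSU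
      (fun z hz => hb z (hSlens hz)) hε] with N hN
    rw [op_aeval_sub_arnoldiLin Z v hv hm]
    have h2 := hK (P N /ₘ H.charpoly) _ (by positivity) fun z hz =>
      norm_quotient_eval_le hm hSconv h1S hHS hτ (P N) hN (hZS hz)
    -- The last Arnoldi vector has norm at most 1, also after a breakdown at step m, when it is 0.
    refine (ContinuousLinearMap.le_opNorm _ _).trans ?_
    rw [norm_smul, norm_prod]
    refine (mul_le_mul h2 (mul_le_of_le_one_right (by positivity)
      (norm_arnoldiVec_le Z v hv m)) (by positivity) (by positivity)).trans_eq ?_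
    rw [hD]
    ring
  -- Dividing by D + 1 rather than D covers D = 0.
  have h3 := hbound (η / (D + 1)) (by positivity)
  have h4 : D * (η / (D + 1)) ≤ η := by
    rw [mul_div_assoc', div_le_iff₀ (by positivity)]
    nlinarith
  calc _ ≤ D * b + D * (η / (D + 1)) := by rw [← mul_add]; exact h3
    _ ≤ D * b + η := by gcongr
    _ = _ := by rw [hD]; ring

/-- For a self-adjoint operator the functional calculus bounds the norm by the supremum over the
spectrum, which lies in the numerical range. -/
theorem norm_op_aeval_le_of_isHermitian {n : ℕ} {A : Matrix (Fin n) (Fin n) ℂ}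
    (hA : A.IsHermitian) (p : Polynomial ℂ) {C : ℝ} (hC : 0 ≤ C)
    (h : ∀ z ∈ opRange (op A), ‖p.eval z‖ ≤ C) : ‖op (Polynomial.aeval A p)‖ ≤ C := by
  have hsa : IsSelfAdjoint (op A) := IsSelfAdjoint.map hA _
  have hn : IsStarNormal (op A) := hsa.isStarNormal
  rw [op_aeval, ← cfc_polynomial p (op A)]
  refine norm_cfc_le hC fun z hz => h z (mem_opRange_of_mem_spectrum ?_)
  rwa [op, AlgEquiv.spectrum_eq] at hz

theorem isHermitian_shiftInv {n : ℕ} {L : Matrix (Fin n) (Fin n) ℂ} (hL : L.IsHermitian) (δ : ℝ) :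
    (shiftInv δ L).IsHermitian := by
  refine Matrix.IsHermitian.inv ?_
  rw [Matrix.IsHermitian, Matrix.conjTranspose_sub, Matrix.conjTranspose_one,
    Matrix.conjTranspose_smul, hL.eq]
  simp

end ErrorBound

end RDArnoldi

end

/-! ### The main theorem -/

open RDArnoldi in
theorem proposition2 {M : ℕ} (L : Matrix (Fin M) (Fin M) ℂ) (v : EuclideanSpace ℂ (Fin M))
    (θ h δ : ℝ) (k m : ℕ) (hθ0 : 0 ≤ θ) (hθ : θ < Real.pi / 2) (hh : 0 < h) (hδ : 0 < δ)
    (hL : numericalRange L ⊆ sector θ) (hv : ‖v‖ = 1) (hm : 1 ≤ m)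
    (hbreak : ∀ i : ℕ, i + 1 < m → arnoldiCoeff (shiftInv δ L) v (i + 1) i ≠ 0) :
    (2 ≤ crouzeixConstant ∧ crouzeixConstant ≤ 11.08) ∧
    ∃ z₀ ∈ lens δ θ,
      (∀ z ∈ lens δ θ,
        ‖iteratedDeriv (m + k) (fun w : ℂ => rdFun (h / δ) 0 w * w ^ k) z‖ ≤
          ‖iteratedDeriv (m + k) (fun w : ℂ => rdFun (h / δ) 0 w * w ^ k) z₀‖) ∧
      ‖rdError L v h δ k m‖ ≤
        crouzeixConstant * (1 / ((h / δ) ^ k * (Nat.factorial (m + k) : ℝ))) *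
          ‖iteratedDeriv (m + k) (fun w : ℂ => rdFun (h / δ) 0 w * w ^ k) z₀‖ *
          ∏ i ∈ Finset.range m, ‖arnoldiCoeff (shiftInv δ L) v (i + 1) i‖ ∧
      (L.IsHermitian →
        ‖rdError L v h δ k m‖ ≤
          1 / ((h / δ) ^ k * (Nat.factorial (m + k) : ℝ)) *
            ‖iteratedDeriv (m + k) (fun w : ℂ => rdFun (h / δ) 0 w * w ^ k) z₀‖ *
            ∏ i ∈ Finset.range m, ‖arnoldiCoeff (shiftInv δ L) v (i + 1) i‖) := by
  have hL' : opRange (op L) ⊆ sector θ := numericalRange_eq_opRange L ▸ hL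
  obtain ⟨z₀, hz₀, hmax⟩ := exists_max_iteratedDeriv hθ0 hθ hδ (div_pos hh hδ) k (m + k)
  -- The upper bound 11.08 follows from the sharper value 3.
  refine ⟨⟨two_le_crouzeixConstant, crouzeixConstant_le_three.trans (by norm_num)⟩, z₀, hz₀, hmax,
    ?_, fun hHerm => ?_⟩
  · refine norm_rdError_le L v hθ0 hθ hh hδ hL' hv hm hbreak
      (zero_le_two.trans two_le_crouzeixConstant) (fun p C hC hp => ?_) hmax
    refine isCrouzeixBound_crouzeixConstant _ _ p C hC ?_
    rwa [numericalRange_eq_opRange]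
  · have := norm_rdError_le L v hθ0 hθ hh hδ hL' hv hm hbreak zero_le_one (fun p C hC hp => by
      rw [one_mul]
      exact norm_op_aeval_le_of_isHermitian (isHermitian_shiftInv hHerm δ) p hC hp) hmax
    rwa [one_mul] at this
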